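/- **Setting.** Let $(\Omega,\mathcal F,P)$ be a probability space, and let $X=\{X_t\}_{t\ge 0}$ be a right-continuous process with left limits (RCLL) on it, which is a finite-state Markov chain with values in the unit vectors $\{e_1,\dots,e_N\}$ of $\mathbb R^N$. Its rate matrix $A_t$ is deterministic, measurable in $t$ and has bounded entries; off-diagonal entries are nonnegative and columns sum to $0$. Let $\{\mathcal F_t\}$ be the completed natural filtration of $X$. Then $M_t=X_t-X_0-\int_0^tA_sX_s\,ds$ is a martingale. Put $$\Psi_t=\operatorname{diag}(A_tX_{t-})-\operatorname{diag}(X_{t-})A_t'-A_t\operatorname{diag}(X_{t-}),\qquad \|z\|_{X_t}^2=z'\Psi_tz\quad(z\in\mathbb R^N),$$ with $X_{0-}=X_0$, and let $\Psi_t^\dagger$ be the Moore–Penrose pseudoinverse of $\Psi_t$. Matrix norms are operator norms for the Euclidean norm. Fix $T\ge 0$ and $m>0$ with $\|A_t\|\le m$ for all $t\in[0,T]$. **Data.** Let $c',c''\ge 0$ and let $f:\Omega\times[0,T]\times\mathbb R\times\mathbb R^N\to\mathbb R$ be measurable with respect to the product of the predictable and the Borel $\sigma$-algebras, with $E\int_0^T|f(t,0,0)|^2dt<\infty$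 and, almost surely, for all $t\in[0,T]$, $v_1,v_2\in\mathbb R$, $z_1,z_2\in\mathbb R^N$, $$|f(t,v_1,z_1)-f(t,v_2,z_2)|\le c'|v_1-v_2|+c''\|z_1-z_2\|_{X_t},\qquad c''\,\|\Psi_t^\dagger\|\,\sqrt{6m}<1 .$$ For $i=1,2$ let $\xi_i\in L^2(\mathcal F_T)$, let $\varphi^{(i)}$ be a predictable process with $E\int_0^T|\varphi^{(i)}_t|^2dt<\infty$, and let $G^{(i)}$ be a progressively measurable process with $E[\sup_{t\in[0,T]}((G^{(i)}_t)^+)^2]<\infty$. Let $(V^{(i)},Z^{(i)},K^{(i)})$ be such that $V^{(i)}$ is adapted and RCLL with $E\int_0^T|V^{(i)}_t|^2dt<\infty$, $Z^{(i)}$ is predictable and $\mathbb R^N$-valued with $E\int_0^T\|Z^{(i)}_t\|_{X_t}^2dt<\infty$, $K^{(i)}_T\in L^2(\mathcal F_T)$, and, almost surely, $$V^{(i)}_t=\xi_i+\int_t^T\bigl(f(s,V^{(i)}_s,Z^{(i)}_s)+\varphi^{(i)}_s\bigr)ds+K^{(i)}_T-K^{(i)}_t-\int_t^T(Z^{(i)}_s)'dM_s,\qquad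 V^{(i)}_t\ge G^{(i)}_t,\qquad t\in[0,T],$$ where $K^{(i)}$ is continuous and nondecreasing on $[0,T]$ with $K^{(i)}_0=0$ and $\int_0^T(V^{(i)}_s-G^{(i)}_s)\,dK^{(i)}_s=0$. **Claim.** Put $v=V^{(1)}-V^{(2)}$, $z=Z^{(1)}-Z^{(2)}$, $k=K^{(1)}-K^{(2)}$. There is a constant $\bar C>0$, depending only on $c'$, $c''$, $T$ and the bound $m$ on the rates of the chain, such that $$\sup_{t\in[0,T]}E[|v_t|^2]+E\Bigl[\int_0^T\|z_t\|_{X_t}^2dt\Bigr]+\sup_{t\in[0,T]}E[|k_T-k_t|^2]\le\bar C\,E\Bigl[|\xi_1-\xi_2|^2+\Bigl(\int_0^T|\varphi^{(1)}_t-\varphi^{(2)}_t|dt\Bigr)^2+\sup_{t\in[0,T]}|G^{(1)}_t-G^{(2)}_t|^2\Bigr]$$ and $$E\Bigl[\sup_{t\in[0,T]}|v_t+k_t|^2+\int_0^T\|z_t\|_{X_t}^2dt\Bigr]\le\bar C\,E\Bigl[|\xi_1-\xi_2|^2+\Bigl(\int_0^T|\varphi^{(1)}_t-\varphi^{(2)}_t|dt\Bigr)^2+\sup_{t\in[0,T]}|G^{(1)}_t-G^{(2)}_t|^2\Bigr].$$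 (The right-hand sides may be $+\infty$.) -/

import Mathlib

open MeasureTheory Filter Topology
open scoped NNReal ENNReal Matrix

noncomputable section

namespace MarkovRBSDE

/-- Lebesgue measure on the half-line `[0, ∞)`. -/
def lebesgue : Measure ℝ≥0 := (volume : Measure ℝ).comap (fun s : ℝ≥0 => (s : ℝ))

/-- Paths on `[0, T]` that are right continuous with left limits. -/
def RCLLOn {E : Type*} [TopologicalSpace E] (T : ℝ≥0) (x : ℝ≥0 → E) : Prop :=
  (∀ t < T, ContinuousWithinAt x (Set.Ici t) t) ∧
    ∀ t ≤ T, ∃ l : E, Tendsto x (𝓝[<] t) (𝓝 l)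

/-- `B` is the Moore-Penrose pseudoinverse of the square matrix `Q`. -/
structure IsMoorePenrose {N : ℕ} (Q B : Matrix (Fin N) (Fin N) ℝ) : Prop where
  mul_mul_self : Q * B * Q = Q
  mul_mul_inv : B * Q * B = B
  transpose_mul : (Q * B)ᵀ = Q * B
  transpose_inv_mul : (B * Q)ᵀ = B * Q

/-- The operator norm of a square matrix for the Euclidean norm. -/
def matrixNorm {N : ℕ} (Q : Matrix (Fin N) (Fin N) ℝ) : ℝ :=
  ‖Matrix.toEuclideanCLM (n := Fin N) (𝕜 := ℝ) Q‖

variable {Ω : Type*} [mΩ : MeasurableSpace Ω]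

/-- The natural filtration of a process `X`, augmented by the `P`-null events. -/
def completedFiltration (P : Measure Ω) {N : ℕ} (X : ℝ≥0 → Ω → (Fin N → ℝ))
    (hX : ∀ t, Measurable (X t)) : Filtration ℝ≥0 mΩ where
  seq t := (⨆ s ≤ t, MeasurableSpace.comap (X s) inferInstance) ⊔
    MeasurableSpace.generateFrom {B | MeasurableSet B ∧ P B = 0}
  mono' _ _ hst := sup_le_sup_right (biSup_mono fun _ h => h.trans hst) _
  le' _ := sup_le (iSup₂_le fun s _ => (hX s).comap_le)
    (MeasurableSpace.generateFrom_le fun _ h => h.1)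

/-- `A` is a bounded measurable family of rate matrices, in the convention where `A t j i` is the
rate of the jumps from state `i` to state `j` at time `t`. -/
structure IsRateMatrix {N : ℕ} (A : ℝ≥0 → Matrix (Fin N) (Fin N) ℝ) : Prop where
  measurable : ∀ i j, Measurable fun t => A t i j
  bounded : ∃ b : ℝ, ∀ t i j, |A t i j| ≤ b
  nonneg : ∀ t i j, i ≠ j → 0 ≤ A t i j
  sum_eq_zero : ∀ t i, ∑ j, A t j i = 0

/-- A continuous time Markov chain on the unit vectors of `ℝ^N` with rate matrix `A`, right
continuous with left limits. The chain is characterized by the (well-posed) martingale problem for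
its rate matrix: `X t - X 0 - ∫₀ᵗ A s X s ds` is a martingale. -/
structure MarkovChain (P : Measure Ω) (N : ℕ) where
  /-- The chain. -/
  X : ℝ≥0 → Ω → (Fin N → ℝ)
  /-- The rate matrix. -/
  A : ℝ≥0 → Matrix (Fin N) (Fin N) ℝ
  measurable : ∀ t, Measurable (X t)
  unit_vector : ∀ t ω, ∃ i, X t ω = Pi.single i 1
  rcll : ∀ ω T, RCLLOn T fun t => X t ω
  rate : IsRateMatrix A
  martingale : Martingale
    (fun t ω => X t ω - X 0 ω - ∫ s in Set.Ioc 0 t, A s *ᵥ X s ω ∂lebesgue)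
    (completedFiltration P X measurable) P

namespace MarkovChain

variable {P : Measure Ω} {N : ℕ} (C : MarkovChain P N)

/-- The completed natural filtration of the chain. -/
def filtration : Filtration ℝ≥0 mΩ := completedFiltration P C.X C.measurable

/-- The left limit `X_{t-}`, with `X_{0-} = X_0`. -/
def left (t : ℝ≥0) (ω : Ω) : Fin N → ℝ := Function.leftLim (fun s => C.X s ω) t

/-- The density `Ψ` of the predictable quadratic variation of the chain. -/
def Psi (t : ℝ≥0) (ω : Ω) : Matrix (Fin N) (Fin N) ℝ :=
  Matrix.diagonal (C.A t *ᵥ C.left t ω) - Matrix.diagonal (C.left t ω) * (C.A t)ᵀ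
    - C.A t * Matrix.diagonal (C.left t ω)

/-- The square `z' Ψ_t z` of the seminorm `‖z‖_{X_t}`. -/
def seminormSq (t : ℝ≥0) (ω : Ω) (z : Fin N → ℝ) : ℝ := z ⬝ᵥ (C.Psi t ω *ᵥ z)

/-- The seminorm `‖z‖_{X_t}`. -/
def seminorm (t : ℝ≥0) (ω : Ω) (z : Fin N → ℝ) : ℝ := √(C.seminormSq t ω z)

/-- The integral `∫_t^T Z_s' dM_s` for `dM = dX - A X ds`. The martingale `M` has paths of finite
variation (the chain has finitely many jumps in `(t, T]`), and the integral is the pathwise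
Lebesgue-Stieltjes integral: the sum of `Z_s' ΔX_s` over the jumps, minus the integral of
`Z_s' A_s X_s ds`. -/
def stochInt (Z : ℝ≥0 → Ω → (Fin N → ℝ)) (t T : ℝ≥0) (ω : Ω) : ℝ :=
  (∑ᶠ (s : ℝ≥0) (_ : s ∈ Set.Ioc t T), Z s ω ⬝ᵥ (C.X s ω - C.left s ω))
    - ∫ s in Set.Ioc t T, Z s ω ⬝ᵥ (C.A s *ᵥ C.X s ω) ∂lebesgue

/-- `L²(𝓕_T)`. -/
def InL2 (T : ℝ≥0) (ξ : Ω → ℝ) : Prop :=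
  Measurable[C.filtration T] ξ ∧ ∫⁻ ω, ‖ξ ω‖ₑ ^ 2 ∂P < ∞

/-- Adapted processes with right continuous paths with left limits and `E ∫_0^T |V|² ds < ∞`. -/
structure InL2F (T : ℝ≥0) (V : ℝ≥0 → Ω → ℝ) : Prop where
  adapted : ∀ t ≤ T, Measurable[C.filtration t] (V t)
  rcll : ∀ᵐ ω ∂P, RCLLOn T fun t => V t ω
  sq_integrable : ∫⁻ ω, ∫⁻ s in Set.Icc 0 T, ‖V s ω‖ₑ ^ 2 ∂lebesgue ∂P < ∞

/-- Predictable processes with `E ∫_0^T ‖Z‖²_{X_s} ds < ∞`. -/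
structure InP2F (T : ℝ≥0) (Z : ℝ≥0 → Ω → (Fin N → ℝ)) : Prop where
  predictable : IsStronglyPredictable C.filtration Z
  sq_integrable : ∫⁻ ω, ∫⁻ s in Set.Icc 0 T,
    ENNReal.ofReal (C.seminormSq s ω (Z s ω)) ∂lebesgue ∂P < ∞

/-- The conditions on the driver `f`: measurability with respect to the product of the predictable
and the Borel `σ`-algebra, Lipschitz continuity with constants `c'`, `c''`, the smallness condition
`c'' ‖Ψ_t†‖ √(6 m) < 1` and square integrability of `f(·, 0, 0)`. -/
structure IsDriver (T : ℝ≥0) (c' c'' m : ℝ) (f : ℝ≥0 → Ω → ℝ → (Fin N → ℝ) → ℝ) : Prop where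
  measurable : Measurable[(C.filtration.predictable).prod inferInstance]
    fun p : (ℝ≥0 × Ω) × (ℝ × (Fin N → ℝ)) => f p.1.1 p.1.2 p.2.1 p.2.2
  lipschitz : ∀ᵐ ω ∂P, ∀ t ≤ T, ∀ (v₁ v₂ : ℝ) (z₁ z₂ : Fin N → ℝ),
    |f t ω v₁ z₁ - f t ω v₂ z₂| ≤ c' * |v₁ - v₂| + c'' * C.seminorm t ω (z₁ - z₂)
  small : ∀ᵐ ω ∂P, ∀ t ≤ T, ∃ B, IsMoorePenrose (C.Psi t ω) B ∧
    c'' * matrixNorm B * √(6 * m) < 1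
  sq_integrable : ∫⁻ ω, ∫⁻ s in Set.Icc 0 T, ‖f s ω 0 0‖ₑ ^ 2 ∂lebesgue ∂P < ∞

/-- The conditions on the obstacle `G`: a progressively measurable process with
`E [sup_{t ≤ T} (G_t⁺)²] < ∞`. -/
structure IsObstacle (T : ℝ≥0) (G : ℝ≥0 → Ω → ℝ) : Prop where
  progressive : IsStronglyProgressive C.filtration G
  sq_integrable : ∫⁻ ω, ⨆ t ∈ Set.Icc 0 T, ENNReal.ofReal (G t ω) ^ 2 ∂P < ∞

/-- The conditions on the perturbation `φ`: a predictable process with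
`E ∫_0^T |φ_s|² ds < ∞`. -/
structure IsPerturbation (T : ℝ≥0) (φ : ℝ≥0 → Ω → ℝ) : Prop where
  predictable : IsStronglyPredictable C.filtration φ
  sq_integrable : ∫⁻ ω, ∫⁻ s in Set.Icc 0 T, ‖φ s ω‖ₑ ^ 2 ∂lebesgue ∂P < ∞

end MarkovChain

/-- The Stieltjes function of a path `k` that is continuous and nondecreasing on `[0, T]`,
stopped at `T`. -/
def pathStieltjes (T : ℝ≥0) (k : ℝ≥0 → ℝ) (hm : MonotoneOn k (Set.Icc 0 T))
    (hc : ContinuousOn k (Set.Icc 0 T)) : StieltjesFunction ℝ≥0 where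
  toFun s := k (min s T)
  mono' s t hst := hm ⟨zero_le, min_le_right _ _⟩ ⟨zero_le, min_le_right _ _⟩
    (min_le_min_right T hst)
  right_continuous' s := by
    have h : Continuous fun s : ℝ≥0 => k (min s T) :=
      hc.comp_continuous (by fun_prop) fun s => ⟨zero_le, min_le_right _ _⟩
    exact h.continuousWithinAt

open Classical in
/-- The Lebesgue-Stieltjes measure `dk` on `[0, T]` of a path `k` that is continuous and
nondecreasing on `[0, T]`. -/
def pathMeasure (T : ℝ≥0) (k : ℝ≥0 → ℝ) : Measure ℝ≥0 :=
  if h : MonotoneOn k (Set.Icc 0 T) ∧ ContinuousOn k (Set.Icc 0 T) then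
    (pathStieltjes T k h.1 h.2).measure
  else 0

/-- `(V, Z, K)` solves the reflected backward stochastic differential equation on `[0, T]` with
terminal value `ξ`, driver `g` and obstacle `G`. -/
structure IsRBSDESolution {P : Measure Ω} {N : ℕ} (C : MarkovChain P N) (T : ℝ≥0)
    (g : ℝ≥0 → Ω → ℝ → (Fin N → ℝ) → ℝ) (ξ : Ω → ℝ) (G : ℝ≥0 → Ω → ℝ)
    (V : ℝ≥0 → Ω → ℝ) (Z : ℝ≥0 → Ω → (Fin N → ℝ)) (K : ℝ≥0 → Ω → ℝ) : Prop where
  memV : C.InL2F T V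
  memZ : C.InP2F T Z
  memK : C.InL2 T (K T)
  equation : ∀ᵐ ω ∂P, ∀ t ≤ T,
    V t ω = ξ ω + ∫ s in Set.Ioc t T, g s ω (V s ω) (Z s ω) ∂lebesgue + (K T ω - K t ω)
      - C.stochInt Z t T ω
  obstacle : ∀ᵐ ω ∂P, ∀ t ≤ T, G t ω ≤ V t ω
  continuous : ∀ᵐ ω ∂P, ContinuousOn (fun t => K t ω) (Set.Icc 0 T)
  increasing : ∀ᵐ ω ∂P, MonotoneOn (fun t => K t ω) (Set.Icc 0 T)
  zero : ∀ᵐ ω ∂P, K 0 ω = 0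
  -- The integrand is nonnegative by `obstacle`.
  skorokhod : ∀ᵐ ω ∂P, ∫⁻ s in Set.Icc 0 T, ENNReal.ofReal (V s ω - G s ω)
    ∂(pathMeasure T fun t => K t ω) = 0

end MarkovRBSDE

end

/-! Applying the chain rule to |v|² leaves the term ∫ (G₁ - G₂) dk, and the total variation of k is
not controlled by the data; a bound that is linear in E sup |G₁ - G₂|² needs another functional. The
two signs of the difference are treated separately.

Let U = v + ∫₀ᵗ (φ₁ - φ₂) ds (`gap`), which takes the perturbations out of the drift. Read backward
in time, U is raised by the drift and by K₁ and lowered by K₂. When K₁ acts, V₁ touches G₁ while V₂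
≥ G₂, so U is then at most G₁ - G₂ + ∫₀ᵗ (φ₁ - φ₂) ds. Let L (`level`) collect the levels at which
K₁ has acted so far. It is nondecreasing, predictable and almost surely bounded by sup |G₁ - G₂| + ∫
|φ₁ - φ₂|. The process max(U⁺, L) (`upper`) does not see the pushes: K₁ acts only where U has come
down to L, and K₂ has the favourable sign (`ofReal_le_max_add`). Between jumps its square therefore
obeys a chain rule inequality in which only the positive part of the drift enters
(`sq_le_sq_add_of_le_add`, `max_pushLevel_sq_le`).

At the jumps, the entries into a state j are compensated by an intensity λ_j
(`lintegral_entryMeasure`); this follows from the martingale problem by counting the transitions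
seen on finer and finer grids. If Δ_j denotes the jump of U on an entry into j, then ‖z‖² = ∑ λ_j
Δ_j² and z'AX₋ = ∑ λ_j Δ_j. The energy of max(U⁺, L) controls only the positive part of U + Δ_j, so
a drift of size c''‖z‖ cannot simply be absorbed. Here the smallness condition enters: it forces
c''² ≤ λ_j wherever λ_j > 0 (`sq_le_rate`), hence c''‖z‖ ≤ ∑ λ_j |Δ_j| (`mul_seminorm_le`). Since
|Δ| + Δ = 2Δ⁺ ≤ 2(U + Δ)⁺ when U > 0, the drift is at most c'|v| + 2 ∑ λ_j max((U₋ + Δ_j)⁺, L)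
(`ae_ofReal_diffDrift_le`), and the last sum is absorbed by the expected squares after the jumps
(`lintegral_upper_sq_add_le`).

Adding the inequality for the two orders of the solutions (`swap`) and applying Gronwall's
inequality backward bounds E|v_t|² and the energies at the jumps; ‖z‖² is recovered from Δ_j = (U₋ +
Δ_j) - U₋ (`lintegral_diffSq_le`). Finally, the increments of v + k contain no pushes, only drifts
and jumps. The second moment of the sum of the absolute jumps comes from a discrete chain rule, the
compensation formula and a forward Gronwall inequality (`lintegral_totalJump_sq_le`). This gives the
estimate of sup |v + k|, and subtracting v gives the one of k. If the data are infinite there is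
nothing to prove; otherwise everything that is absorbed or fed to Gronwall's inequality is finite
beforehand, by the square integrability of the solutions (`roughBound`) or by truncation. -/

namespace MarkovRBSDE

/-! ### Lebesgue measure on the half-line. -/

section Lebesgue

lemma measurableEmbedding_nnreal_coe : MeasurableEmbedding (fun s : ℝ≥0 => (s : ℝ)) :=
  MeasurableEmbedding.subtype_coe measurableSet_Ici

lemma lebesgue_apply (s : Set ℝ≥0) :
    lebesgue s = (volume : Measure ℝ) ((fun s : ℝ≥0 => (s : ℝ)) '' s) :=
  measurableEmbedding_nnreal_coe.comap_apply _ _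

lemma coe_image_Ioc (a b : ℝ≥0) :
    (fun s : ℝ≥0 => (s : ℝ)) '' Set.Ioc a b = Set.Ioc (a : ℝ) b := by
  ext x
  constructor
  · rintro ⟨s, hs, rfl⟩
    exact ⟨NNReal.coe_lt_coe.2 hs.1, NNReal.coe_le_coe.2 hs.2⟩
  · rintro ⟨h1, h2⟩
    have hx : 0 ≤ x := a.coe_nonneg.trans h1.le
    exact ⟨⟨x, hx⟩, ⟨by exact_mod_cast h1, by exact_mod_cast h2⟩, rfl⟩

lemma lebesgue_Ioc (a b : ℝ≥0) : lebesgue (Set.Ioc a b) = ENNReal.ofReal ((b : ℝ) - a) := by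
  rw [lebesgue_apply, coe_image_Ioc, Real.volume_Ioc]

instance : NullSingletonClass lebesgue :=
  ⟨fun x => by rw [lebesgue_apply, Set.image_singleton, Real.volume_singleton]⟩

instance : SigmaFinite lebesgue :=
  ⟨⟨{ set := fun n => Set.Icc 0 (n : ℝ≥0)
      set_mem := fun _ => trivial
      finite := fun n => by
        rw [← measure_congr (Ioc_ae_eq_Icc (a := (0 : ℝ≥0)) (b := n)), lebesgue_Ioc]
        exact ENNReal.ofReal_lt_top
      spanning := by
        refine Set.eq_univ_of_forall fun x => Set.mem_iUnion.2 ?_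
        obtain ⟨n, hn⟩ := exists_nat_ge x
        exact ⟨n, zero_le, hn⟩ }⟩⟩

instance (a b : ℝ≥0) : IsFiniteMeasure (lebesgue.restrict (Set.Ioc a b)) :=
  ⟨by rw [Measure.restrict_apply_univ, lebesgue_Ioc]; exact ENNReal.ofReal_lt_top⟩

lemma restrict_Icc_eq_restrict_Ioc (T : ℝ≥0) :
    lebesgue.restrict (Set.Icc 0 T) = lebesgue.restrict (Set.Ioc 0 T) :=
  Measure.restrict_congr_set Ioc_ae_eq_Icc.symm

lemma setLIntegral_lebesgue_Ioc (a b : ℝ≥0) (F : ℝ → ℝ≥0∞) :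
    ∫⁻ t in Set.Ioc a b, F t ∂lebesgue = ∫⁻ x in Set.Ioc (a : ℝ) b, F x := by
  have h : lebesgue.map (fun s : ℝ≥0 => (s : ℝ))
      = (volume : Measure ℝ).restrict (Set.range (fun s : ℝ≥0 => (s : ℝ))) :=
    measurableEmbedding_nnreal_coe.map_comap _
  have h1 : (Set.Ioc (a : ℝ) b) ⊆ Set.range (fun s : ℝ≥0 => (s : ℝ)) := by
    rw [← coe_image_Ioc]
    exact Set.image_subset_range _ _
  have h2 : Set.Ioc a b = (fun s : ℝ≥0 => (s : ℝ)) ⁻¹' Set.Ioc (a : ℝ) b := by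
    ext s
    simp
  rw [← Set.inter_eq_self_of_subset_left h1, ← Measure.restrict_restrict measurableSet_Ioc, ← h,
    measurableEmbedding_nnreal_coe.restrict_map, measurableEmbedding_nnreal_coe.lintegral_map, h2]

lemma setLIntegral_exp (a b : ℝ≥0) (hab : a ≤ b) {β : ℝ} (hβ : β ≠ 0) :
    ∫⁻ t in Set.Ioc a b, ENNReal.ofReal (Real.exp (β * t)) ∂lebesgue
      = ENNReal.ofReal ((Real.exp (β * b) - Real.exp (β * a)) / β) := by
  have hab' : (a : ℝ) ≤ b := by exact_mod_cast hab
  have hd : ∀ x : ℝ, HasDerivAt (fun x => Real.exp (β * x) / β) (Real.exp (β * x)) x := by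
    intro x
    have := (((hasDerivAt_id x).const_mul β).exp).div_const β
    simpa [hβ] using this
  have hi : IntervalIntegrable (fun x : ℝ => Real.exp (β * x)) volume a b :=
    (by fun_prop : Continuous fun x : ℝ => Real.exp (β * x)).intervalIntegrable _ _
  rw [setLIntegral_lebesgue_Ioc a b (fun x => ENNReal.ofReal (Real.exp (β * x))),
    ← ofReal_integral_eq_lintegral_ofReal
      ((intervalIntegrable_iff_integrableOn_Ioc_of_le hab').1 hi)
      (Eventually.of_forall fun x => (Real.exp_pos _).le),
    ← intervalIntegral.integral_of_le hab',
    intervalIntegral.integral_eq_sub_of_hasDerivAt (fun x _ => hd x) hi, sub_div]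

end Lebesgue

/-! ### Primitives, and a chain rule inequality for squares. -/

section Primitive

/-- Away from u = s₀ the kernel is locally constant in its upper limit. This is the pointwise
convergence behind the continuity of primitives. -/
lemma eventually_indicator_Ioc_eq {E : Type*} [Zero E] (a s₀ u : ℝ≥0) (hu : u ≠ s₀) (g : ℝ≥0 → E) :
    ∀ᶠ s in 𝓝 s₀, (Set.Ioc a s).indicator g u = (Set.Ioc a s₀).indicator g u := by
  rcases lt_or_gt_of_ne hu with h | h
  · filter_upwards [lt_mem_nhds h] with s hs
    simp [Set.indicator_apply, hs.le, h.le]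
  · filter_upwards [gt_mem_nhds h] with s hs
    simp [not_le.2 hs, not_le.2 h]

lemma continuousOn_setIntegral_Ioc {μ : Measure ℝ≥0} [NullSingletonClass μ]
    {a b : ℝ≥0} {g : ℝ≥0 → ℝ} (hg : IntegrableOn g (Set.Ioc a b) μ) :
    ContinuousOn (fun s => ∫ u in Set.Ioc a s, g u ∂μ) (Set.Icc a b) := by
  have key : ContinuousOn (fun s => ∫ u in Set.Ioc a b, (Set.Ioc a s).indicator g u ∂μ)
      (Set.Icc a b) := by
    intro s₀ _
    apply ContinuousAt.continuousWithinAt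
    apply continuousAt_of_dominated (bound := fun u => ‖g u‖)
    · exact Eventually.of_forall fun s => hg.aestronglyMeasurable.indicator measurableSet_Ioc
    · exact Eventually.of_forall fun s => Eventually.of_forall fun u =>
        norm_indicator_le_norm_self _ _
    · exact hg.norm
    · filter_upwards [ae_restrict_of_ae (s := Set.Ioc a b) (measure_eq_zero_iff_ae_notMem.1
        (measure_singleton (μ := μ) s₀))] with u hu
      exact (tendsto_const_nhds.congr' ((eventually_indicator_Ioc_eq a s₀ u hu g).mono
        fun _ h => h.symm))
  refine key.congr fun s hs => ?_
  simp only [integral_indicator measurableSet_Ioc]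
  rw [Measure.restrict_restrict measurableSet_Ioc,
    Set.inter_eq_self_of_subset_left (Set.Ioc_subset_Ioc_right hs.2)]

lemma continuousOn_setLIntegral_Ioc {μ : Measure ℝ≥0} [NullSingletonClass μ]
    {a b : ℝ≥0} {g : ℝ≥0 → ℝ≥0∞}
    (hg : AEMeasurable g (μ.restrict (Set.Ioc a b))) (hfin : ∫⁻ u in Set.Ioc a b, g u ∂μ ≠ ∞) :
    ContinuousOn (fun s => ∫⁻ u in Set.Ioc a s, g u ∂μ) (Set.Icc a b) := by
  have key : ContinuousOn (fun s => ∫⁻ u in Set.Ioc a b, (Set.Ioc a s).indicator g u ∂μ)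
      (Set.Icc a b) := by
    intro s₀ _
    apply ContinuousAt.continuousWithinAt
    apply tendsto_lintegral_filter_of_dominated_convergence' (bound := g)
    · exact Eventually.of_forall fun s => hg.indicator measurableSet_Ioc
    · exact Eventually.of_forall fun s => Eventually.of_forall fun u =>
        Set.indicator_le_self _ _ _
    · exact hfin
    · filter_upwards [ae_restrict_of_ae (s := Set.Ioc a b) (measure_eq_zero_iff_ae_notMem.1
        (measure_singleton (μ := μ) s₀))] with u hu
      exact (tendsto_const_nhds.congr' ((eventually_indicator_Ioc_eq a s₀ u hu g).mono
        fun _ h => h.symm))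
  refine key.congr fun s hs => ?_
  simp only [lintegral_indicator measurableSet_Ioc]
  rw [Measure.restrict_restrict measurableSet_Ioc,
    Set.inter_eq_self_of_subset_left (Set.Ioc_subset_Ioc_right hs.2)]

lemma setLIntegral_Ioc_add {μ : Measure ℝ≥0} {a b c : ℝ≥0} (hab : a ≤ b) (hbc : b ≤ c) (g : ℝ≥0 → ℝ≥0∞) :
    ∫⁻ u in Set.Ioc a b, g u ∂μ + ∫⁻ u in Set.Ioc b c, g u ∂μ = ∫⁻ u in Set.Ioc a c, g u ∂μ := by
  rw [← lintegral_union measurableSet_Ioc (Set.Ioc_disjoint_Ioc_of_le le_rfl),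
    Set.Ioc_union_Ioc_eq_Ioc hab hbc]

/-- If `U` decreases along `[a, b]` at most as fast as the primitive of `g` increases, then `U²`
decreases at most as fast as the primitive of `2 U g` increases. -/
lemma sq_le_sq_add_of_le_add {μ : Measure ℝ≥0} [NullSingletonClass μ]
    {a b : ℝ≥0} (hab : a ≤ b) {g U : ℝ≥0 → ℝ≥0∞}
    (hg : AEMeasurable g (μ.restrict (Set.Ioc a b))) (hfin : ∫⁻ u in Set.Ioc a b, g u ∂μ ≠ ∞)
    (hU : ∀ s s', a ≤ s → s ≤ s' → s' ≤ b → U s ≤ U s' + ∫⁻ u in Set.Ioc s s', g u ∂μ) :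
    U a ^ 2 ≤ U b ^ 2 + 2 * ∫⁻ u in Set.Ioc a b, U u * g u ∂μ := by
  -- No regularity of U is available, so the inequality is proved on all subintervals with an error
  -- (∫g)² 2⁻ⁿ. Cutting where ∫g is halved replaces one error I² by two errors (I/2)², a gain of a
  -- factor 2 at each stage.
  have key : ∀ n : ℕ, ∀ s s', a ≤ s → s ≤ s' → s' ≤ b →
      U s ^ 2 ≤ U s' ^ 2 + 2 * ∫⁻ u in Set.Ioc s s', U u * g u ∂μ
        + (∫⁻ u in Set.Ioc s s', g u ∂μ) ^ 2 * (2⁻¹) ^ n := by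
    intro n
    induction n with
    | zero =>
      intro s s' has hss hsb
      simp only [pow_zero, mul_one]
      set I := ∫⁻ u in Set.Ioc s s', g u ∂μ with hI
      have hIfin : I ≠ ∞ := ne_top_of_le_ne_top hfin
        (lintegral_mono_set (Set.Ioc_subset_Ioc has hsb))
      -- If U s = x + I, then U ≥ x on the whole interval, so 2xI is covered by 2∫Ug, x² by U s'²,
      -- and only I² is left over.
      rcases le_total (U s) I with h | h
      · calc U s ^ 2 ≤ I ^ 2 := by gcongr
          _ ≤ _ := le_add_self
      · obtain ⟨x, hx⟩ := exists_add_of_le h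
        have h1 : x ≤ U s' := by
          have := hU s s' has hss hsb
          rw [hx, ← hI, add_comm I x] at this
          exact (ENNReal.add_le_add_iff_right hIfin).1 this
        have h2 : x * I ≤ ∫⁻ u in Set.Ioc s s', U u * g u ∂μ := by
          refine (lintegral_const_mul_le x g).trans ?_
          refine setLIntegral_mono_ae' measurableSet_Ioc (Eventually.of_forall fun u hu => ?_)
          gcongr
          have h3 := hU s u has hu.1.le (hu.2.trans hsb)
          have h4 : ∫⁻ u in Set.Ioc s u, g u ∂μ ≤ I :=
            lintegral_mono_set (Set.Ioc_subset_Ioc_right hu.2)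
          have h5 : x + I ≤ U u + I := by
            rw [add_comm x I, ← hx]
            exact h3.trans (by gcongr)
          exact (ENNReal.add_le_add_iff_right hIfin).1 h5
        calc U s ^ 2 = x ^ 2 + 2 * (x * I) + I ^ 2 := by rw [hx]; ring
          _ ≤ _ := by gcongr
    | succ n ih =>
      intro s s' has hss hsb
      have hsub : Set.Ioc s s' ⊆ Set.Ioc a b := Set.Ioc_subset_Ioc has hsb
      have hIfin : ∫⁻ u in Set.Ioc s s', g u ∂μ ≠ ∞ :=
        ne_top_of_le_ne_top hfin (lintegral_mono_set hsub)
      have hcont := continuousOn_setLIntegral_Ioc (hg.mono_measure (Measure.restrict_mono hsub le_rfl))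
        hIfin
      have hmem : (∫⁻ u in Set.Ioc s s', g u ∂μ) / 2 ∈
          Set.Icc (∫⁻ u in Set.Ioc s s, g u ∂μ) (∫⁻ u in Set.Ioc s s', g u ∂μ) := by
        simp [ENNReal.half_le_self]
      obtain ⟨c, hc, hceq⟩ := intermediate_value_Icc hss hcont hmem
      simp only at hceq
      have hadd := setLIntegral_Ioc_add (μ := μ) hc.1 hc.2 g
      have hadd' := setLIntegral_Ioc_add (μ := μ) hc.1 hc.2 (fun u => U u * g u)
      have hcfin : ∫⁻ u in Set.Ioc s c, g u ∂μ ≠ ∞ := ne_top_of_le_ne_top hIfin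
        (lintegral_mono_set (Set.Ioc_subset_Ioc_right hc.2))
      have h2 : ∫⁻ u in Set.Ioc c s', g u ∂μ = (∫⁻ u in Set.Ioc s s', g u ∂μ) / 2 := by
        have : ∫⁻ u in Set.Ioc s c, g u ∂μ + ∫⁻ u in Set.Ioc c s', g u ∂μ
            = ∫⁻ u in Set.Ioc s c, g u ∂μ + (∫⁻ u in Set.Ioc s s', g u ∂μ) / 2 := by
          rw [hadd, hceq, ENNReal.add_halves]
        exact (ENNReal.add_right_inj hcfin).1 this
      have i1 := ih s c has hc.1 (hc.2.trans hsb)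
      have i2 := ih c s' (has.trans hc.1) hc.2 hsb
      rw [hceq] at i1
      rw [h2] at i2
      set I := ∫⁻ u in Set.Ioc s s', g u ∂μ
      have hh : (I / 2) ^ 2 * 2⁻¹ ^ n + (I / 2) ^ 2 * 2⁻¹ ^ n = I ^ 2 * 2⁻¹ ^ (n + 1) := by
        rw [← two_mul, div_eq_mul_inv, mul_pow, pow_succ (2⁻¹ : ℝ≥0∞) n]
        have h22 : (2 : ℝ≥0∞) * 2⁻¹ = 1 := ENNReal.mul_inv_cancel (by simp) (by simp)
        calc 2 * (I ^ 2 * 2⁻¹ ^ 2 * 2⁻¹ ^ n) = (2 * 2⁻¹) * (I ^ 2 * (2⁻¹ ^ n * 2⁻¹)) := by ring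
          _ = _ := by rw [h22, one_mul]
      calc U s ^ 2 ≤ U c ^ 2 + 2 * ∫⁻ u in Set.Ioc s c, U u * g u ∂μ + (I / 2) ^ 2 * 2⁻¹ ^ n := i1
        _ ≤ (U s' ^ 2 + 2 * ∫⁻ u in Set.Ioc c s', U u * g u ∂μ + (I / 2) ^ 2 * 2⁻¹ ^ n)
            + 2 * ∫⁻ u in Set.Ioc s c, U u * g u ∂μ + (I / 2) ^ 2 * 2⁻¹ ^ n := by gcongr
        _ = U s' ^ 2 + 2 * (∫⁻ u in Set.Ioc s c, U u * g u ∂μ + ∫⁻ u in Set.Ioc c s', U u * g u ∂μ)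
            + ((I / 2) ^ 2 * 2⁻¹ ^ n + (I / 2) ^ 2 * 2⁻¹ ^ n) := by ring
        _ = _ := by rw [hadd', hh]
  have hlim : Tendsto (fun n : ℕ => U b ^ 2 + 2 * ∫⁻ u in Set.Ioc a b, U u * g u ∂μ
        + (∫⁻ u in Set.Ioc a b, g u ∂μ) ^ 2 * (2⁻¹) ^ n) atTop
      (𝓝 (U b ^ 2 + 2 * ∫⁻ u in Set.Ioc a b, U u * g u ∂μ
        + (∫⁻ u in Set.Ioc a b, g u ∂μ) ^ 2 * 0)) := by
    refine Tendsto.const_add _ (ENNReal.Tendsto.const_mul ?_ (Or.inr (by finiteness)))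
    exact ENNReal.tendsto_pow_atTop_nhds_zero_of_lt_one (by simp)
  have := ge_of_tendsto' hlim fun n => key n a b le_rfl hab le_rfl
  simpa using this

end Primitive

/-! ### Gronwall's inequality in integrated form, backward and forward. -/

section Gronwall

/-- Integrate the inequality against w and exchange the integrals: by the assumption on w the kernel
term returns at most half of the left side, and finiteness allows it to be absorbed. The relation R
is left open in order to serve both directions of time. -/
lemma lintegral_weight_mul_le {μ : Measure ℝ≥0} [SFinite μ] {g w : ℝ≥0 → ℝ≥0∞} {c D : ℝ≥0∞}
    {R : Set (ℝ≥0 × ℝ≥0)} (hR : MeasurableSet R) (hgm : Measurable g) (hwm : Measurable w)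
    (hg : ∀ᵐ t ∂μ, g t ≤ D + c * ∫⁻ s, R.indicator 1 (t, s) * g s ∂μ)
    (hw : ∀ᵐ s ∂μ, c * ∫⁻ t, R.indicator 1 (t, s) * w t ∂μ ≤ w s * 2⁻¹)
    (hfin : ∫⁻ t, w t * g t ∂μ ≠ ∞) :
    ∫⁻ t, w t * g t ∂μ ≤ 2 * (D * ∫⁻ t, w t ∂μ) := by
  have hRm : Measurable (R.indicator (1 : ℝ≥0 × ℝ≥0 → ℝ≥0∞)) := measurable_one.indicator hR
  have h1 : ∫⁻ t, w t * g t ∂μ ≤ D * ∫⁻ t, w t ∂μ + 2⁻¹ * ∫⁻ t, w t * g t ∂μ := by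
    calc ∫⁻ t, w t * g t ∂μ
        ≤ ∫⁻ t, (D * w t + ∫⁻ s, c * (R.indicator 1 (t, s) * w t * g s) ∂μ) ∂μ := by
          refine lintegral_mono_ae (hg.mono fun t ht => ?_)
          calc w t * g t ≤ w t * (D + c * ∫⁻ s, R.indicator 1 (t, s) * g s ∂μ) := by gcongr
            _ = D * w t + (c * w t) * ∫⁻ s, R.indicator 1 (t, s) * g s ∂μ := by ring
            _ = _ := by
              rw [← lintegral_const_mul _ (by fun_prop)]
              congr 1
              refine lintegral_congr fun s => by ring
      _ = D * ∫⁻ t, w t ∂μ + ∫⁻ s, ∫⁻ t, c * (R.indicator 1 (t, s) * w t * g s) ∂μ ∂μ := by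
          rw [lintegral_add_left (by fun_prop), lintegral_const_mul _ hwm,
            lintegral_lintegral_swap]
          exact (by fun_prop : Measurable _).aemeasurable
      _ ≤ D * ∫⁻ t, w t ∂μ + ∫⁻ s, 2⁻¹ * (w s * g s) ∂μ := by
          refine add_le_add le_rfl ?_
          refine lintegral_mono_ae (hw.mono fun s hs => ?_)
          calc ∫⁻ t, c * (R.indicator 1 (t, s) * w t * g s) ∂μ
              = (c * ∫⁻ t, R.indicator 1 (t, s) * w t ∂μ) * g s := by
                rw [lintegral_const_mul _ (by fun_prop), lintegral_mul_const _ (by fun_prop)]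
                ring
            _ ≤ (w s * 2⁻¹) * g s := by gcongr
            _ = _ := by ring
      _ = _ := by rw [lintegral_const_mul _ (by fun_prop)]
  set I := ∫⁻ t, w t * g t ∂μ
  have h2 : I = 2⁻¹ * I + 2⁻¹ * I := by
    rw [← add_mul, ENNReal.inv_two_add_inv_two, one_mul]
  have h3 : 2⁻¹ * I ≤ D * ∫⁻ t, w t ∂μ := by
    have : 2⁻¹ * I + 2⁻¹ * I ≤ D * ∫⁻ t, w t ∂μ + 2⁻¹ * I := by rw [← h2]; exact h1
    exact (ENNReal.add_le_add_iff_right (by finiteness)).1 this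
  rw [h2, two_mul]
  gcongr

/-- The constant in the integral form of Gronwall's inequality on `[0, T]` with rate `c`. -/
noncomputable def gronwallConst (c : ℝ) (T : ℝ≥0) : ℝ≥0∞ :=
  2 * ENNReal.ofReal (Real.exp (2 * c * T)) * ENNReal.ofReal T

lemma gronwallConst_ne_top (c : ℝ) (T : ℝ≥0) : gronwallConst c T ≠ ∞ := by
  unfold gronwallConst; finiteness

lemma lintegral_le_of_le_backward {c : ℝ} (hc : 0 < c) {T : ℝ≥0} {g : ℝ≥0 → ℝ≥0∞} {D : ℝ≥0∞}
    (hgm : Measurable g)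
    (hg : ∀ t ∈ Set.Ioc 0 T, g t ≤ D + ENNReal.ofReal c * ∫⁻ s in Set.Ioc t T, g s ∂lebesgue)
    (hfin : ∫⁻ t in Set.Ioc 0 T, g t ∂lebesgue ≠ ∞) :
    ∫⁻ t in Set.Ioc 0 T, g t ∂lebesgue ≤ gronwallConst c T * D := by
  -- With the rate 2c one has c ∫₀ˢ w = (w s - 1)/2 ≤ w s / 2.
  set w : ℝ≥0 → ℝ≥0∞ := fun t => ENNReal.ofReal (Real.exp (2 * c * t)) with hw
  have hwm : Measurable w := by fun_prop
  have hwle : ∀ t ∈ Set.Ioc 0 T, w t ≤ ENNReal.ofReal (Real.exp (2 * c * T)) := by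
    intro t ht
    have : (t : ℝ) ≤ T := by exact_mod_cast ht.2
    exact ENNReal.ofReal_le_ofReal (Real.exp_le_exp.2 (by gcongr))
  have h1w : ∀ t, 1 ≤ w t := fun t => by
    rw [hw, ← ENNReal.ofReal_one]
    exact ENNReal.ofReal_le_ofReal (Real.one_le_exp (by positivity))
  have hmain := lintegral_weight_mul_le (μ := lebesgue.restrict (Set.Ioc 0 T)) (g := g) (w := w)
    (c := ENNReal.ofReal c) (D := D) (R := {p | p.1 < p.2})
    (measurableSet_lt measurable_fst measurable_snd) hgm hwm ?_ ?_ ?_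
  · calc ∫⁻ t in Set.Ioc 0 T, g t ∂lebesgue ≤ ∫⁻ t in Set.Ioc 0 T, w t * g t ∂lebesgue := by
          refine lintegral_mono fun t => le_mul_of_one_le_left' (h1w t)
      _ ≤ 2 * (D * ∫⁻ t in Set.Ioc 0 T, w t ∂lebesgue) := hmain
      _ ≤ 2 * (D * ∫⁻ t in Set.Ioc 0 T, ENNReal.ofReal (Real.exp (2 * c * T)) ∂lebesgue) := by
          gcongr 2 * (D * ?_)
          exact setLIntegral_mono measurable_const hwle
      _ = _ := by
          rw [setLIntegral_const, lebesgue_Ioc, gronwallConst]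
          simp only [NNReal.coe_zero, sub_zero]
          ring
  · refine (ae_restrict_iff' measurableSet_Ioc).2 (Eventually.of_forall fun t ht => ?_)
    refine (hg t ht).trans (le_of_eq ?_)
    congr 2
    have : Set.Ioc t T = Set.Ioi t ∩ Set.Ioc 0 T := by
      ext s; simp only [Set.mem_Ioc, Set.mem_inter_iff, Set.mem_Ioi]
      exact ⟨fun h => ⟨h.1, ht.1.trans h.1, h.2⟩, fun h => ⟨h.1, h.2.2⟩⟩
    rw [this, ← Measure.restrict_restrict measurableSet_Ioi, ← lintegral_indicator measurableSet_Ioi]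
    refine lintegral_congr fun s => ?_
    by_cases h : t < s <;> simp [h]
  · refine (ae_restrict_iff' measurableSet_Ioc).2 (Eventually.of_forall fun s hs => ?_)
    have : ∫⁻ t in Set.Ioc 0 T, Set.indicator {p : ℝ≥0 × ℝ≥0 | p.1 < p.2} 1 (t, s) * w t ∂lebesgue
        ≤ ∫⁻ t in Set.Ioc 0 s, w t ∂lebesgue := by
      rw [← lintegral_indicator measurableSet_Ioc, ← lintegral_indicator measurableSet_Ioc]
      refine lintegral_mono fun t => ?_
      by_cases h : t < s
      · by_cases h0 : 0 < t
        · by_cases hT : t ≤ T <;> simp [Set.indicator_apply, h, h0, h.le, hT]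
        · simp [Set.indicator_apply, h0]
      · simp [Set.indicator_apply, h]
    refine (mul_le_mul_right this _).trans ?_
    rw [hw, setLIntegral_exp 0 s zero_le (by positivity : 2 * c ≠ 0),
      ← ENNReal.ofReal_mul hc.le]
    have h2 : (2⁻¹ : ℝ≥0∞) = ENNReal.ofReal 2⁻¹ := by
      rw [ENNReal.ofReal_inv_of_pos (by norm_num)]; simp
    rw [h2, ← ENNReal.ofReal_mul (by positivity)]
    refine ENNReal.ofReal_le_ofReal ?_
    have : c * ((Real.exp (2 * c * s) - Real.exp (2 * c * (0 : ℝ≥0))) / (2 * c))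
      = (Real.exp (2 * c * s) - 1) * 2⁻¹ := by
      simp only [NNReal.coe_zero, mul_zero, Real.exp_zero]; field_simp
    rw [this]
    linarith
  · refine ne_top_of_le_ne_top (b := ENNReal.ofReal (Real.exp (2 * c * T)) *
      ∫⁻ t in Set.Ioc 0 T, g t ∂lebesgue) (by finiteness) ?_
    rw [← lintegral_const_mul _ hgm]
    refine setLIntegral_mono (by fun_prop) fun t ht => ?_
    gcongr
    exact hwle t ht

lemma lintegral_le_of_le_forward {c : ℝ} (hc : 0 < c) {T : ℝ≥0} {g : ℝ≥0 → ℝ≥0∞} {D : ℝ≥0∞}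
    (hgm : Measurable g)
    (hg : ∀ t ∈ Set.Ioc 0 T, g t ≤ D + ENNReal.ofReal c * ∫⁻ s in Set.Ioc 0 t, g s ∂lebesgue)
    (hfin : ∫⁻ t in Set.Ioc 0 T, g t ∂lebesgue ≠ ∞) :
    ∫⁻ t in Set.Ioc 0 T, g t ∂lebesgue ≤ gronwallConst c T * D := by
  -- The past enters now, so the weight decreases: c ∫ₛᵀ w = (w s - w T)/2 ≤ w s / 2.
  set w : ℝ≥0 → ℝ≥0∞ := fun t => ENNReal.ofReal (Real.exp (-(2 * c) * t)) with hw
  have hwm : Measurable w := by fun_prop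
  have hwle : ∀ t ∈ Set.Ioc 0 T, 1 ≤ ENNReal.ofReal (Real.exp (2 * c * T)) * w t := by
    intro t ht
    have : (t : ℝ) ≤ T := by exact_mod_cast ht.2
    rw [hw, ← ENNReal.ofReal_mul (Real.exp_pos _).le, ← Real.exp_add, ← ENNReal.ofReal_one]
    refine ENNReal.ofReal_le_ofReal (Real.one_le_exp ?_)
    nlinarith
  have h1w : ∀ t, w t ≤ 1 := fun t => by
    rw [hw, ← ENNReal.ofReal_one]
    refine ENNReal.ofReal_le_ofReal (Real.exp_le_one_iff.2 ?_)
    have := t.coe_nonneg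
    nlinarith
  have hmain := lintegral_weight_mul_le (μ := lebesgue.restrict (Set.Ioc 0 T)) (g := g) (w := w)
    (c := ENNReal.ofReal c) (D := D) (R := {p | p.2 ≤ p.1})
    (measurableSet_le measurable_snd measurable_fst) hgm hwm ?_ ?_ ?_
  · calc ∫⁻ t in Set.Ioc 0 T, g t ∂lebesgue
        ≤ ∫⁻ t in Set.Ioc 0 T, ENNReal.ofReal (Real.exp (2 * c * T)) * (w t * g t) ∂lebesgue := by
          refine setLIntegral_mono (by fun_prop) fun t ht => ?_
          rw [← mul_assoc]
          exact le_mul_of_one_le_left' (hwle t ht)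
      _ = ENNReal.ofReal (Real.exp (2 * c * T)) * ∫⁻ t in Set.Ioc 0 T, w t * g t ∂lebesgue := by
          rw [lintegral_const_mul _ (by fun_prop)]
      _ ≤ ENNReal.ofReal (Real.exp (2 * c * T)) * (2 * (D * ∫⁻ t in Set.Ioc 0 T, w t ∂lebesgue)) := by
          gcongr
      _ ≤ ENNReal.ofReal (Real.exp (2 * c * T)) * (2 * (D * ∫⁻ t in Set.Ioc 0 T, 1 ∂lebesgue)) := by
          gcongr with t
          exact h1w t
      _ = _ := by
          rw [setLIntegral_const, lebesgue_Ioc, gronwallConst]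
          simp only [NNReal.coe_zero, sub_zero]
          ring
  · refine (ae_restrict_iff' measurableSet_Ioc).2 (Eventually.of_forall fun t ht => ?_)
    refine (hg t ht).trans (le_of_eq ?_)
    congr 2
    have : Set.Ioc 0 t = Set.Iic t ∩ Set.Ioc 0 T := by
      ext s; simp only [Set.mem_Ioc, Set.mem_inter_iff, Set.mem_Iic]
      exact ⟨fun h => ⟨h.2, h.1, h.2.trans ht.2⟩, fun h => ⟨h.2.1, h.1⟩⟩
    rw [this, ← Measure.restrict_restrict measurableSet_Iic, ← lintegral_indicator measurableSet_Iic]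
    refine lintegral_congr fun s => ?_
    by_cases h : s ≤ t <;> simp [h]
  · refine (ae_restrict_iff' measurableSet_Ioc).2 (Eventually.of_forall fun s hs => ?_)
    have : ∫⁻ t in Set.Ioc 0 T, Set.indicator {p : ℝ≥0 × ℝ≥0 | p.2 ≤ p.1} 1 (t, s) * w t ∂lebesgue
        ≤ ∫⁻ t in Set.Ioc s T, w t ∂lebesgue := by
      rw [← lintegral_indicator measurableSet_Ioc, ← lintegral_indicator measurableSet_Ioc]
      refine lintegral_mono_ae ?_
      filter_upwards [measure_eq_zero_iff_ae_notMem.1 (measure_singleton (μ := lebesgue) s)]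
        with t ht
      by_cases h : s ≤ t
      · have h' : s < t := lt_of_le_of_ne h fun h' => ht (by simp [h'])
        by_cases hT : t ≤ T <;> simp [Set.indicator_apply, h, h', hT, hs.1.trans h']
      · simp [Set.indicator_apply, h]
    refine (mul_le_mul_right this _).trans ?_
    rw [hw, setLIntegral_exp s T hs.2 (by simp [hc.ne'] : -(2 * c) ≠ 0),
      ← ENNReal.ofReal_mul hc.le]
    have h2 : (2⁻¹ : ℝ≥0∞) = ENNReal.ofReal 2⁻¹ := by
      rw [ENNReal.ofReal_inv_of_pos (by norm_num)]; simp
    rw [h2, ← ENNReal.ofReal_mul (by positivity)]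
    refine ENNReal.ofReal_le_ofReal ?_
    have : c * ((Real.exp (-(2 * c) * T) - Real.exp (-(2 * c) * s)) / (-(2 * c)))
      = (Real.exp (-(2 * c) * s) - Real.exp (-(2 * c) * T)) * 2⁻¹ := by
      field_simp; ring
    rw [this]
    have := Real.exp_pos (-(2 * c) * T)
    linarith
  · refine ne_top_of_le_ne_top hfin (lintegral_mono fun t => mul_le_of_le_one_left' (h1w t))

end Gronwall

/-! ### The paths of the chain: jumps, entries and their counting measures. -/

lemma eventually_eq_of_tendsto_of_finite {α E : Type*} [TopologicalSpace E] [T1Space E]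
    {l : Filter α} {f : α → E} {S : Set E} (hS : S.Finite) (hf : ∀ a, f a ∈ S) {x : E}
    (h : Tendsto f l (𝓝 x)) : ∀ᶠ a in l, f a = x := by
  have h1 : (S \ {x})ᶜ ∈ 𝓝 x :=
    (hS.subset Set.sdiff_subset).isClosed.isOpen_compl.mem_nhds (by simp)
  filter_upwards [h h1] with a ha
  by_contra hne
  exact ha ⟨hf a, hne⟩

namespace MarkovChain

variable {Ω : Type*} [MeasurableSpace Ω] {P : Measure Ω} {N : ℕ} (C : MarkovChain P N)

lemma mem_range_single (t : ℝ≥0) (ω : Ω) :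
    C.X t ω ∈ Set.range fun i : Fin N => (Pi.single i 1 : Fin N → ℝ) := by
  obtain ⟨i, hi⟩ := C.unit_vector t ω
  exact ⟨i, hi.symm⟩

lemma tendsto_left (t : ℝ≥0) (ω : Ω) :
    Tendsto (fun s => C.X s ω) (𝓝[<] t) (𝓝 (C.left t ω)) := by
  obtain ⟨l, hl⟩ := (C.rcll ω t).2 t le_rfl
  exact tendsto_leftLim_of_tendsto ⟨l, hl⟩

lemma left_zero (ω : Ω) : C.left 0 ω = C.X 0 ω :=
  leftLim_eq_of_isBot (isBot_bot)

lemma eventually_left (t : ℝ≥0) (ω : Ω) : ∀ᶠ s in 𝓝[<] t, C.X s ω = C.left t ω :=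
  eventually_eq_of_tendsto_of_finite (Set.finite_range _) (fun s => C.mem_range_single s ω)
    (C.tendsto_left t ω)

lemma eventually_right (t : ℝ≥0) (ω : Ω) : ∀ᶠ s in 𝓝[≥] t, C.X s ω = C.X t ω :=
  eventually_eq_of_tendsto_of_finite (Set.finite_range _) (fun s => C.mem_range_single s ω)
    ((C.rcll ω (t + 1)).1 t (lt_add_of_pos_right _ one_pos))

lemma left_unit_vector (t : ℝ≥0) (ω : Ω) : ∃ i, C.left t ω = Pi.single i 1 := by
  rcases eq_zero_or_pos t with rfl | ht
  · rw [left_zero]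
    exact C.unit_vector 0 ω
  · have : (𝓝[<] t).NeBot := nhdsLT_neBot_of_exists_lt ⟨0, ht⟩
    obtain ⟨s, hs⟩ := (C.eventually_left t ω).exists
    rw [← hs]
    exact C.unit_vector s ω

lemma exists_Ico_eq (t : ℝ≥0) (ω : Ω) : ∃ u > t, ∀ s ∈ Set.Ico t u, C.X s ω = C.X t ω := by
  obtain ⟨u, hu, hsub⟩ := (mem_nhdsGE_iff_exists_Ico_subset' (lt_add_of_pos_right t one_pos)).1
    (C.eventually_right t ω)
  exact ⟨u, hu, fun s hs => hsub hs⟩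

lemma exists_Ioo_eq_left (t : ℝ≥0) (ht : 0 < t) (ω : Ω) :
    ∃ u < t, ∀ s ∈ Set.Ioo u t, C.X s ω = C.left t ω := by
  obtain ⟨u, hu, hsub⟩ := (mem_nhdsLT_iff_exists_Ioo_subset' ht).1 (C.eventually_left t ω)
  exact ⟨u, hu, fun s hs => hsub hs⟩

lemma left_eq_of_forall_Ioo {u s : ℝ≥0} (hus : u < s) {ω : Ω} {x : Fin N → ℝ}
    (h : ∀ r ∈ Set.Ioo u s, C.X r ω = x) : C.left s ω = x := by
  have : (𝓝[<] s).NeBot := nhdsLT_neBot_of_exists_lt ⟨u, hus⟩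
  obtain ⟨r, hr, hr'⟩ := ((C.eventually_left s ω).and (Ioo_mem_nhdsLT hus)).exists
  rw [← hr, h r hr']

/-- The times at which the chain jumps. -/
def jumps (ω : Ω) : Set ℝ≥0 := {s | C.X s ω ≠ C.left s ω}

/-- The times at which the chain enters the state `j`. -/
def entries (j : Fin N) (ω : Ω) : Set ℝ≥0 := {s | C.left s ω j = 0 ∧ C.X s ω j = 1}

lemma X_apply_eq (t : ℝ≥0) (ω : Ω) (j : Fin N) : C.X t ω j = 0 ∨ C.X t ω j = 1 := by
  obtain ⟨i, hi⟩ := C.unit_vector t ω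
  rw [hi]
  by_cases h : j = i
  · right; rw [h]; simp
  · left; simp [h]

lemma left_apply_eq (t : ℝ≥0) (ω : Ω) (j : Fin N) : C.left t ω j = 0 ∨ C.left t ω j = 1 := by
  obtain ⟨i, hi⟩ := C.left_unit_vector t ω
  rw [hi]
  by_cases h : j = i
  · right; rw [h]; simp
  · left; simp [h]

lemma eq_single_of_X_apply {t : ℝ≥0} {ω : Ω} {j : Fin N} (h : C.X t ω j = 1) :
    C.X t ω = Pi.single j 1 := by
  obtain ⟨i, hi⟩ := C.unit_vector t ω
  rw [hi] at h ⊢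
  by_cases hj : j = i
  · rw [hj]
  · simp [hj] at h

lemma eq_single_of_left_apply {t : ℝ≥0} {ω : Ω} {j : Fin N} (h : C.left t ω j = 1) :
    C.left t ω = Pi.single j 1 := by
  obtain ⟨i, hi⟩ := C.left_unit_vector t ω
  rw [hi] at h ⊢
  by_cases hj : j = i
  · rw [hj]
  · simp [hj] at h

lemma entries_subset_jumps (j : Fin N) (ω : Ω) : C.entries j ω ⊆ C.jumps ω := by
  rintro s ⟨h1, h2⟩ h
  rw [h, h1] at h2
  exact zero_ne_one h2

lemma pos_of_mem_jumps {ω : Ω} {s : ℝ≥0} (hs : s ∈ C.jumps ω) : 0 < s := by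
  rcases eq_zero_or_pos s with rfl | h
  · exact absurd (C.left_zero ω).symm hs
  · exact h

lemma exists_entry_of_mem_jumps {ω : Ω} {s : ℝ≥0} (hs : s ∈ C.jumps ω) :
    ∃ j, s ∈ C.entries j ω := by
  obtain ⟨j, hj⟩ := C.unit_vector s ω
  refine ⟨j, ?_, by simp [hj]⟩
  rcases C.left_apply_eq s ω j with h | h
  · exact h
  · exact absurd (hj.trans (C.eq_single_of_left_apply h).symm) hs

lemma eq_of_mem_entries {ω : Ω} {s : ℝ≥0} {i j : Fin N} (hi : s ∈ C.entries i ω)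
    (hj : s ∈ C.entries j ω) : i = j := by
  have h := hj.2
  rw [C.eq_single_of_X_apply hi.2] at h
  by_contra hne
  simp [Ne.symm hne] at h

/-- The entry happens at u, the supremum of the times in [a, b] spent outside j. If X_u were outside
j, right constancy would prolong the stay beyond u. Times outside j lie arbitrarily close to u on
the left, and constancy there puts the left limit outside j. -/
lemma exists_entry {ω : Ω} {a b : ℝ≥0} (hab : a ≤ b) {j : Fin N} (ha : C.X a ω j = 0)
    (hb : C.X b ω j = 1) : ∃ s ∈ Set.Ioc a b, s ∈ C.entries j ω := by
  set S := {s | s ∈ Set.Icc a b ∧ C.X s ω j = 0} with hS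
  have haS : a ∈ S := ⟨⟨le_rfl, hab⟩, ha⟩
  have hbdd : BddAbove S := ⟨b, fun s hs => hs.1.2⟩
  set u := sSup S with hu
  have hau : a ≤ u := le_csSup hbdd haS
  have hub : u ≤ b := csSup_le ⟨a, haS⟩ fun s hs => hs.1.2
  have hXu : C.X u ω j = 1 := by
    rcases C.X_apply_eq u ω j with h | h
    · exfalso
      have hlt : u < b := lt_of_le_of_ne hub fun h' => by
        rw [h', hb] at h; exact one_ne_zero h
      obtain ⟨v, hv, hvc⟩ := C.exists_Ico_eq u ω
      obtain ⟨r, hr1, hr2⟩ := exists_between (lt_min hv hlt)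
      have hrS : r ∈ S := ⟨⟨hau.trans hr1.le, (hr2.trans_le (min_le_right _ _)).le⟩, by
        rw [hvc r ⟨hr1.le, hr2.trans_le (min_le_left _ _)⟩, h]⟩
      exact absurd (le_csSup hbdd hrS) (not_le.2 hr1)
    · exact h
  have hau' : a < u := lt_of_le_of_ne hau fun h' => by
    rw [← h', ha] at hXu; exact zero_ne_one hXu
  refine ⟨u, ⟨hau', hub⟩, ?_, hXu⟩
  obtain ⟨v, hv, hvc⟩ := C.exists_Ioo_eq_left u (zero_le.trans_lt hau') ω
  obtain ⟨r, hrS, hr⟩ := exists_lt_of_lt_csSup ⟨a, haS⟩ hv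
  have hru : r ≤ u := le_csSup hbdd hrS
  have hru' : r < u := lt_of_le_of_ne hru fun h' => by
    have := hrS.2
    rw [h', hXu] at this; exact one_ne_zero this
  rw [← hvc r ⟨hr, hru'⟩]
  exact hrS.2

lemma X_eq_of_no_jumps {ω : Ω} {a b : ℝ≥0} (hab : a ≤ b)
    (h : ∀ s ∈ Set.Ioc a b, s ∉ C.jumps ω) : C.X b ω = C.X a ω := by
  obtain ⟨j, hj⟩ := C.unit_vector b ω
  rcases C.X_apply_eq a ω j with h0 | h1
  · obtain ⟨s, hs, hse⟩ := C.exists_entry hab h0 (by simp [hj])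
    exact absurd (C.entries_subset_jumps j ω hse) (h s hs)
  · rw [C.eq_single_of_X_apply h1, hj]

lemma left_eq_of_no_jumps {ω : Ω} {a b : ℝ≥0} (hab : a < b)
    (h : ∀ s ∈ Set.Ioo a b, s ∉ C.jumps ω) : C.left b ω = C.X a ω :=
  C.left_eq_of_forall_Ioo hab fun _ hr => C.X_eq_of_no_jumps hr.1.le fun s hs =>
    h s ⟨hs.1, hs.2.trans_lt hr.2⟩

/-- The path is constant just before and just after t, so jump times are isolated; compactness of
[0, T] then makes them finite in number. -/
lemma eventually_notMem_jumps (t : ℝ≥0) (ω : Ω) : ∀ᶠ s in 𝓝[≠] t, s ∉ C.jumps ω := by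
  rw [← Set.Iio_union_Ioi, nhdsWithin_union, eventually_sup]
  constructor
  · rcases eq_zero_or_pos t with rfl | ht
    · simp
    · obtain ⟨u, hu, huc⟩ := C.exists_Ioo_eq_left t ht ω
      filter_upwards [Ioo_mem_nhdsLT hu] with s hs
      have := C.left_eq_of_forall_Ioo hs.1 fun r hr => huc r ⟨hr.1, hr.2.trans hs.2⟩
      simp [jumps, this, huc s hs]
  · obtain ⟨u, hu, huc⟩ := C.exists_Ico_eq t ω
    filter_upwards [Ioo_mem_nhdsGT hu] with s hs
    have := C.left_eq_of_forall_Ioo hs.1 fun r hr => huc r ⟨hr.1.le, hr.2.trans hs.2⟩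
    simp [jumps, this, huc s ⟨hs.1.le, hs.2⟩]

lemma finite_jumps (T : ℝ≥0) (ω : Ω) : (C.jumps ω ∩ Set.Icc 0 T).Finite := by
  have h : ∀ t ∈ Set.Icc 0 T, {s | s ≠ t → s ∉ C.jumps ω} ∈ 𝓝 t := fun t _ =>
    mem_nhdsWithin_iff_eventually.1 (C.eventually_notMem_jumps t ω)
  obtain ⟨F, -, hF⟩ := (isCompact_Icc (a := (0 : ℝ≥0)) (b := T)).elim_nhds_subcover _ h
  refine F.finite_toSet.subset fun s hs => ?_
  obtain ⟨t, htF, ht⟩ := Set.mem_iUnion₂.1 (hF hs.2)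
  by_contra hne
  exact ht (fun h => hne (h ▸ htF)) hs.1

lemma finite_jumps_Ioc (a b : ℝ≥0) (ω : Ω) : (C.jumps ω ∩ Set.Ioc a b).Finite :=
  (C.finite_jumps b ω).subset fun _ hs => ⟨hs.1, zero_le, hs.2.2⟩

lemma finite_entries_Ioc (j : Fin N) (a b : ℝ≥0) (ω : Ω) :
    (C.entries j ω ∩ Set.Ioc a b).Finite :=
  (C.finite_jumps_Ioc a b ω).subset (Set.inter_subset_inter_left _ (C.entries_subset_jumps j ω))

/-- The counting measure of the times at which the chain enters the state `j`. -/
noncomputable def entryMeasure (j : Fin N) (ω : Ω) : Measure ℝ≥0 :=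
  Measure.count.restrict (C.entries j ω)

lemma entryMeasure_restrict_Ioc (j : Fin N) (a b : ℝ≥0) (ω : Ω) :
    (C.entryMeasure j ω).restrict (Set.Ioc a b)
      = Measure.count.restrict ((C.finite_entries_Ioc j a b ω).toFinset : Set ℝ≥0) := by
  rw [entryMeasure, Measure.restrict_restrict measurableSet_Ioc, Set.Finite.coe_toFinset,
    Set.inter_comm]

lemma setLIntegral_entryMeasure (j : Fin N) (a b : ℝ≥0) (ω : Ω) (f : ℝ≥0 → ℝ≥0∞) :
    ∫⁻ s in Set.Ioc a b, f s ∂(C.entryMeasure j ω)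
      = ∑ s ∈ (C.finite_entries_Ioc j a b ω).toFinset, f s := by
  rw [entryMeasure_restrict_Ioc, lintegral_finset]
  simp

lemma entryMeasure_Ioc (j : Fin N) (a b : ℝ≥0) (ω : Ω) :
    C.entryMeasure j ω (Set.Ioc a b) = ((C.finite_entries_Ioc j a b ω).toFinset.card : ℝ≥0∞) := by
  rw [← Measure.restrict_apply_univ, entryMeasure_restrict_Ioc, Measure.restrict_apply_univ,
    Measure.count_apply_finset]

instance (j : Fin N) (a b : ℝ≥0) (ω : Ω) :
    IsFiniteMeasure ((C.entryMeasure j ω).restrict (Set.Ioc a b)) :=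
  ⟨by rw [Measure.restrict_apply_univ, entryMeasure_Ioc]; exact ENNReal.natCast_lt_top _⟩

/-- A sum over all jumps splits according to the state that is entered. -/
lemma sum_jumps_eq {M : Type*} [AddCommMonoid M] (a b : ℝ≥0) (ω : Ω) (f : ℝ≥0 → M) :
    ∑ s ∈ (C.finite_jumps_Ioc a b ω).toFinset, f s
      = ∑ j, ∑ s ∈ (C.finite_entries_Ioc j a b ω).toFinset, f s := by
  classical
  rw [← Finset.sum_biUnion]
  · refine Finset.sum_congr ?_ fun _ _ => rfl
    ext s
    simp only [Set.Finite.mem_toFinset, Finset.mem_biUnion, Finset.mem_univ, true_and]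
    constructor
    · rintro ⟨h1, h2⟩
      obtain ⟨j, hj⟩ := C.exists_entry_of_mem_jumps h1
      exact ⟨j, hj, h2⟩
    · rintro ⟨j, h1, h2⟩
      exact ⟨C.entries_subset_jumps j ω h1, h2⟩
  · intro i _ j _ hij
    refine Finset.disjoint_left.2 fun s hi hj => hij ?_
    rw [Set.Finite.mem_toFinset] at hi hj
    exact C.eq_of_mem_entries hi.1 hj.1

open Classical in
/-- The indicator of the event that the chain is outside `j` at time `s` and in `j` at time `t`. -/
noncomputable def transition (j : Fin N) (s t : ℝ≥0) (ω : Ω) : ℝ≥0∞ :=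
  if C.X s ω j = 0 ∧ C.X t ω j = 1 then 1 else 0

lemma transition_le (j : Fin N) {s t : ℝ≥0} (hst : s ≤ t) (ω : Ω) :
    C.transition j s t ω ≤ C.entryMeasure j ω (Set.Ioc s t) := by
  unfold transition
  split_ifs with h
  · obtain ⟨u, hu, hue⟩ := C.exists_entry hst h.1 h.2
    rw [entryMeasure_Ioc, Nat.one_le_cast, Nat.one_le_iff_ne_zero, Finset.card_ne_zero]
    exact ⟨u, by simpa using ⟨hue, hu⟩⟩
  · exact zero_le

/-- Take for δ the separation of the finitely many jumps in [0, T]. A shorter interval holds at most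
one jump, so an entry into j is not undone before the end of the interval and comparing the
endpoints counts it exactly. -/
lemma exists_transition_eq (j : Fin N) (T : ℝ≥0) (ω : Ω) : ∃ δ : ℝ≥0∞, 0 < δ ∧
    ∀ s t, s ≤ t → t ≤ T → edist s t < δ →
      C.transition j s t ω = C.entryMeasure j ω (Set.Ioc s t) := by
  obtain ⟨δ, hδ, hsep⟩ := Set.einfsep_pos.1 (C.finite_jumps T ω).einfsep_pos
  refine ⟨δ, hδ, fun s t hst htT hd => le_antisymm (C.transition_le j hst ω) ?_⟩
  rw [entryMeasure_Ioc]
  by_cases hemp : (C.finite_entries_Ioc j s t ω).toFinset = ∅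
  · simp [hemp]
  obtain ⟨u, hu⟩ := Finset.nonempty_iff_ne_empty.2 hemp
  have hu' : u ∈ C.entries j ω ∩ Set.Ioc s t := by simpa using hu
  have huniq : ∀ r ∈ C.jumps ω, r ∈ Set.Ioc s t → r = u := by
    intro r hr hrI
    by_contra hne
    have h1 := hsep r ⟨hr, zero_le, hrI.2.trans htT⟩ u
      ⟨C.entries_subset_jumps j ω hu'.1, zero_le, hu'.2.2.trans htT⟩ hne
    have h2 : edist r u ≤ edist s t := by
      rw [edist_nndist, edist_nndist]
      refine ENNReal.coe_le_coe.2 ?_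
      rw [← NNReal.coe_le_coe, coe_nndist, coe_nndist, NNReal.dist_eq, NNReal.dist_eq]
      have a1 := NNReal.coe_le_coe.2 hrI.1.le
      have a2 := NNReal.coe_le_coe.2 hrI.2
      have a3 := NNReal.coe_le_coe.2 hu'.2.1.le
      have a4 := NNReal.coe_le_coe.2 hu'.2.2
      rw [abs_le, abs_of_nonpos (by linarith)]
      constructor <;> linarith
    exact absurd (h1.trans h2) (not_le.2 hd)
  have hcard : (C.finite_entries_Ioc j s t ω).toFinset.card ≤ 1 := by
    refine Finset.card_le_one.2 fun a ha b hb => ?_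
    rw [Set.Finite.mem_toFinset] at ha hb
    rw [huniq a (C.entries_subset_jumps j ω ha.1) ha.2,
      huniq b (C.entries_subset_jumps j ω hb.1) hb.2]
  have h1 : C.X s ω j = 0 := by
    rw [← C.left_eq_of_no_jumps hu'.2.1 fun r hr hrj =>
      hr.2.ne (huniq r hrj ⟨hr.1, hr.2.le.trans hu'.2.2⟩)]
    exact hu'.1.1
  have h2 : C.X t ω j = 1 := by
    rw [C.X_eq_of_no_jumps hu'.2.2 fun r hr hrj =>
      hr.1.ne' (huniq r hrj ⟨hu'.2.1.trans hr.1, hr.2⟩)]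
    exact hu'.1.2
  rw [transition, if_pos ⟨h1, h2⟩]
  exact_mod_cast hcard

end MarkovChain

/-! ### Integrals against kernels of finite but not uniformly bounded mass. -/

section Kernel

open ProbabilityTheory

/-- Cut the parameter space according to the integer part of the total mass: on each piece the mass
is uniformly bounded. The number of entries of the chain has no bound that is uniform in ω. -/
lemma isSFiniteKernel_of_isFiniteMeasure {α β : Type*} {mα : MeasurableSpace α}
    {mβ : MeasurableSpace β} (κ : Kernel α β) (h : ∀ a, IsFiniteMeasure (κ a)) :
    IsSFiniteKernel κ := by
  classical
  have hm : ∀ n : ℕ, MeasurableSet {a | ⌊(κ a Set.univ).toNNReal⌋₊ = n} := fun n =>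
    (Nat.measurable_floor.comp ((κ.measurable_coe MeasurableSet.univ).ennreal_toNNReal))
      (measurableSet_singleton n)
  let κs : ℕ → Kernel α β := fun n => Kernel.piecewise (hm n) κ 0
  refine ⟨κs, fun n => ⟨(n + 1 : ℝ≥0∞), by finiteness, fun a => ?_⟩, ?_⟩
  · simp only [κs, Kernel.piecewise_apply, Set.mem_ofPred_eq]
    split_ifs with hn
    · have h1 : (κ a Set.univ).toNNReal < (n + 1 : ℕ) := by
        rw [← hn]; exact_mod_cast Nat.lt_floor_add_one _
      rw [← ENNReal.coe_toNNReal (measure_ne_top (κ a) Set.univ)]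
      exact_mod_cast h1.le
    · simp
  · ext1 a
    rw [Kernel.sum_apply]
    ext s hs
    rw [Measure.sum_apply _ hs, tsum_eq_single ⌊(κ a Set.univ).toNNReal⌋₊]
    · simp [κs, Kernel.piecewise_apply]
    · intro n hn
      simp [κs, Kernel.piecewise_apply, hn.symm]

lemma measurable_lintegral_of_finite {α β : Type*} {mα : MeasurableSpace α}
    {mβ : MeasurableSpace β} {κ : α → Measure β} (hκ : Measurable κ)
    (h : ∀ a, IsFiniteMeasure (κ a)) {f : α → β → ℝ≥0∞}
    (hf : Measurable (Function.uncurry f)) : Measurable fun a => ∫⁻ b, f a b ∂(κ a) := by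
  let K : Kernel α β := ⟨κ, hκ⟩
  have : IsSFiniteKernel K := isSFiniteKernel_of_isFiniteMeasure K h
  exact Measurable.lintegral_kernel_prod_right (κ := K) hf

end Kernel

/-! ### The predictable σ-algebra and predictable left limits. -/

section Predictable

variable {Ω : Type*} {mΩ : MeasurableSpace Ω} {𝓕 : Filtration ℝ≥0 mΩ}

lemma predictable_le_prod : 𝓕.predictable ≤ (inferInstance : MeasurableSpace (ℝ≥0 × Ω)) :=
  measurableSpace_le_predictable_of_measurableSet
    (fun A hA => (measurableSet_singleton _).prod (𝓕.le _ A hA))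
    (fun i A hA => measurableSet_Ioi.prod (𝓕.le i A hA))

lemma measurable_fst_predictable : Measurable[𝓕.predictable] (Prod.fst : ℝ≥0 × Ω → ℝ≥0) := by
  refine measurable_of_Ioi (mδ := 𝓕.predictable) fun i => ?_
  have : (Prod.fst : ℝ≥0 × Ω → ℝ≥0) ⁻¹' Set.Ioi i = Set.Ioi i ×ˢ Set.univ := by
    ext; simp
  rw [this]
  exact measurableSet_predictable_Ioi_prod MeasurableSet.univ

/-- A predictable process, read on `[0, t] × Ω`, is measurable for the events known at time `t`. -/
lemma measurable_min_of_predictable {E : Type*} [MeasurableSpace E] {H : ℝ≥0 × Ω → E}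
    (hH : Measurable[𝓕.predictable] H) (t : ℝ≥0) :
    Measurable[(𝓕 t).prod inferInstance] fun p : Ω × ℝ≥0 => H (min p.2 t, p.1) := by
  let : MeasurableSpace Ω := 𝓕 t
  have h1 : Measurable fun p : Ω × ℝ≥0 => ((⟨min p.2 t, Set.mem_Iic.2 (min_le_right _ _)⟩ : Set.Iic t), p.1) := by
    refine Measurable.prodMk (Measurable.subtype_mk ?_) measurable_fst
    fun_prop
  exact hH.comp ((measurable_inclusion_predictable (𝓕 := 𝓕) (i := t)).comp h1)

lemma measurable_setLIntegral_of_predictable {κ : Ω → Measure ℝ≥0} {t : ℝ≥0}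
    (hκ : Measurable[𝓕 t] fun ω => (κ ω).restrict (Set.Ioc 0 t))
    (hfin : ∀ ω, IsFiniteMeasure ((κ ω).restrict (Set.Ioc 0 t))) {H : ℝ≥0 × Ω → ℝ≥0∞}
    (hH : Measurable[𝓕.predictable] H) :
    Measurable[𝓕 t] fun ω => ∫⁻ s in Set.Ioc 0 t, H (s, ω) ∂(κ ω) := by
  have h := @measurable_lintegral_of_finite Ω ℝ≥0 (𝓕 t) _ _ hκ hfin
    (fun ω s => H (min s t, ω)) (measurable_min_of_predictable hH t)
  convert h using 2 with ω
  refine setLIntegral_congr_fun measurableSet_Ioc fun s hs => ?_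
  simp [min_eq_left hs.2]

/-- The left end of the interval of the grid of mesh `1 / (n + 1)` that contains `t`. -/
noncomputable def gridLeft (n : ℕ) (t : ℝ≥0) : ℝ≥0 := ((⌈(n + 1) * t⌉₊ - 1 : ℕ) : ℝ≥0) / (n + 1)

lemma gridLeft_zero (n : ℕ) : gridLeft n 0 = 0 := by simp [gridLeft]

lemma gridLeft_lt (n : ℕ) {t : ℝ≥0} (ht : 0 < t) : gridLeft n t < t := by
  have h1 : 0 < ⌈(n + 1) * t⌉₊ := Nat.ceil_pos.2 (by positivity)
  have h2 : ((⌈(n + 1) * t⌉₊ - 1 : ℕ) : ℝ≥0) < (n + 1) * t := by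
    rw [← Nat.lt_ceil]; omega
  rw [gridLeft, div_lt_iff₀ (by positivity), mul_comm t]
  exact h2

lemma le_gridLeft_add (n : ℕ) (t : ℝ≥0) : t ≤ gridLeft n t + 1 / (n + 1) := by
  rw [gridLeft, ← add_div, le_div_iff₀ (by positivity), mul_comm t]
  refine (Nat.le_ceil _).trans ?_
  have : ⌈(n + 1) * t⌉₊ ≤ (⌈(n + 1) * t⌉₊ - 1) + 1 := by omega
  exact_mod_cast this

lemma tendsto_gridLeft {t : ℝ≥0} (ht : 0 < t) :
    Tendsto (fun n => gridLeft n t) atTop (𝓝[<] t) := by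
  refine tendsto_nhdsWithin_iff.2 ⟨?_, Eventually.of_forall fun n => gridLeft_lt n ht⟩
  have h0 : Tendsto (fun n : ℕ => (1 : ℝ≥0) / (n + 1)) atTop (𝓝 0) := by
    exact NNReal.tendsto_coe.1 (by simpa using tendsto_one_div_add_atTop_nhds_zero_nat (𝕜 := ℝ))
  have h1 : Tendsto (fun n : ℕ => t - 1 / ((n : ℝ≥0) + 1)) atTop (𝓝 t) := by
    have := (tendsto_const_nhds (x := t)).sub h0
    simpa using this
  refine tendsto_of_tendsto_of_tendsto_of_le_of_le h1 tendsto_const_nhds (fun n => ?_)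
    (fun n => (gridLeft_lt n ht).le)
  exact tsub_le_iff_right.2 (le_gridLeft_add n t)

lemma gridLeft_preimage (n k : ℕ) :
    {t : ℝ≥0 | ⌈(n + 1) * t⌉₊ - 1 = k}
      = (if k = 0 then {⊥} else ∅) ∪ Set.Ioc ((k : ℝ≥0) / (n + 1)) ((k + 1 : ℝ≥0) / (n + 1)) := by
  ext t
  have hpos : (0 : ℝ≥0) < n + 1 := by positivity
  simp only [Set.mem_ofPred_eq, Set.mem_union, Set.mem_Ioc]
  rw [div_lt_iff₀ hpos, le_div_iff₀ hpos, mul_comm t]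
  rcases eq_zero_or_pos t with rfl | ht
  · by_cases hk : k = 0
    · simp [hk]
    · simp [hk, Ne.symm hk]
  · have h1 : 0 < ⌈(n + 1) * t⌉₊ := Nat.ceil_pos.2 (by positivity)
    have hne : ¬ t ∈ (if k = 0 then ({⊥} : Set ℝ≥0) else ∅) := by
      split_ifs
      · simpa using ht.ne'
      · simp
    have h2 : ((k : ℝ≥0) < (n + 1) * t) ↔ k < ⌈(n + 1) * t⌉₊ := Nat.lt_ceil.symm
    have h3 : ((n + 1) * t ≤ (k + 1 : ℝ≥0)) ↔ ⌈(n + 1) * t⌉₊ ≤ k + 1 := by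
      rw [Nat.ceil_le]; push_cast; rfl
    rw [h2, h3]
    simp only [hne, false_or]
    omega

/-- On a cell (k/(n+1), (k+1)/(n+1)] the sampled process takes the value at the left endpoint, which
is known there. Rounding up makes the cells open on the left, as predictable rectangles have to be;
the time 0 is attached to the first cell. -/
lemma measurable_gridLeft {E : Type*} [MeasurableSpace E] {Y : ℝ≥0 → Ω → E}
    (hY : ∀ t, Measurable[𝓕 t] (Y t)) (n : ℕ) :
    Measurable[𝓕.predictable] fun p : ℝ≥0 × Ω => Y (gridLeft n p.1) p.2 := by
  intro B hB
  have h : (fun p : ℝ≥0 × Ω => Y (gridLeft n p.1) p.2) ⁻¹' B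
      = ⋃ k : ℕ, {t : ℝ≥0 | ⌈(n + 1) * t⌉₊ - 1 = k} ×ˢ (Y ((k : ℝ≥0) / (n + 1)) ⁻¹' B) := by
    ext ⟨t, ω⟩
    simp [gridLeft]
  rw [h]
  refine MeasurableSet.iUnion fun k => ?_
  rw [gridLeft_preimage, Set.union_prod]
  refine MeasurableSet.union ?_ (measurableSet_predictable_Ioc_prod _ _ (hY _ hB))
  split_ifs with hk
  · subst hk
    refine measurableSet_predictable_singleton_bot_prod ?_
    have h0 : ((0 : ℕ) : ℝ≥0) / (n + 1) = ⊥ := by simp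
    rw [h0]
    exact hY ⊥ hB
  · simp

/-- The predictable version of the left limits of a process. -/
noncomputable def leftVersion (Y : ℝ≥0 → Ω → ℝ) (p : ℝ≥0 × Ω) : ℝ :=
  limsup (fun n => Y (gridLeft n p.1) p.2) atTop

/-- The upper limit along the grids is measurable whether or not the path has left limits, so no
exceptional paths have to be removed. -/
lemma measurable_leftVersion {Y : ℝ≥0 → Ω → ℝ} (hY : ∀ t, Measurable[𝓕 t] (Y t)) :
    Measurable[𝓕.predictable] (leftVersion Y) :=
  Measurable.limsup (mδ := 𝓕.predictable) fun n => measurable_gridLeft hY n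

lemma leftVersion_eq {Y : ℝ≥0 → Ω → ℝ} {t : ℝ≥0} (ht : 0 < t) {ω : Ω} {y : ℝ}
    (h : Tendsto (fun s => Y s ω) (𝓝[<] t) (𝓝 y)) : leftVersion Y (t, ω) = y :=
  (h.comp (tendsto_gridLeft ht)).limsup_eq

lemma leftVersion_zero (Y : ℝ≥0 → Ω → ℝ) (ω : Ω) : leftVersion Y (0, ω) = Y 0 ω := by
  simp [leftVersion, gridLeft_zero]

end Predictable

/-! ### Adaptedness of the counting measures of the entries. -/

namespace MarkovChain

variable {Ω : Type*} [mΩ : MeasurableSpace Ω] {P : Measure Ω} {N : ℕ} (C : MarkovChain P N)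

lemma measurable_X_filtration {s t : ℝ≥0} (hst : s ≤ t) : Measurable[C.filtration t] (C.X s) := by
  refine Measurable.mono (comap_measurable (C.X s)) ?_ le_rfl
  exact le_sup_of_le_left (le_iSup₂_of_le s hst le_rfl)

lemma measurable_left_predictable :
    Measurable[C.filtration.predictable] fun p : ℝ≥0 × Ω => C.left p.1 p.2 := by
  refine @measurable_pi_lambda _ _ _ C.filtration.predictable _ _ fun j => ?_
  have h : (fun p : ℝ≥0 × Ω => C.left p.1 p.2 j) = leftVersion fun t ω => C.X t ω j := by
    ext ⟨t, ω⟩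
    rcases eq_zero_or_pos t with rfl | ht
    · rw [leftVersion_zero, C.left_zero]
    · exact (leftVersion_eq ht ((tendsto_pi_nhds.1 (C.tendsto_left t ω)) j)).symm
  rw [h]
  exact measurable_leftVersion fun t => (measurable_pi_apply j).comp (C.measurable_X_filtration le_rfl)

lemma measurable_transition {s t r : ℝ≥0} (hs : s ≤ r) (ht : t ≤ r) (j : Fin N) :
    Measurable[C.filtration r] (C.transition j s t) := by
  unfold transition
  refine Measurable.ite ?_ measurable_const measurable_const
  exact (((measurable_pi_apply j).comp (C.measurable_X_filtration hs))
      (measurableSet_singleton (0 : ℝ))).inter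
    (((measurable_pi_apply j).comp (C.measurable_X_filtration ht))
      (measurableSet_singleton (1 : ℝ)))

/-- The point number `k` of the partition of `[a, b]` into `n + 1` intervals of equal length. -/
noncomputable def _root_.MarkovRBSDE.gridPoint (a b : ℝ≥0) (n k : ℕ) : ℝ≥0 :=
  a + (b - a) * (k / (n + 1))

lemma _root_.MarkovRBSDE.gridPoint_mono (a b : ℝ≥0) (n : ℕ) : Monotone (gridPoint a b n) := by
  intro k l h
  unfold gridPoint
  gcongr

lemma _root_.MarkovRBSDE.gridPoint_zero (a b : ℝ≥0) (n : ℕ) : gridPoint a b n 0 = a := by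
  simp [gridPoint]

lemma _root_.MarkovRBSDE.gridPoint_last {a b : ℝ≥0} (hab : a ≤ b) (n : ℕ) :
    gridPoint a b n (n + 1) = b := by
  have : ((n + 1 : ℕ) : ℝ≥0) / (n + 1) = 1 := by push_cast; exact div_self (by positivity)
  rw [gridPoint, this, mul_one, add_tsub_cancel_of_le hab]

lemma _root_.MarkovRBSDE.le_gridPoint (a b : ℝ≥0) (n k : ℕ) : a ≤ gridPoint a b n k :=
  le_self_add

lemma _root_.MarkovRBSDE.gridPoint_le {a b : ℝ≥0} (hab : a ≤ b) {n k : ℕ} (hk : k ≤ n + 1) :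
    gridPoint a b n k ≤ b := by
  exact (gridPoint_mono a b n hk).trans_eq (gridPoint_last hab n)

lemma _root_.MarkovRBSDE.gridPoint_succ_sub (a b : ℝ≥0) (n k : ℕ) :
    (gridPoint a b n (k + 1) : ℝ) - gridPoint a b n k = (b - a : ℝ≥0) / (n + 1) := by
  unfold gridPoint
  push_cast
  field_simp
  ring

lemma _root_.MarkovRBSDE.measure_Ioc_eq_sum (μ : Measure ℝ≥0) {a b : ℝ≥0} (hab : a ≤ b) (n : ℕ) :
    μ (Set.Ioc a b)
      = ∑ k ∈ Finset.range (n + 1), μ (Set.Ioc (gridPoint a b n k) (gridPoint a b n (k + 1))) := by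
  have h : ∀ l, μ (Set.Ioc a (gridPoint a b n l))
      = ∑ k ∈ Finset.range l, μ (Set.Ioc (gridPoint a b n k) (gridPoint a b n (k + 1))) := by
    intro l
    induction l with
    | zero => simp [gridPoint_zero]
    | succ l ih =>
      rw [Finset.sum_range_succ, ← ih, ← measure_union (Set.Ioc_disjoint_Ioc_of_le le_rfl)
        measurableSet_Ioc, Set.Ioc_union_Ioc_eq_Ioc (le_gridPoint a b n l)
        (gridPoint_mono a b n l.le_succ)]
  rw [← h, gridPoint_last hab]

/-- The number of transitions into `j` that are visible on a grid. -/
noncomputable def gridCount (j : Fin N) (a b : ℝ≥0) (n : ℕ) (ω : Ω) : ℝ≥0∞ :=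
  ∑ k ∈ Finset.range (n + 1), C.transition j (gridPoint a b n k) (gridPoint a b n (k + 1)) ω

lemma gridCount_le (j : Fin N) {a b : ℝ≥0} (hab : a ≤ b) (n : ℕ) (ω : Ω) :
    C.gridCount j a b n ω ≤ C.entryMeasure j ω (Set.Ioc a b) := by
  rw [measure_Ioc_eq_sum _ hab n]
  exact Finset.sum_le_sum fun k _ => C.transition_le j (gridPoint_mono a b n k.le_succ) ω

lemma tendsto_gridCount (j : Fin N) {a b : ℝ≥0} (hab : a ≤ b) (ω : Ω) :
    Tendsto (fun n => C.gridCount j a b n ω) atTop (𝓝 (C.entryMeasure j ω (Set.Ioc a b))) := by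
  obtain ⟨δ, hδ, h⟩ := C.exists_transition_eq j b ω
  have h0 : Tendsto (fun n : ℕ => ENNReal.ofReal ((b - a : ℝ≥0) / ((n : ℝ) + 1))) atTop (𝓝 0) := by
    rw [← ENNReal.ofReal_zero]
    refine (ENNReal.continuous_ofReal.tendsto 0).comp ?_
    have := (tendsto_one_div_add_atTop_nhds_zero_nat (𝕜 := ℝ)).const_mul ((b - a : ℝ≥0) : ℝ)
    simpa [div_eq_mul_inv] using this
  refine tendsto_const_nhds.congr' ?_
  filter_upwards [(tendsto_order.1 h0).2 δ hδ] with n hn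
  rw [measure_Ioc_eq_sum _ hab n, gridCount]
  refine (Finset.sum_congr rfl fun k hk => ?_).symm
  refine h _ _ (gridPoint_mono a b n k.le_succ)
    (gridPoint_le hab (Nat.succ_le_of_lt (Finset.mem_range.1 hk))) ?_
  rw [edist_comm, edist_dist, NNReal.dist_eq, gridPoint_succ_sub, abs_of_nonneg (by positivity)]
  exact hn

lemma measurable_gridCount {a b r : ℝ≥0} (hab : a ≤ b) (hbr : b ≤ r) (j : Fin N) (n : ℕ) :
    Measurable[C.filtration r] (C.gridCount j a b n) := by
  refine Finset.measurable_sum _ fun k hk => ?_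
  have := Finset.mem_range.1 hk
  exact C.measurable_transition ((gridPoint_le hab (by omega)).trans hbr)
    ((gridPoint_le hab (by omega)).trans hbr) j

/-- The counts seen on grids depend on the chain at finitely many times before r, and they converge
to the number of entries. -/
lemma measurable_entryMeasure_Ioc {a b r : ℝ≥0} (hab : a ≤ b) (hbr : b ≤ r) (j : Fin N) :
    Measurable[C.filtration r] fun ω => C.entryMeasure j ω (Set.Ioc a b) :=
  @measurable_of_tendsto_metrizable _ _ (C.filtration r) _ _ _ _ _ _ (fun n => C.measurable_gridCount hab hbr j n)
    (tendsto_pi_nhds.2 fun ω => C.tendsto_gridCount j hab ω)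

lemma measurable_entryMeasure {t r : ℝ≥0} (htr : t ≤ r) (j : Fin N) :
    Measurable[C.filtration r] fun ω => (C.entryMeasure j ω).restrict (Set.Ioc 0 t) := by
  refine Measurable.measure_of_isPiSystem
    (by rw [← borel_eq_generateFrom_Iic]; exact BorelSpace.measurable_eq) isPiSystem_Iic ?_ ?_
  · rintro _ ⟨b, rfl⟩
    have : ∀ ω, (C.entryMeasure j ω).restrict (Set.Ioc 0 t) (Set.Iic b)
        = C.entryMeasure j ω (Set.Ioc 0 (min t b)) := fun ω => by
      rw [Measure.restrict_apply measurableSet_Iic, Set.inter_comm, Set.Ioc_inter_Iic]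
    simp_rw [this]
    exact C.measurable_entryMeasure_Ioc zero_le ((min_le_left _ _).trans htr) j
  · simp_rw [Measure.restrict_apply_univ]
    exact C.measurable_entryMeasure_Ioc zero_le htr j

end MarkovChain

/-! ### The intensity of the entries, from the martingale problem. -/

namespace MarkovChain

variable {Ω : Type*} [mΩ : MeasurableSpace Ω] {P : Measure Ω} {N : ℕ} (C : MarkovChain P N)

/-- The net rate of change of the probability of the state `j`. -/
noncomputable def flow (j : Fin N) (s : ℝ≥0) (ω : Ω) : ℝ := (C.A s *ᵥ C.left s ω) j

/-- The intensity of the jumps into the state `j`. -/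
noncomputable def intensity (j : Fin N) (s : ℝ≥0) (ω : Ω) : ℝ :=
  (1 - C.left s ω j) * C.flow j s ω

lemma flow_eq {s : ℝ≥0} {ω : Ω} {i : Fin N} (hi : C.left s ω = Pi.single i 1) (j : Fin N) :
    C.flow j s ω = C.A s j i := by
  rw [flow, hi, Matrix.mulVec_single_one]
  rfl

lemma intensity_eq {s : ℝ≥0} {ω : Ω} {i : Fin N} (hi : C.left s ω = Pi.single i 1) (j : Fin N) :
    C.intensity j s ω = if j = i then 0 else C.A s j i := by
  rw [intensity, C.flow_eq hi, hi]
  split_ifs with h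
  · subst h; simp
  · simp [h]

lemma intensity_nonneg (j : Fin N) (s : ℝ≥0) (ω : Ω) : 0 ≤ C.intensity j s ω := by
  obtain ⟨i, hi⟩ := C.left_unit_vector s ω
  rw [C.intensity_eq hi]
  split_ifs with h
  · exact le_rfl
  · exact C.rate.nonneg s j i h

lemma exists_abs_flow_le : ∃ b : ℝ, 0 ≤ b ∧ ∀ j s ω, |C.flow j s ω| ≤ b := by
  obtain ⟨b, hb⟩ := C.rate.bounded
  refine ⟨max b 0, le_max_right _ _, fun j s ω => ?_⟩
  obtain ⟨i, hi⟩ := C.left_unit_vector s ω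
  rw [C.flow_eq hi]
  exact (hb _ _ _).trans (le_max_left _ _)

lemma abs_intensity_le (j : Fin N) (s : ℝ≥0) (ω : Ω) : |C.intensity j s ω| ≤ |C.flow j s ω| := by
  rw [intensity]
  rcases C.left_apply_eq s ω j with h | h <;> simp [h]

lemma measurable_flow_predictable (j : Fin N) :
    Measurable[C.filtration.predictable] fun p : ℝ≥0 × Ω => C.flow j p.1 p.2 := by
  unfold flow Matrix.mulVec dotProduct
  refine Finset.measurable_sum _ fun i _ => ?_
  exact ((C.rate.measurable j i).comp measurable_fst_predictable).mul
    ((measurable_pi_apply i).comp C.measurable_left_predictable)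

lemma measurable_intensity_predictable (j : Fin N) :
    Measurable[C.filtration.predictable] fun p : ℝ≥0 × Ω => C.intensity j p.1 p.2 := by
  unfold intensity
  exact (measurable_const.sub ((measurable_pi_apply j).comp C.measurable_left_predictable)).mul
    (C.measurable_flow_predictable j)

lemma measurable_flow (j : Fin N) : Measurable fun p : ℝ≥0 × Ω => C.flow j p.1 p.2 :=
  (C.measurable_flow_predictable j).mono predictable_le_prod le_rfl

lemma measurable_intensity (j : Fin N) : Measurable fun p : ℝ≥0 × Ω => C.intensity j p.1 p.2 :=
  (C.measurable_intensity_predictable j).mono predictable_le_prod le_rfl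

lemma countable_jumps (ω : Ω) : (C.jumps ω).Countable := by
  have : C.jumps ω = ⋃ n : ℕ, C.jumps ω ∩ Set.Icc 0 (n : ℝ≥0) := by
    rw [← Set.inter_iUnion]
    refine (Set.inter_eq_self_of_subset_left fun x _ => ?_).symm
    obtain ⟨n, hn⟩ := exists_nat_ge x
    exact Set.mem_iUnion.2 ⟨n, zero_le, hn⟩
  rw [this]
  exact Set.countable_iUnion fun n => (C.finite_jumps n ω).countable

lemma ae_notMem_jumps (ω : Ω) : ∀ᵐ s ∂lebesgue, s ∉ C.jumps ω :=
  measure_eq_zero_iff_ae_notMem.1 ((C.countable_jumps ω).measure_zero lebesgue)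

lemma ae_X_eq_left (ω : Ω) : ∀ᵐ s ∂lebesgue, C.X s ω = C.left s ω :=
  (C.ae_notMem_jumps ω).mono fun s hs => by simpa [jumps] using hs

lemma integrableOn_flow (j : Fin N) (ω : Ω) (a b : ℝ≥0) :
    IntegrableOn (fun s => C.flow j s ω) (Set.Ioc a b) lebesgue := by
  obtain ⟨B, -, hB⟩ := C.exists_abs_flow_le
  refine Integrable.of_bound
    ((C.measurable_flow j).comp measurable_prodMk_right).aestronglyMeasurable B
    (Eventually.of_forall fun s => hB j s ω)

lemma integrableOn_intensity (j : Fin N) (ω : Ω) (a b : ℝ≥0) :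
    IntegrableOn (fun s => C.intensity j s ω) (Set.Ioc a b) lebesgue := by
  obtain ⟨B, -, hB⟩ := C.exists_abs_flow_le
  refine Integrable.of_bound
    ((C.measurable_intensity j).comp measurable_prodMk_right).aestronglyMeasurable B
    (Eventually.of_forall fun s => (C.abs_intensity_le j s ω).trans (hB j s ω))

lemma _root_.MarkovRBSDE.norm_setIntegral_Ioc_le {g : ℝ≥0 → ℝ} {B : ℝ} (hB : ∀ s, |g s| ≤ B)
    {a b : ℝ≥0} (hab : a ≤ b) : ‖∫ s in Set.Ioc a b, g s ∂lebesgue‖ ≤ B * (b - a) := by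
  have := norm_setIntegral_le_of_norm_le_const (μ := lebesgue) (s := Set.Ioc a b) (f := g)
    (C := B) (by rw [lebesgue_Ioc]; exact ENNReal.ofReal_lt_top) (fun s _ => hB s)
  rwa [measureReal_def, lebesgue_Ioc, ENNReal.toReal_ofReal] at this
  exact sub_nonneg.2 (NNReal.coe_le_coe.2 hab)

lemma integrable_setIntegral_of_bounded [IsFiniteMeasure P] {g : ℝ≥0 → Ω → ℝ} {B : ℝ}
    (hg : Measurable fun p : ℝ≥0 × Ω => g p.1 p.2) (hB : ∀ s ω, |g s ω| ≤ B) {a b : ℝ≥0}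
    (hab : a ≤ b) : Integrable (fun ω => ∫ s in Set.Ioc a b, g s ω ∂lebesgue) P := by
  refine Integrable.of_bound (C := B * (b - a)) ?_
    (Eventually.of_forall fun ω => norm_setIntegral_Ioc_le (fun s => hB s ω) hab)
  have : Measurable fun p : Ω × ℝ≥0 => g p.2 p.1 := hg.comp measurable_swap
  exact (this.stronglyMeasurable.integral_prod_right
    (ν := lebesgue.restrict (Set.Ioc a b))).aestronglyMeasurable

lemma martingale_apply (j : Fin N) (t : ℝ≥0) (ω : Ω) :
    (C.X t ω - C.X 0 ω - ∫ s in Set.Ioc 0 t, C.A s *ᵥ C.X s ω ∂lebesgue) j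
      = C.X t ω j - C.X 0 ω j - ∫ s in Set.Ioc 0 t, C.flow j s ω ∂lebesgue := by
  have h : ∀ i, ∀ᵐ s ∂(lebesgue.restrict (Set.Ioc 0 t)),
      (C.A s *ᵥ C.X s ω) i = C.flow i s ω := fun i =>
    (ae_restrict_of_ae (C.ae_X_eq_left ω)).mono fun s hs => by rw [flow, hs]
  rw [Pi.sub_apply, Pi.sub_apply, eval_integral, integral_congr_ae (h j)]
  exact fun i => (C.integrableOn_flow i ω 0 t).congr ((h i).mono fun s hs => hs.symm)

/-- On the event that the chain is outside j at time s, the coordinate X^j starts at 0, so its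
expectation at time t is the probability of the transition. This event belongs to the past of s, and
the martingale property converts the expectation into that of the integrated flow. -/
lemma measureReal_transition [IsProbabilityMeasure P] (j : Fin N) {s t : ℝ≥0} (hst : s ≤ t) {S : Set Ω}
    (hS : MeasurableSet[C.filtration s] S) :
    P.real (S ∩ {ω | C.X s ω j = 0} ∩ {ω | C.X t ω j = 1})
      = ∫ ω in S ∩ {ω | C.X s ω j = 0}, ∫ r in Set.Ioc s t, C.flow j r ω ∂lebesgue ∂P := by
  obtain ⟨B, -, hB⟩ := C.exists_abs_flow_le
  set S' := S ∩ {ω | C.X s ω j = 0} with hS'def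
  have hS' : MeasurableSet[C.filtration s] S' := hS.inter
    (((measurable_pi_apply j).comp (C.measurable_X_filtration le_rfl))
      (measurableSet_singleton (0 : ℝ)))
  have hS'm : MeasurableSet S' := C.filtration.le s _ hS'
  have hXint : ∀ t, IntegrableOn (fun ω => C.X t ω j) S' P := fun t => by
    refine Integrable.of_bound (C := 1)
      ((measurable_pi_apply j).comp (C.measurable t)).aestronglyMeasurable
      (Eventually.of_forall fun ω => ?_)
    rcases C.X_apply_eq t ω j with h | h <;> simp [h]
  have hWint : ∀ a b, a ≤ b →
      IntegrableOn (fun ω => ∫ r in Set.Ioc a b, C.flow j r ω ∂lebesgue) S' P := fun a b hab =>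
    (integrable_setIntegral_of_bounded (C.measurable_flow j) (hB j) hab).integrableOn
  have h := congrFun (C.martingale.setIntegral_eq hst hS') j
  have hev : ∀ t i, Integrable (fun ω => (C.X t ω - C.X 0 ω
      - ∫ s in Set.Ioc 0 t, C.A s *ᵥ C.X s ω ∂lebesgue) i) (P.restrict S') := fun t i =>
    ((C.martingale.integrable t).integrableOn (s := S')).eval i
  rw [eval_integral (hev s), eval_integral (hev t)] at h
  simp_rw [C.martingale_apply] at h
  have hsplit : ∀ t, ∫ ω in S', (C.X t ω j - C.X 0 ω j
        - ∫ r in Set.Ioc 0 t, C.flow j r ω ∂lebesgue) ∂P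
      = ∫ ω in S', C.X t ω j ∂P - ∫ ω in S', C.X 0 ω j ∂P
        - ∫ ω in S', ∫ r in Set.Ioc 0 t, C.flow j r ω ∂lebesgue ∂P := fun t => by
    rw [← integral_sub (hXint t) (hXint 0)]
    exact integral_sub ((hXint t).sub (hXint 0)) (hWint 0 t zero_le)
  rw [hsplit, hsplit] at h
  have h0 : ∫ ω in S', C.X s ω j ∂P = 0 :=
    setIntegral_eq_zero_of_forall_eq_zero fun ω hω => hω.2
  have h1 : ∫ ω in S', C.X t ω j ∂P = P.real (S' ∩ {ω | C.X t ω j = 1}) := by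
    have hm : MeasurableSet {ω | C.X t ω j = 1} :=
      ((measurable_pi_apply j).comp (C.measurable t)) (measurableSet_singleton (1 : ℝ))
    have : (fun ω => C.X t ω j) = Set.indicator {ω | C.X t ω j = 1} 1 := by
      ext ω
      rcases C.X_apply_eq t ω j with h | h <;> simp [h]
    rw [this, integral_indicator_one hm, measureReal_restrict_apply hm, Set.inter_comm]
  have h2 : ∫ ω in S', ∫ r in Set.Ioc s t, C.flow j r ω ∂lebesgue ∂P
      = ∫ ω in S', ∫ r in Set.Ioc 0 t, C.flow j r ω ∂lebesgue ∂P
        - ∫ ω in S', ∫ r in Set.Ioc 0 s, C.flow j r ω ∂lebesgue ∂P := by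
    rw [← integral_sub (hWint 0 t zero_le) (hWint 0 s zero_le)]
    refine integral_congr_ae (Eventually.of_forall fun ω => ?_)
    simp only
    rw [← Set.Ioc_union_Ioc_eq_Ioc (zero_le (a := s)) hst,
      setIntegral_union (Set.Ioc_disjoint_Ioc_of_le le_rfl) measurableSet_Ioc
      (C.integrableOn_flow j ω _ _) (C.integrableOn_flow j ω _ _)]
    ring
  rw [← h1, h2]
  linarith

lemma setLIntegral_transition (j : Fin N) {s t : ℝ≥0} (S : Set Ω) :
    ∫⁻ ω in S, C.transition j s t ω ∂P
      = P (S ∩ {ω | C.X s ω j = 0} ∩ {ω | C.X t ω j = 1}) := by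
  have hm : MeasurableSet ({ω | C.X s ω j = 0} ∩ {ω | C.X t ω j = 1}) :=
    (((measurable_pi_apply j).comp (C.measurable s)) (measurableSet_singleton (0 : ℝ))).inter
    (((measurable_pi_apply j).comp (C.measurable t)) (measurableSet_singleton (1 : ℝ)))
  have : C.transition j s t
      = ({ω | C.X s ω j = 0} ∩ {ω | C.X t ω j = 1}).indicator 1 := by
    ext ω
    simp only [transition, Set.indicator_apply, Set.mem_inter_iff, Set.mem_ofPred_eq, Pi.one_apply]
  rw [this, lintegral_indicator_one hm, Measure.restrict_apply hm, Set.inter_assoc S, Set.inter_comm]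

/-- A transition over [s, t] has probability at most B(t - s); these bounds add up to B(b - a) on
every grid, and Fatou's lemma passes to the number of entries. Only with this integrability can the
counts be passed to the limit by domination. -/
lemma lintegral_entryMeasure_ne_top [IsProbabilityMeasure P] (j : Fin N) {a b : ℝ≥0} (hab : a ≤ b) :
    ∫⁻ ω, C.entryMeasure j ω (Set.Ioc a b) ∂P ≠ ∞ := by
  obtain ⟨B, hB0, hB⟩ := C.exists_abs_flow_le
  have hm : ∀ n, Measurable (C.gridCount j a b n) := fun n =>
    (C.measurable_gridCount hab le_rfl j n).mono (C.filtration.le b) le_rfl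
  have hstep : ∀ s t, s ≤ t → ∫⁻ ω, C.transition j s t ω ∂P
      ≤ ENNReal.ofReal (B * (t - s)) := by
    intro s t hst
    rw [← setLIntegral_univ, C.setLIntegral_transition j Set.univ,
      ← ENNReal.ofReal_toReal (measure_ne_top P _), ← measureReal_def,
      C.measureReal_transition j hst MeasurableSet.univ]
    refine ENNReal.ofReal_le_ofReal ((Real.le_norm_self _).trans ?_)
    refine (norm_setIntegral_le_of_norm_le_const (measure_lt_top P _) fun ω _ =>
      norm_setIntegral_Ioc_le (fun r => hB j r ω) hst).trans ?_
    refine mul_le_of_le_one_right ?_ measureReal_le_one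
    exact mul_nonneg hB0 (sub_nonneg.2 (NNReal.coe_le_coe.2 hst))
  have hbound : ∀ n, ∫⁻ ω, C.gridCount j a b n ω ∂P ≤ ENNReal.ofReal (B * (b - a)) := by
    intro n
    have hmt : ∀ s t, Measurable (C.transition j s t) := fun s t =>
      (C.measurable_transition (le_max_left s t) (le_max_right s t) j).mono (C.filtration.le _) le_rfl
    unfold gridCount
    rw [lintegral_finsetSum _ fun k _ => hmt _ _]
    refine (Finset.sum_le_sum fun k _ => hstep _ _ (gridPoint_mono a b n k.le_succ)).trans ?_
    rw [← ENNReal.ofReal_sum_of_nonneg]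
    · refine ENNReal.ofReal_le_ofReal (le_of_eq ?_)
      rw [← Finset.mul_sum, Finset.sum_range_sub fun k => (gridPoint a b n k : ℝ),
        gridPoint_last hab, gridPoint_zero]
    · exact fun k _ => mul_nonneg hB0
        (sub_nonneg.2 (NNReal.coe_le_coe.2 (gridPoint_mono a b n k.le_succ)))
  refine ne_top_of_le_ne_top (ENNReal.ofReal_ne_top (r := B * (b - a))) ?_
  calc ∫⁻ ω, C.entryMeasure j ω (Set.Ioc a b) ∂P
      = ∫⁻ ω, liminf (fun n => C.gridCount j a b n ω) atTop ∂P :=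
        lintegral_congr fun ω => (C.tendsto_gridCount j hab ω).liminf_eq.symm
    _ ≤ liminf (fun n => ∫⁻ ω, C.gridCount j a b n ω ∂P) atTop := lintegral_liminf_le hm
    _ ≤ liminf (fun _ : ℕ => ENNReal.ofReal (B * (b - a))) atTop :=
        liminf_le_liminf (Eventually.of_forall hbound)
    _ = _ := by simp

/-- The total number of jumps in `(a, b]`. -/
noncomputable def jumpCount (a b : ℝ≥0) (ω : Ω) : ℝ := ∑ i, (C.entryMeasure i ω).real (Set.Ioc a b)

lemma one_le_jumpCount {a b s : ℝ≥0} {ω : Ω} (hs : s ∈ C.jumps ω) (hsI : s ∈ Set.Ioc a b) :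
    1 ≤ C.jumpCount a b ω := by
  obtain ⟨i, hi⟩ := C.exists_entry_of_mem_jumps hs
  have h1 : 1 ≤ (C.entryMeasure i ω).real (Set.Ioc a b) := by
    rw [measureReal_def, entryMeasure_Ioc, ENNReal.toReal_natCast, Nat.one_le_cast,
      Nat.one_le_iff_ne_zero, Finset.card_ne_zero]
    exact ⟨s, by simpa using ⟨hi, hsI⟩⟩
  exact h1.trans (Finset.single_le_sum (f := fun i => (C.entryMeasure i ω).real (Set.Ioc a b))
    (fun _ _ => measureReal_nonneg) (Finset.mem_univ i))

lemma integrable_jumpCount [IsProbabilityMeasure P] {a b : ℝ≥0} (hab : a ≤ b) : Integrable (C.jumpCount a b) P := by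
  refine integrable_finsetSum _ fun i _ => integrable_toReal_of_lintegral_ne_top ?_
    (C.lintegral_entryMeasure_ne_top i hab)
  exact ((C.measurable_entryMeasure_Ioc hab le_rfl i).mono (C.filtration.le b) le_rfl).aemeasurable

/-- If there is no jump in (s, t], the left limits are frozen at X_s and both integrals agree.
Otherwise they differ by at most B(t - s), and the number of jumps is at least 1. -/
lemma abs_sub_intensity_le {B : ℝ} (hB0 : 0 ≤ B) (hB : ∀ j s ω, |C.flow j s ω| ≤ B) (j : Fin N)
    {s t : ℝ≥0} (hst : s ≤ t) (ω : Ω) :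
    |Set.indicator {ω | C.X s ω j = 0} (fun ω => ∫ r in Set.Ioc s t, C.flow j r ω ∂lebesgue) ω
      - ∫ r in Set.Ioc s t, C.intensity j r ω ∂lebesgue| ≤ B * (t - s) * C.jumpCount s t ω := by
  have hts : (0 : ℝ) ≤ (t : ℝ) - s := sub_nonneg.2 (NNReal.coe_le_coe.2 hst)
  have hcount : 0 ≤ C.jumpCount s t ω := Finset.sum_nonneg fun _ _ => measureReal_nonneg
  by_cases hj : ∃ r ∈ Set.Ioc s t, r ∈ C.jumps ω
  · obtain ⟨r, hr, hrj⟩ := hj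
    refine le_trans ?_ (le_mul_of_one_le_right (mul_nonneg hB0 hts) (C.one_le_jumpCount hrj hr))
    rw [Set.indicator_apply]
    split_ifs with h
    · rw [← integral_sub (C.integrableOn_flow j ω _ _) (C.integrableOn_intensity j ω _ _)]
      refine norm_setIntegral_Ioc_le (fun r => ?_) hst
      refine le_trans ?_ (hB j r ω)
      rw [intensity]
      rcases C.left_apply_eq r ω j with h | h <;> simp [h]
    · rw [zero_sub, abs_neg]
      exact norm_setIntegral_Ioc_le (fun r => (C.abs_intensity_le j r ω).trans (hB j r ω)) hst
  · push Not at hj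
    refine le_trans (le_of_eq ?_) (mul_nonneg (mul_nonneg hB0 hts) hcount)
    rw [abs_eq_zero, sub_eq_zero]
    have hleft : ∀ r ∈ Set.Ioc s t, C.left r ω = C.X s ω := fun r hr =>
      C.left_eq_of_no_jumps hr.1 fun u hu => hj u ⟨hu.1, hu.2.le.trans hr.2⟩
    rw [Set.indicator_apply]
    split_ifs with h
    · refine setIntegral_congr_fun measurableSet_Ioc fun r hr => ?_
      have h' : C.X s ω j = 0 := h
      simp [intensity, hleft r hr, h']
    · have h' : C.X s ω j = 1 := (C.X_apply_eq s ω j).resolve_left h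
      rw [setIntegral_eq_zero_of_forall_eq_zero]
      intro r hr
      simp [intensity, hleft r hr, h']

lemma abs_measureReal_transition_sub_le [IsProbabilityMeasure P] {B : ℝ} (hB0 : 0 ≤ B) (hB : ∀ j s ω, |C.flow j s ω| ≤ B)
    (j : Fin N) {s t : ℝ≥0} (hst : s ≤ t) {S : Set Ω} (hS : MeasurableSet[C.filtration s] S) :
    |P.real (S ∩ {ω | C.X s ω j = 0} ∩ {ω | C.X t ω j = 1})
      - ∫ ω in S, ∫ r in Set.Ioc s t, C.intensity j r ω ∂lebesgue ∂P|
      ≤ B * (t - s) * ∫ ω, C.jumpCount s t ω ∂P := by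
  have hm : MeasurableSet {ω | C.X s ω j = 0} :=
    ((measurable_pi_apply j).comp (C.measurable s)) (measurableSet_singleton (0 : ℝ))
  have hi1 : Integrable (fun ω => ∫ r in Set.Ioc s t, C.flow j r ω ∂lebesgue) P :=
    integrable_setIntegral_of_bounded (C.measurable_flow j) (hB j) hst
  have hi2 : Integrable (fun ω => ∫ r in Set.Ioc s t, C.intensity j r ω ∂lebesgue) P :=
    integrable_setIntegral_of_bounded (C.measurable_intensity j)
      (fun r ω => (C.abs_intensity_le j r ω).trans (hB j r ω)) hst
  have hts : (0 : ℝ) ≤ (t : ℝ) - s := sub_nonneg.2 (NNReal.coe_le_coe.2 hst)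
  have hcount : ∀ ω, 0 ≤ B * (t - s) * C.jumpCount s t ω := fun ω =>
    mul_nonneg (mul_nonneg hB0 hts) (Finset.sum_nonneg fun _ _ => measureReal_nonneg)
  rw [C.measureReal_transition j hst hS, ← setIntegral_indicator hm,
    ← integral_sub (hi1.indicator hm).integrableOn hi2.integrableOn, ← integral_const_mul]
  rw [← Real.norm_eq_abs]
  refine (norm_integral_le_integral_norm _).trans ?_
  refine (integral_mono (μ := P.restrict S) (((hi1.indicator hm).sub hi2).norm.integrableOn)
    ((C.integrable_jumpCount hst).const_mul _).integrableOn
    fun ω => C.abs_sub_intensity_le hB0 hB j hst ω).trans ?_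
  exact setIntegral_le_integral ((C.integrable_jumpCount hst).const_mul _)
    (Eventually.of_forall hcount)

lemma jumpCount_eq_sum {a b : ℝ≥0} (hab : a ≤ b) (n : ℕ) (ω : Ω) : C.jumpCount a b ω
    = ∑ k ∈ Finset.range (n + 1), C.jumpCount (gridPoint a b n k) (gridPoint a b n (k + 1)) ω := by
  unfold jumpCount
  rw [Finset.sum_comm]
  refine Finset.sum_congr rfl fun i _ => ?_
  rw [measureReal_def, measure_Ioc_eq_sum _ hab n, ENNReal.toReal_sum]
  · rfl
  · intro k _
    rw [entryMeasure_Ioc]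
    exact ENNReal.natCast_ne_top _

lemma setIntegral_intensity_eq_sum (j : Fin N) {a b : ℝ≥0} (hab : a ≤ b) (n : ℕ) (ω : Ω) :
    ∫ r in Set.Ioc a b, C.intensity j r ω ∂lebesgue = ∑ k ∈ Finset.range (n + 1),
      ∫ r in Set.Ioc (gridPoint a b n k) (gridPoint a b n (k + 1)), C.intensity j r ω ∂lebesgue := by
  have h : ∀ l, ∫ r in Set.Ioc a (gridPoint a b n l), C.intensity j r ω ∂lebesgue
      = ∑ k ∈ Finset.range l,
        ∫ r in Set.Ioc (gridPoint a b n k) (gridPoint a b n (k + 1)), C.intensity j r ω ∂lebesgue := by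
    intro l
    induction l with
    | zero => simp [gridPoint_zero]
    | succ l ih =>
      rw [Finset.sum_range_succ, ← ih, ← setIntegral_union (Set.Ioc_disjoint_Ioc_of_le le_rfl)
        measurableSet_Ioc (C.integrableOn_intensity j ω _ _) (C.integrableOn_intensity j ω _ _),
        Set.Ioc_union_Ioc_eq_Ioc (le_gridPoint a b n l) (gridPoint_mono a b n l.le_succ)]
  rw [← h, gridPoint_last hab]

/-- On a cell of a grid, the transition probability and the expected integral of the intensity
differ by at most B · (mesh) · E[jumps in the cell]. Jumps are additive over the cells, so the total
error is B · (mesh) · E[jumps in (a, b]], which tends to 0. -/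
lemma setLIntegral_entryMeasure_eq [IsProbabilityMeasure P] (j : Fin N) {a b : ℝ≥0} (hab : a ≤ b) {S : Set Ω}
    (hS : MeasurableSet[C.filtration a] S) :
    ∫⁻ ω in S, C.entryMeasure j ω (Set.Ioc a b) ∂P
      = ∫⁻ ω in S, ∫⁻ r in Set.Ioc a b, ENNReal.ofReal (C.intensity j r ω) ∂lebesgue ∂P := by
  obtain ⟨B, hB0, hB⟩ := C.exists_abs_flow_le
  have hm : ∀ n, Measurable (C.gridCount j a b n) := fun n =>
    (C.measurable_gridCount hab le_rfl j n).mono (C.filtration.le b) le_rfl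
  have hmt : ∀ s t, Measurable (C.transition j s t) := fun s t =>
    (C.measurable_transition (le_max_left s t) (le_max_right s t) j).mono (C.filtration.le _) le_rfl
  have hi : ∀ s t, s ≤ t → Integrable (fun ω => ∫ r in Set.Ioc s t, C.intensity j r ω ∂lebesgue) P :=
    fun s t hst => integrable_setIntegral_of_bounded (C.measurable_intensity j)
      (fun r ω => (C.abs_intensity_le j r ω).trans (hB j r ω)) hst
  have hlim : Tendsto (fun n => ∫⁻ ω in S, C.gridCount j a b n ω ∂P) atTop
      (𝓝 (∫⁻ ω in S, C.entryMeasure j ω (Set.Ioc a b) ∂P)) := by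
    refine tendsto_lintegral_of_dominated_convergence
      (fun ω => C.entryMeasure j ω (Set.Ioc a b)) hm
      (fun n => Eventually.of_forall fun ω => C.gridCount_le j hab n ω) ?_
      (Eventually.of_forall fun ω => C.tendsto_gridCount j hab ω)
    exact ne_top_of_le_ne_top (C.lintegral_entryMeasure_ne_top j hab) (setLIntegral_le_lintegral _ _)
  have hfin : ∫⁻ ω in S, C.entryMeasure j ω (Set.Ioc a b) ∂P ≠ ∞ :=
    ne_top_of_le_ne_top (C.lintegral_entryMeasure_ne_top j hab) (setLIntegral_le_lintegral _ _)
  have hlim' := (ENNReal.tendsto_toReal hfin).comp hlim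
  have hgc : ∀ n, (∫⁻ ω in S, C.gridCount j a b n ω ∂P).toReal
      = ∑ k ∈ Finset.range (n + 1), P.real (S ∩ {ω | C.X (gridPoint a b n k) ω j = 0}
        ∩ {ω | C.X (gridPoint a b n (k + 1)) ω j = 1}) := by
    intro n
    unfold gridCount
    rw [lintegral_finsetSum _ fun k _ => hmt _ _, ENNReal.toReal_sum]
    · refine Finset.sum_congr rfl fun k _ => ?_
      rw [C.setLIntegral_transition j S, measureReal_def]
    · intro k _
      rw [C.setLIntegral_transition j S]
      finiteness
  have herr : ∀ n, |(∫⁻ ω in S, C.gridCount j a b n ω ∂P).toReal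
      - ∫ ω in S, ∫ r in Set.Ioc a b, C.intensity j r ω ∂lebesgue ∂P|
      ≤ (B * (b - a : ℝ≥0) * ∫ ω, C.jumpCount a b ω ∂P) * (1 / ((n : ℝ) + 1)) := by
    intro n
    have hmono := gridPoint_mono a b n
    have e1 : ∫ ω in S, ∫ r in Set.Ioc a b, C.intensity j r ω ∂lebesgue ∂P
        = ∑ k ∈ Finset.range (n + 1), ∫ ω in S, ∫ r in Set.Ioc (gridPoint a b n k)
          (gridPoint a b n (k + 1)), C.intensity j r ω ∂lebesgue ∂P := by
      rw [← integral_finsetSum _ fun k _ => (hi _ _ (hmono k.le_succ)).integrableOn]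
      exact integral_congr_ae (Eventually.of_forall fun ω =>
        C.setIntegral_intensity_eq_sum j hab n ω)
    have e2 : ∫ ω, C.jumpCount a b ω ∂P = ∑ k ∈ Finset.range (n + 1),
        ∫ ω, C.jumpCount (gridPoint a b n k) (gridPoint a b n (k + 1)) ω ∂P := by
      rw [← integral_finsetSum _ fun k _ => C.integrable_jumpCount (hmono k.le_succ)]
      exact integral_congr_ae (Eventually.of_forall fun ω => C.jumpCount_eq_sum hab n ω)
    rw [hgc, e1, e2, ← Finset.sum_sub_distrib, Finset.mul_sum, Finset.sum_mul]
    refine (Finset.abs_sum_le_sum_abs _ _).trans (Finset.sum_le_sum fun k _ => ?_)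
    have hS' : MeasurableSet[C.filtration (gridPoint a b n k)] S :=
      C.filtration.mono (le_gridPoint a b n k) _ hS
    refine (C.abs_measureReal_transition_sub_le hB0 hB j (hmono k.le_succ) hS').trans
      (le_of_eq ?_)
    rw [Nat.succ_eq_add_one, gridPoint_succ_sub]
    ring
  have hconv : Tendsto (fun n => (∫⁻ ω in S, C.gridCount j a b n ω ∂P).toReal) atTop
      (𝓝 (∫ ω in S, ∫ r in Set.Ioc a b, C.intensity j r ω ∂lebesgue ∂P)) := by
    rw [tendsto_iff_norm_sub_tendsto_zero]
    refine squeeze_zero (fun _ => norm_nonneg _) herr ?_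
    have := (tendsto_one_div_add_atTop_nhds_zero_nat (𝕜 := ℝ)).const_mul
      (B * (b - a : ℝ≥0) * ∫ ω, C.jumpCount a b ω ∂P)
    rwa [mul_zero] at this
  have heq := tendsto_nhds_unique hlim' hconv
  rw [← ENNReal.ofReal_toReal hfin, heq, ofReal_integral_eq_lintegral_ofReal
    (hi a b hab).integrableOn (Eventually.of_forall fun ω =>
      integral_nonneg fun r => C.intensity_nonneg j r ω)]
  refine lintegral_congr fun ω => ?_
  exact ofReal_integral_eq_lintegral_ofReal (C.integrableOn_intensity j ω a b)
    (Eventually.of_forall fun r => C.intensity_nonneg j r ω)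

end MarkovChain

/-! ### The compensation formula for predictable integrands. -/

lemma isPiSystem_predictable {Ω : Type*} {mΩ : MeasurableSpace Ω} (𝓕 : Filtration ℝ≥0 mΩ) :
    IsPiSystem ({s : Set (ℝ≥0 × Ω) | ∃ A, MeasurableSet[𝓕 ⊥] A ∧ s = {⊥} ×ˢ A} ∪
      {s | ∃ i A, MeasurableSet[𝓕 i] A ∧ s = Set.Ioi i ×ˢ A}) := by
  rintro _ (⟨A, hA, rfl⟩ | ⟨i, A, hA, rfl⟩) _ (⟨B, hB, rfl⟩ | ⟨k, B, hB, rfl⟩) hne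
  · exact Or.inl ⟨A ∩ B, hA.inter hB, by rw [Set.prod_inter_prod, Set.inter_self]⟩
  · obtain ⟨⟨t, ω⟩, ⟨h1, -⟩, ⟨h2, -⟩⟩ := hne
    simp only [Set.mem_singleton_iff] at h1
    simp only [h1] at h2
    exact absurd (Set.mem_Ioi.1 h2) not_lt_bot
  · obtain ⟨⟨t, ω⟩, ⟨h2, -⟩, ⟨h1, -⟩⟩ := hne
    simp only [Set.mem_singleton_iff] at h1
    simp only [h1] at h2
    exact absurd (Set.mem_Ioi.1 h2) not_lt_bot
  · refine Or.inr ⟨i ⊔ k, A ∩ B, (𝓕.mono le_sup_left _ hA).inter (𝓕.mono le_sup_right _ hB), ?_⟩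
    rw [Set.prod_inter_prod, Set.Ioi_inter_Ioi]

namespace MarkovChain

open ProbabilityTheory

variable {Ω : Type*} [mΩ : MeasurableSpace Ω] {P : Measure Ω} {N : ℕ} (C : MarkovChain P N)

/-- The kernel of the entries into `j` up to time `T`. -/
noncomputable def entryKernel (j : Fin N) (T : ℝ≥0) : Kernel Ω ℝ≥0 :=
  ⟨fun ω => (C.entryMeasure j ω).restrict (Set.Ioc 0 T),
    (C.measurable_entryMeasure le_rfl j).mono (C.filtration.le T) le_rfl⟩

instance (j : Fin N) (T : ℝ≥0) : IsSFiniteKernel (C.entryKernel j T) :=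
  isSFiniteKernel_of_isFiniteMeasure _ fun ω =>
    inferInstanceAs (IsFiniteMeasure ((C.entryMeasure j ω).restrict (Set.Ioc 0 T)))

/-- The compensation formula: the jumps into `j` have the intensity `C.intensity j`. -/
theorem lintegral_entryMeasure [IsProbabilityMeasure P] (j : Fin N) (T : ℝ≥0)
    {H : ℝ≥0 × Ω → ℝ≥0∞} (hH : Measurable[C.filtration.predictable] H) :
    ∫⁻ ω, ∫⁻ s in Set.Ioc 0 T, H (s, ω) ∂(C.entryMeasure j ω) ∂P
      = ∫⁻ ω, ∫⁻ s in Set.Ioc 0 T, ENNReal.ofReal (C.intensity j s ω) * H (s, ω) ∂lebesgue ∂P := by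
  have hle : C.filtration.predictable ≤ (inferInstance : MeasurableSpace (ℝ≥0 × Ω)) :=
    predictable_le_prod
  have hdm : Measurable fun p : ℝ≥0 × Ω => ENNReal.ofReal (C.intensity j p.1 p.2) :=
    (C.measurable_intensity j).ennreal_ofReal
  -- Both sides of the formula are made into measures on the predictable σ-algebra itself, since
  -- agreement is to be shown only there.
  let μ₁ : @Measure (ℝ≥0 × Ω) C.filtration.predictable :=
    ((P ⊗ₘ C.entryKernel j T).map Prod.swap).trim hle
  let μ₂ : @Measure (ℝ≥0 × Ω) C.filtration.predictable :=
    (((lebesgue.restrict (Set.Ioc 0 T)).prod P).withDensity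
      fun p => ENNReal.ofReal (C.intensity j p.1 p.2)).trim hle
  have h₁ : ∀ {G : ℝ≥0 × Ω → ℝ≥0∞}, Measurable[C.filtration.predictable] G →
      ∫⁻ p, G p ∂μ₁ = ∫⁻ ω, ∫⁻ s in Set.Ioc 0 T, G (s, ω) ∂(C.entryMeasure j ω) ∂P := by
    intro G hG
    have hG' : Measurable G := hG.mono hle le_rfl
    rw [lintegral_trim hle hG, lintegral_map hG' measurable_swap,
      Measure.lintegral_compProd (f := fun p => G p.swap) (hG'.comp measurable_swap)]
    rfl
  have h₂ : ∀ {G : ℝ≥0 × Ω → ℝ≥0∞}, Measurable[C.filtration.predictable] G →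
      ∫⁻ p, G p ∂μ₂ = ∫⁻ ω, ∫⁻ s in Set.Ioc 0 T,
        ENNReal.ofReal (C.intensity j s ω) * G (s, ω) ∂lebesgue ∂P := by
    intro G hG
    have hG' : Measurable G := hG.mono hle le_rfl
    rw [lintegral_trim hle hG, lintegral_withDensity_eq_lintegral_mul _ hdm hG',
      lintegral_prod_symm' _ (hdm.mul hG')]
    rfl
  have hone₁ : ∀ {S : Set (ℝ≥0 × Ω)}, MeasurableSet[C.filtration.predictable] S → μ₁ S
      = ∫⁻ ω, ∫⁻ s in Set.Ioc 0 T, S.indicator 1 (s, ω) ∂(C.entryMeasure j ω) ∂P := fun hS =>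
    (@lintegral_indicator_one _ C.filtration.predictable μ₁ _ hS).symm.trans
      (h₁ (Measurable.indicator measurable_const hS))
  have hone₂ : ∀ {S : Set (ℝ≥0 × Ω)}, MeasurableSet[C.filtration.predictable] S → μ₂ S
      = ∫⁻ ω, ∫⁻ s in Set.Ioc 0 T,
        ENNReal.ofReal (C.intensity j s ω) * S.indicator 1 (s, ω) ∂lebesgue ∂P := fun hS =>
    (@lintegral_indicator_one _ C.filtration.predictable μ₂ _ hS).symm.trans
      (h₂ (Measurable.indicator measurable_const hS))
  have hrect : ∀ (i : ℝ≥0) (A : Set Ω), MeasurableSet[C.filtration i] A →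
      μ₁ (Set.Ioi i ×ˢ A) = μ₂ (Set.Ioi i ×ˢ A) := by
    intro i A hA
    have hms : MeasurableSet[C.filtration.predictable] (Set.Ioi i ×ˢ A) :=
      measurableSet_predictable_Ioi_prod hA
    have hAm : MeasurableSet A := C.filtration.le i _ hA
    rw [hone₁ hms, hone₂ hms]
    rcases le_total i T with hiT | hTi
    · have hinter : Set.Ioi i ∩ Set.Ioc 0 T = Set.Ioc i T := by
        ext s; simp only [Set.mem_inter_iff, Set.mem_Ioi, Set.mem_Ioc]
        exact ⟨fun h => ⟨h.1, h.2.2⟩, fun h => ⟨h.1, zero_le.trans_lt h.1, h.2⟩⟩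
      have e := C.setLIntegral_entryMeasure_eq j hiT hA
      rw [← lintegral_indicator hAm, ← lintegral_indicator hAm] at e
      convert e using 1
      · refine lintegral_congr fun ω => ?_
        by_cases hω : ω ∈ A
        · have : ∀ s, (Set.Ioi i ×ˢ A).indicator (1 : ℝ≥0 × Ω → ℝ≥0∞) (s, ω)
              = (Set.Ioi i).indicator 1 s := fun s => by
            by_cases hs : i < s <;> simp [hω, hs]
          simp_rw [this]
          rw [lintegral_indicator_one measurableSet_Ioi, Measure.restrict_apply measurableSet_Ioi,
            hinter, Set.indicator_of_mem hω]
        · simp [hω]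
      · refine lintegral_congr fun ω => ?_
        by_cases hω : ω ∈ A
        · have : ∀ s, ENNReal.ofReal (C.intensity j s ω)
                * (Set.Ioi i ×ˢ A).indicator (1 : ℝ≥0 × Ω → ℝ≥0∞) (s, ω)
              = (Set.Ioi i).indicator (fun s => ENNReal.ofReal (C.intensity j s ω)) s := fun s => by
            by_cases hs : i < s <;> simp [hω, hs]
          simp_rw [this]
          rw [lintegral_indicator measurableSet_Ioi, Measure.restrict_restrict measurableSet_Ioi,
            hinter, Set.indicator_of_mem hω]
        · simp [hω]
    · have hz : ∀ ω, ∀ s ∈ Set.Ioc 0 T,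
          (Set.Ioi i ×ˢ A).indicator (1 : ℝ≥0 × Ω → ℝ≥0∞) (s, ω) = 0 := fun ω s hs =>
        Set.indicator_of_notMem (fun h => absurd (hs.2.trans hTi) (not_le.2 h.1)) _
      have e1 : ∀ ω, ∫⁻ s in Set.Ioc 0 T, (Set.Ioi i ×ˢ A).indicator (1 : ℝ≥0 × Ω → ℝ≥0∞) (s, ω)
          ∂(C.entryMeasure j ω) = 0 := fun ω => by
        rw [setLIntegral_congr_fun measurableSet_Ioc (hz ω), lintegral_zero]
      have e2 : ∀ ω, ∫⁻ s in Set.Ioc 0 T, ENNReal.ofReal (C.intensity j s ω)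
          * (Set.Ioi i ×ˢ A).indicator (1 : ℝ≥0 × Ω → ℝ≥0∞) (s, ω) ∂lebesgue = 0 := fun ω => by
        rw [setLIntegral_congr_fun measurableSet_Ioc (g := fun _ => 0)
          (fun s hs => by simp only [hz ω s hs, mul_zero]), lintegral_zero]
      simp_rw [e1, e2]
  have hbot : ∀ A : Set Ω, MeasurableSet[C.filtration ⊥] A →
      μ₁ ({⊥} ×ˢ A) = 0 ∧ μ₂ ({⊥} ×ˢ A) = 0 := by
    intro A hA
    have hms : MeasurableSet[C.filtration.predictable] (({⊥} : Set ℝ≥0) ×ˢ A) :=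
      measurableSet_predictable_singleton_bot_prod hA
    have hz : ∀ ω, ∀ s ∈ Set.Ioc 0 T,
        (({⊥} : Set ℝ≥0) ×ˢ A).indicator (1 : ℝ≥0 × Ω → ℝ≥0∞) (s, ω) = 0 := fun ω s hs =>
      Set.indicator_of_notMem (fun h => hs.1.ne' h.1) _
    rw [hone₁ hms, hone₂ hms]
    constructor
    · have e1 : ∀ ω, ∫⁻ s in Set.Ioc 0 T,
          (({⊥} : Set ℝ≥0) ×ˢ A).indicator (1 : ℝ≥0 × Ω → ℝ≥0∞) (s, ω)
          ∂(C.entryMeasure j ω) = 0 := fun ω => by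
        rw [setLIntegral_congr_fun measurableSet_Ioc (hz ω), lintegral_zero]
      simp_rw [e1, lintegral_zero]
    · have e2 : ∀ ω, ∫⁻ s in Set.Ioc 0 T, ENNReal.ofReal (C.intensity j s ω)
          * (({⊥} : Set ℝ≥0) ×ˢ A).indicator (1 : ℝ≥0 × Ω → ℝ≥0∞) (s, ω) ∂lebesgue = 0 := fun ω => by
        rw [setLIntegral_congr_fun measurableSet_Ioc (g := fun _ => 0)
          (fun s hs => by simp only [hz ω s hs, mul_zero]), lintegral_zero]
      simp_rw [e2, lintegral_zero]
  have huniv : (Set.univ : Set (ℝ≥0 × Ω)) = ({⊥} ×ˢ Set.univ) ∪ (Set.Ioi ⊥ ×ˢ Set.univ) := by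
    rw [← Set.union_prod]
    ext ⟨s, ω⟩
    simp
  have hdisj : Disjoint (({⊥} : Set ℝ≥0) ×ˢ (Set.univ : Set Ω)) (Set.Ioi ⊥ ×ˢ Set.univ) :=
    Set.disjoint_left.2 fun p h1 h2 => by
      have h1' : p.1 = ⊥ := h1.1
      have h2' : ⊥ < p.1 := h2.1
      exact h2'.ne' h1'
  have hmuniv : MeasurableSet[C.filtration.predictable]
      (Set.Ioi (⊥ : ℝ≥0) ×ˢ (Set.univ : Set Ω)) :=
    measurableSet_predictable_Ioi_prod MeasurableSet.univ
  have huniv_eq : μ₁ Set.univ = μ₂ Set.univ := by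
    rw [huniv, measure_union hdisj hmuniv, measure_union hdisj hmuniv,
      (hbot _ MeasurableSet.univ).1, (hbot _ MeasurableSet.univ).2, hrect _ _ MeasurableSet.univ]
  have : IsFiniteMeasure μ₁ := ⟨by
    have e := h₁ (G := fun _ => 1) measurable_const
    rw [lintegral_one] at e
    rw [e]
    simp_rw [setLIntegral_one]
    exact (C.lintegral_entryMeasure_ne_top j zero_le).lt_top⟩
  -- The rectangles form a generating π-system. The ones over (i, ∞) were treated by the grid
  -- argument; the ones over the time 0 are null for both measures because the integrals run over
  -- (0, T].
  have hμ : μ₁ = μ₂ := by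
    refine ext_of_generate_finite _ rfl (isPiSystem_predictable C.filtration) ?_ huniv_eq
    rintro _ (⟨A, hA, rfl⟩ | ⟨i, A, hA, rfl⟩)
    · rw [(hbot A hA).1, (hbot A hA).2]
    · exact hrect i A hA
  rw [← h₁ hH, ← h₂ hH, hμ]

/-- The chain does not jump at a fixed time. -/
lemma ae_notMem_jumps_of_time [IsProbabilityMeasure P] (t : ℝ≥0) :
    ∀ᵐ ω ∂P, C.X t ω = C.left t ω := by
  have key : ∀ j, ∀ᵐ ω ∂P, t ∉ C.entries j ω := by
    intro j
    -- The indicator of the single time t is predictable and Lebesgue null, so the compensation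
    -- formula leaves no entry at t.
    have hm : Measurable[C.filtration.predictable] fun p : ℝ≥0 × Ω =>
        ({t} : Set ℝ≥0).indicator (1 : ℝ≥0 → ℝ≥0∞) p.1 :=
      (measurable_one.indicator (measurableSet_singleton t)).comp measurable_fst_predictable
    have h := C.lintegral_entryMeasure j t hm
    have h0 : ∀ ω, ∫⁻ s in Set.Ioc 0 t, ENNReal.ofReal (C.intensity j s ω)
        * ({t} : Set ℝ≥0).indicator (1 : ℝ≥0 → ℝ≥0∞) s ∂lebesgue = 0 := fun ω => by
      refine lintegral_eq_zero_of_ae_eq_zero (ae_restrict_of_ae ?_)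
      filter_upwards [measure_eq_zero_iff_ae_notMem.1 (measure_singleton (μ := lebesgue) t)]
        with s hs
      simp [Set.indicator_of_notMem hs]
    simp_rw [h0, lintegral_zero] at h
    rw [lintegral_eq_zero_iff ((measurable_setLIntegral_of_predictable (𝓕 := C.filtration)
      (C.measurable_entryMeasure le_rfl j) (fun ω => inferInstance) hm).mono
      (C.filtration.le t) le_rfl)] at h
    filter_upwards [h] with ω hω hmem
    rw [C.setLIntegral_entryMeasure, Pi.zero_apply, Finset.sum_eq_zero_iff] at hω
    have htpos := C.pos_of_mem_jumps (C.entries_subset_jumps j ω hmem)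
    have := hω t (by simpa using ⟨hmem, htpos⟩)
    simp at this
  filter_upwards [ae_all_iff.2 key] with ω hω
  by_contra hne
  obtain ⟨j, hj⟩ := C.exists_entry_of_mem_jumps hne
  exact hω j hj

end MarkovChain

/-! ### The seminorm in terms of intensities, and the smallness condition. -/

lemma abs_dotProduct_mulVec_le {N : ℕ} (B : Matrix (Fin N) (Fin N) ℝ) (u v : Fin N → ℝ) :
    |u ⬝ᵥ (B *ᵥ v)| ≤ matrixNorm B * (√(u ⬝ᵥ u) * √(v ⬝ᵥ v)) := by
  have h1 : u ⬝ᵥ (B *ᵥ v) = inner ℝ (WithLp.toLp 2 u)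
      (Matrix.toEuclideanCLM (n := Fin N) (𝕜 := ℝ) B (WithLp.toLp 2 v)) := by
    rw [Matrix.toEuclideanCLM_toLp, EuclideanSpace.inner_toLp_toLp]
    simp [dotProduct_comm]
  have h2 : ∀ w : Fin N → ℝ, ‖(WithLp.toLp 2 w : EuclideanSpace ℝ (Fin N))‖ = √(w ⬝ᵥ w) := by
    intro w
    rw [EuclideanSpace.norm_eq]
    simp [dotProduct, sq]
  rw [h1]
  refine (abs_real_inner_le_norm _ _).trans ?_
  rw [← h2, ← h2, matrixNorm]
  calc _ ≤ ‖(WithLp.toLp 2 u : EuclideanSpace ℝ (Fin N))‖ *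
        (‖Matrix.toEuclideanCLM (n := Fin N) (𝕜 := ℝ) B‖
          * ‖(WithLp.toLp 2 v : EuclideanSpace ℝ (Fin N))‖) := by
        gcongr
        exact ContinuousLinearMap.le_opNorm _ _
    _ = _ := by ring

lemma abs_apply_le_matrixNorm {N : ℕ} (B : Matrix (Fin N) (Fin N) ℝ) (i j : Fin N) :
    |B i j| ≤ matrixNorm B := by
  have := abs_dotProduct_mulVec_le B (Pi.single i 1) (Pi.single j 1)
  simpa using this

namespace MarkovChain

variable {Ω : Type*} [mΩ : MeasurableSpace Ω] {P : Measure Ω} {N : ℕ} (C : MarkovChain P N)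

/-- The increment of `z' X` if the chain jumps from its present state to `j`. -/
noncomputable def increment (j : Fin N) (s : ℝ≥0) (ω : Ω) (z : Fin N → ℝ) : ℝ := z j - z ⬝ᵥ C.left s ω

lemma increment_eq {s : ℝ≥0} {ω : Ω} {i : Fin N} (hi : C.left s ω = Pi.single i 1) (j : Fin N)
    (z : Fin N → ℝ) : C.increment j s ω z = z j - z i := by
  simp [increment, hi]

lemma increment_sub (j : Fin N) (s : ℝ≥0) (ω : Ω) (z w : Fin N → ℝ) :
    C.increment j s ω (z - w) = C.increment j s ω z - C.increment j s ω w := by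
  simp only [increment, sub_dotProduct, Pi.sub_apply]
  ring

lemma increment_neg (j : Fin N) (s : ℝ≥0) (ω : Ω) (z : Fin N → ℝ) :
    C.increment j s ω (-z) = -C.increment j s ω z := by
  simp only [increment, neg_dotProduct, Pi.neg_apply]
  ring

lemma Psi_mulVec_apply {s : ℝ≥0} {ω : Ω} {i : Fin N} (hi : C.left s ω = Pi.single i 1)
    (z : Fin N → ℝ) (k : Fin N) : (C.Psi s ω *ᵥ z) k
      = C.A s k i * (z k - z i) - if k = i then ∑ l, C.A s l i * z l else 0 := by
  rw [Psi, Matrix.sub_mulVec, Matrix.sub_mulVec, ← Matrix.mulVec_mulVec, ← Matrix.mulVec_mulVec]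
  simp only [Pi.sub_apply, Matrix.mulVec_diagonal]
  rw [hi, Matrix.mulVec_single_one]
  have h1 : (Matrix.diagonal (Pi.single i (1 : ℝ)) *ᵥ z) = Pi.single i (z i) := by
    ext l
    rw [Matrix.mulVec_diagonal]
    by_cases h : l = i
    · subst h; simp
    · simp [h]
  rw [h1]
  have h2 : (C.A s *ᵥ Pi.single i (z i)) k = C.A s k i * z i := by
    simp [Matrix.mulVec_single]
  rw [h2]
  by_cases h : k = i
  · subst h
    simp [Matrix.mulVec, dotProduct, Matrix.col]
  · simp [h, Matrix.col]
    ring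

/-- In the state i the form is ∑ A_ki z_k (z_k - z_i) - z_i ∑ A_ki z_k; adding z_i² ∑ A_ki, which
vanishes, completes the squares. The seminorm is thus the intensity-weighted mean square of the
possible jumps. -/
lemma seminormSq_eq (s : ℝ≥0) (ω : Ω) (z : Fin N → ℝ) :
    C.seminormSq s ω z = ∑ j, C.intensity j s ω * C.increment j s ω z ^ 2 := by
  obtain ⟨i, hi⟩ := C.left_unit_vector s ω
  have h0 := C.rate.sum_eq_zero s i
  have e1 : C.seminormSq s ω z = ∑ k, z k * (C.A s k i * (z k - z i))
      - z i * ∑ l, C.A s l i * z l := by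
    simp only [seminormSq, dotProduct, C.Psi_mulVec_apply hi, mul_sub, Finset.sum_sub_distrib]
    simp
  have e2 : ∑ j, C.intensity j s ω * C.increment j s ω z ^ 2
      = ∑ j, C.A s j i * (z j - z i) ^ 2 := by
    refine Finset.sum_congr rfl fun j _ => ?_
    rw [C.intensity_eq hi, C.increment_eq hi]
    split_ifs with h
    · subst h; simp
    · rfl
  rw [e1, e2, Finset.mul_sum, ← Finset.sum_sub_distrib]
  have : ∑ j, C.A s j i * (z j - z i) ^ 2 - z i ^ 2 * ∑ j, C.A s j i
      = ∑ k, (z k * (C.A s k i * (z k - z i)) - z i * (C.A s k i * z k)) := by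
    rw [Finset.mul_sum, ← Finset.sum_sub_distrib]
    exact Finset.sum_congr rfl fun j _ => by ring
  rw [← this, h0]
  ring

/-- As the columns of A sum to zero, z_i may be subtracted from every coordinate of z. The
compensator is thereby written with the same weights and jumps as the seminorm. -/
lemma dotProduct_flow (s : ℝ≥0) (ω : Ω) (z : Fin N → ℝ) :
    z ⬝ᵥ (C.A s *ᵥ C.left s ω) = ∑ j, C.intensity j s ω * C.increment j s ω z := by
  obtain ⟨i, hi⟩ := C.left_unit_vector s ω
  have h0 := C.rate.sum_eq_zero s i
  have e2 : ∑ j, C.intensity j s ω * C.increment j s ω z = ∑ j, C.A s j i * (z j - z i) := by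
    refine Finset.sum_congr rfl fun j _ => ?_
    rw [C.intensity_eq hi, C.increment_eq hi]
    split_ifs with h
    · subst h; simp
    · rfl
  rw [e2]
  simp_rw [mul_sub]
  rw [Finset.sum_sub_distrib, ← Finset.sum_mul, h0, zero_mul, sub_zero]
  refine Finset.sum_congr rfl fun j _ => ?_
  change z j * C.flow j s ω = _
  rw [C.flow_eq hi, mul_comm]

lemma seminormSq_nonneg (s : ℝ≥0) (ω : Ω) (z : Fin N → ℝ) : 0 ≤ C.seminormSq s ω z := by
  rw [seminormSq_eq]
  exact Finset.sum_nonneg fun j _ => mul_nonneg (C.intensity_nonneg j s ω) (sq_nonneg _)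

lemma sum_intensity_le {m : ℝ} {s : ℝ≥0} (hm : matrixNorm (C.A s) ≤ m) (ω : Ω) :
    ∑ j, C.intensity j s ω ≤ m := by
  obtain ⟨i, hi⟩ := C.left_unit_vector s ω
  have h0 := C.rate.sum_eq_zero s i
  have e : ∑ j, C.intensity j s ω = -C.A s i i := by
    have : ∀ j, C.intensity j s ω = C.A s j i - if j = i then C.A s i i else 0 := fun j => by
      rw [C.intensity_eq hi]
      split_ifs with h
      · subst h; simp
      · simp
    simp_rw [this]
    rw [Finset.sum_sub_distrib, h0]
    simp
  rw [e]
  exact (neg_le_abs _).trans ((abs_apply_le_matrixNorm _ i i).trans hm)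

/-- Test the pseudoinverse B on v = Ψe_j = a(e_j - e_i), where a = A_ji. Since ΨBΨ = Ψ, v'Bv = a,
while |v|² = 2a², so 1 ≤ 2a‖B‖. The smallness condition then gives c''√(6m) ≤ 2a, and with a ≤ m
this leaves c''² ≤ 2a/3. -/
lemma sq_le_rate {c'' m : ℝ} (hc : 0 ≤ c'') (hm0 : 0 < m) {s : ℝ≥0} (hm : matrixNorm (C.A s) ≤ m)
    {ω : Ω} (h : ∃ B, IsMoorePenrose (C.Psi s ω) B ∧ c'' * matrixNorm B * √(6 * m) < 1)
    {i j : Fin N} (hi : C.left s ω = Pi.single i 1) (hij : j ≠ i) (hA : 0 < C.A s j i) :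
    c'' ^ 2 ≤ C.A s j i := by
  obtain ⟨B, hB, hlt⟩ := h
  set a := C.A s j i with ha
  set v : Fin N → ℝ := C.Psi s ω *ᵥ Pi.single j 1 with hv
  have hvk : ∀ k, v k = (Pi.single j a : Fin N → ℝ) k - (Pi.single i a : Fin N → ℝ) k := fun k => by
    rw [hv, C.Psi_mulVec_apply hi]
    by_cases hk : k = i
    · subst hk
      simp [Pi.single_apply, Ne.symm hij, ha]
    · by_cases hkj : k = j
      · subst hkj; simp [hk, ha, Ne.symm hij]
      · simp [hk, hkj, Ne.symm hij]
  have hvv : v ⬝ᵥ v = 2 * a ^ 2 := by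
    have hv' : v = Pi.single j a - Pi.single i a := by ext k; rw [hvk]; rfl
    rw [hv']
    simp [dotProduct_sub, hij, Ne.symm hij]
    ring
  have hsymm : (C.Psi s ω)ᵀ = C.Psi s ω := by
    rw [Psi]
    simp only [Matrix.transpose_sub, Matrix.transpose_mul, Matrix.diagonal_transpose,
      Matrix.transpose_transpose]
    abel
  have hvB : v ⬝ᵥ (B *ᵥ v) = a := by
    have e1 : v ⬝ᵥ (B *ᵥ v) = Pi.single j 1 ⬝ᵥ (C.Psi s ω *ᵥ (B *ᵥ v)) := by
      rw [Matrix.dotProduct_mulVec (Pi.single j 1), ← Matrix.mulVec_transpose, hsymm]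
    rw [e1, hv, Matrix.mulVec_mulVec, Matrix.mulVec_mulVec,
      hB.mul_mul_self, ← hv, single_dotProduct, hvk]
    simp [hij]
  have hle := (le_abs_self _).trans (abs_dotProduct_mulVec_le B v v)
  rw [hvB, hvv, Real.mul_self_sqrt (by positivity)] at hle
  have hB0 : 0 ≤ matrixNorm B := norm_nonneg _
  have h1 : 1 ≤ 2 * (matrixNorm B * a) := by
    by_contra hcon
    push Not at hcon
    nlinarith
  have ham : a ≤ m := (le_abs_self _).trans ((abs_apply_le_matrixNorm _ j i).trans hm)
  set r := √(6 * m) with hr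
  have hr0 : 0 ≤ r := Real.sqrt_nonneg _
  have hr2 : r ^ 2 = 6 * m := Real.sq_sqrt (by positivity)
  have h2 : c'' * r ≤ 2 * a := by
    have : c'' * r ≤ c'' * r * (2 * (matrixNorm B * a)) :=
      le_mul_of_one_le_right (mul_nonneg hc hr0) h1
    have h3 : c'' * r * (2 * (matrixNorm B * a)) = (c'' * matrixNorm B * r) * (2 * a) := by ring
    rw [h3] at this
    exact this.trans (mul_le_of_le_one_left (by positivity) hlt.le)
  have h4 : (c'' * r) ^ 2 ≤ (2 * a) ^ 2 := pow_le_pow_left₀ (mul_nonneg hc hr0) h2 2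
  rw [mul_pow, hr2] at h4
  have h5 : c'' ^ 2 * (6 * m) ≤ 4 * a * m := by nlinarith
  have h6 : c'' ^ 2 * 6 ≤ 4 * a := by
    have : c'' ^ 2 * 6 * m ≤ 4 * a * m := by linarith
    exact le_of_mul_le_mul_right this hm0
  linarith

/-- Under the smallness condition, the jumps dominate the dependence of the driver on `z`. -/
lemma mul_seminorm_le {c'' m : ℝ} (hc : 0 ≤ c'') (hm0 : 0 < m) {s : ℝ≥0}
    (hm : matrixNorm (C.A s) ≤ m) {ω : Ω}
    (h : ∃ B, IsMoorePenrose (C.Psi s ω) B ∧ c'' * matrixNorm B * √(6 * m) < 1)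
    (z : Fin N → ℝ) :
    c'' * C.seminorm s ω z ≤ ∑ j, C.intensity j s ω * |C.increment j s ω z| := by
  obtain ⟨i, hi⟩ := C.left_unit_vector s ω
  -- Where λ_j > 0, the constant c'' is at most √λ_j, which upgrades √λ_j to λ_j; where λ_j = 0 both
  -- sides vanish.
  have hbnd : ∀ j, c'' * (√(C.intensity j s ω) * |C.increment j s ω z|)
      ≤ C.intensity j s ω * |C.increment j s ω z| := by
    intro j
    have h0 := C.intensity_nonneg j s ω
    rcases h0.eq_or_lt with h1 | h1
    · simp [← h1]
    · have h2 := C.intensity_eq hi j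
      split_ifs at h2 with hij
      · exact absurd h2 h1.ne'
      · have h3 : c'' ^ 2 ≤ C.intensity j s ω := by
          rw [h2]; exact C.sq_le_rate hc hm0 hm h hi hij (h2 ▸ h1)
        have h4 : c'' ≤ √(C.intensity j s ω) := Real.le_sqrt_of_sq_le h3
        rw [← mul_assoc]
        gcongr
        calc c'' * √(C.intensity j s ω) ≤ √(C.intensity j s ω) * √(C.intensity j s ω) := by gcongr
          _ = _ := Real.mul_self_sqrt h0
  refine le_trans ?_ (Finset.sum_le_sum fun j _ => hbnd j)
  rw [← Finset.mul_sum]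
  gcongr
  -- The ℓ² norm of the numbers √λ_j |Δ_j| is at most their ℓ¹ norm.
  rw [seminorm, seminormSq_eq]
  refine Real.sqrt_le_iff.2 ⟨Finset.sum_nonneg fun j _ => by positivity, ?_⟩
  have e : ∀ j, C.intensity j s ω * C.increment j s ω z ^ 2
      = (√(C.intensity j s ω) * |C.increment j s ω z|) ^ 2 := fun j => by
    rw [mul_pow, Real.sq_sqrt (C.intensity_nonneg j s ω), sq_abs]
  simp_rw [e]
  exact Finset.sum_sq_le_sq_sum_of_nonneg fun j _ => by positivity

end MarkovChain

/-! ### Reflected paths and the level of their push. -/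

lemma ofReal_integral_le_lintegral {α : Type*} [MeasurableSpace α] {μ : Measure α} {f : α → ℝ}
    (hf : Integrable f μ) : ENNReal.ofReal (∫ x, f x ∂μ) ≤ ∫⁻ x, ENNReal.ofReal (f x) ∂μ := by
  have h1 : ∫ x, f x ∂μ ≤ ∫ x, max (f x) 0 ∂μ :=
    integral_mono hf hf.pos_part fun x => le_max_left _ _
  refine (ENNReal.ofReal_le_ofReal h1).trans (le_of_eq ?_)
  rw [ofReal_integral_eq_lintegral_ofReal hf.pos_part
    (Eventually.of_forall fun x => le_max_right _ _)]
  refine lintegral_congr fun x => ?_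
  rcases le_total (f x) 0 with h | h
  · rw [max_eq_right h, ENNReal.ofReal_zero, ENNReal.ofReal_of_nonpos h]
  · rw [max_eq_left h]

lemma setIntegral_Ioc_add {g : ℝ≥0 → ℝ} {μ : Measure ℝ≥0} {a b c : ℝ≥0} (hab : a ≤ b) (hbc : b ≤ c)
    (hg : IntegrableOn g (Set.Ioc a c) μ) :
    ∫ u in Set.Ioc a b, g u ∂μ + ∫ u in Set.Ioc b c, g u ∂μ = ∫ u in Set.Ioc a c, g u ∂μ := by
  rw [← setIntegral_union (Set.Ioc_disjoint_Ioc_of_le le_rfl) measurableSet_Ioc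
    (hg.mono_set (Set.Ioc_subset_Ioc_right hbc)) (hg.mono_set (Set.Ioc_subset_Ioc_left hab)),
    Set.Ioc_union_Ioc_eq_Ioc hab hbc]

/-- A path that increases by the increments of `K₂` and decreases by those of `K₁` and by the
integral of `d`, reflected at the level `e` by `K₁`: its value at the beginning is controlled by
its value at the end, the level and the integral of the drift. -/
lemma ofReal_le_max_add {a b : ℝ≥0} (hab : a ≤ b) {y d K₁ K₂ : ℝ≥0 → ℝ} {G : ℝ≥0 → ℝ≥0∞}
    {e : ℝ≥0∞} (hd : IntegrableOn d (Set.Ioc a b) lebesgue)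
    (hy : ∀ s s', a ≤ s → s ≤ s' → s' ≤ b →
      y s - y s' = ∫ u in Set.Ioc s s', d u ∂lebesgue + (K₁ s' - K₁ s) - (K₂ s' - K₂ s))
    (hK₁ : MonotoneOn K₁ (Set.Icc a b)) (hK₂ : MonotoneOn K₂ (Set.Icc a b))
    (hK₁c : ContinuousOn K₁ (Set.Icc a b)) (hyc : ContinuousOn y (Set.Icc a b))
    (hG : ∀ᵐ s ∂lebesgue, s ∈ Set.Ioo a b → 0 < y s → ENNReal.ofReal (d s) ≤ G s)
    (he : ∀ r q, a < r → r < q → q < b → K₁ r < K₁ q → ∃ u ∈ Set.Icc r q, ENNReal.ofReal (y u) ≤ e) :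
    ENNReal.ofReal (y a) ≤ max (ENNReal.ofReal (y b)) e + ∫⁻ u in Set.Ioc a b, G u ∂lebesgue := by
  -- D is the first time at which y is at the level e or below it, and D = b if there is none.
  obtain ⟨D, hDmem, hDend, hDlt⟩ : ∃ D ∈ Set.Icc a b,
      ENNReal.ofReal (y D) ≤ max (ENNReal.ofReal (y b)) e ∧
        ∀ s ∈ Set.Ico a D, e < ENNReal.ofReal (y s) := by
    set S := {s | s ∈ Set.Icc a b ∧ ENNReal.ofReal (y s) ≤ e} with hS
    by_cases hne : S.Nonempty
    · have hcl : IsClosed S := by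
        have := (ENNReal.continuous_ofReal.comp_continuousOn hyc).preimage_isClosed_of_isClosed
          isClosed_Icc (isClosed_Iic (a := e))
        exact this
      have hbdd : BddBelow S := ⟨a, fun s hs => hs.1.1⟩
      have hmem : sInf S ∈ S := hcl.csInf_mem hne hbdd
      refine ⟨sInf S, hmem.1, hmem.2.trans (le_max_right _ _), fun s hs => ?_⟩
      by_contra hcon
      exact absurd (csInf_le hbdd ⟨⟨hs.1, hs.2.le.trans hmem.1.2⟩, not_lt.1 hcon⟩) (not_le.2 hs.2)
    · refine ⟨b, ⟨hab, le_rfl⟩, le_max_left _ _, fun s hs => ?_⟩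
      by_contra hcon
      exact hne ⟨s, ⟨hs.1, hs.2.le⟩, not_lt.1 hcon⟩
  -- Before D the path is strictly above e, so K₁ cannot increase. Intermediate values of K₁ move a
  -- possible increase to times r < q inside (a, D), because `he` says nothing about the endpoints.
  have hKeq : K₁ D = K₁ a := by
    by_contra hne
    have hlt : K₁ a < K₁ D :=
      lt_of_le_of_ne (hK₁ ⟨le_rfl, hab⟩ hDmem hDmem.1) (Ne.symm hne)
    obtain ⟨x₁, hx₁, hx₁'⟩ := exists_between hlt
    obtain ⟨x₂, hx₂, hx₂'⟩ := exists_between hx₁'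
    have hsub : Set.Icc a D ⊆ Set.Icc a b := Set.Icc_subset_Icc_right hDmem.2
    have hivt := intermediate_value_Ioo hDmem.1 (hK₁c.mono hsub)
    obtain ⟨r, hr, hr'⟩ := hivt ⟨hx₁, hx₁'⟩
    obtain ⟨q, hq, hq'⟩ := hivt ⟨hx₁.trans hx₂, hx₂'⟩
    have hrq : r < q := by
      by_contra hcon
      have := hK₁ (hsub (Set.Ioo_subset_Icc_self hq)) (hsub (Set.Ioo_subset_Icc_self hr))
        (not_lt.1 hcon)
      rw [hr', hq'] at this
      exact absurd hx₂ (not_lt.2 this)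
    obtain ⟨u, hu, hue⟩ := he r q hr.1 hrq (hq.2.trans_le hDmem.2) (by rw [hr', hq']; exact hx₂)
    exact absurd hue (not_le.2 (hDlt u ⟨hr.1.le.trans hu.1, hu.2.trans_lt hq.2⟩))
  have h1 := hy a D le_rfl hDmem.1 hDmem.2
  have h2 := hK₂ ⟨le_rfl, hab⟩ hDmem hDmem.1
  have h3 : y a ≤ y D + ∫ u in Set.Ioc a D, d u ∂lebesgue := by rw [hKeq] at h1; linarith
  have hsub : Set.Ioc a D ⊆ Set.Ioc a b := Set.Ioc_subset_Ioc_right hDmem.2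
  calc ENNReal.ofReal (y a) ≤ ENNReal.ofReal (y D + ∫ u in Set.Ioc a D, d u ∂lebesgue) :=
        ENNReal.ofReal_le_ofReal h3
    _ ≤ ENNReal.ofReal (y D) + ENNReal.ofReal (∫ u in Set.Ioc a D, d u ∂lebesgue) :=
        ENNReal.ofReal_add_le
    _ ≤ ENNReal.ofReal (y D) + ∫⁻ u in Set.Ioc a D, ENNReal.ofReal (d u) ∂lebesgue := by
        gcongr
        exact ofReal_integral_le_lintegral (hd.mono_set hsub)
    _ ≤ ENNReal.ofReal (y D) + ∫⁻ u in Set.Ioc a D, G u ∂lebesgue := by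
        refine add_le_add le_rfl ?_
        refine setLIntegral_mono_ae' measurableSet_Ioc ?_
        filter_upwards [hG, measure_eq_zero_iff_ae_notMem.1 (measure_singleton (μ := lebesgue) D)]
          with s hs hsD hsI
        have hsD' : s < D := lt_of_le_of_ne hsI.2 hsD
        refine hs ⟨hsI.1, hsD'.trans_le hDmem.2⟩ ?_
        exact ENNReal.ofReal_pos.1 (zero_le.trans_lt (hDlt s ⟨hsI.1.le, hsD'⟩))
    _ ≤ _ := add_le_add hDend (lintegral_mono_set hsub)

/-- A path on `[0, T]` with jumps only in `J`: `yl` are its left limits, `d` its drift and `K₁`,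
`K₂` the continuous nondecreasing processes that push it. -/
structure IsReflectedPath (J : Set ℝ≥0) (T : ℝ≥0) (y yl d K₁ K₂ : ℝ≥0 → ℝ) : Prop where
  finite : (J ∩ Set.Icc 0 T).Finite
  left_eq : ∀ s ≤ T, s ∉ J → yl s = y s
  segment : ∀ a b, a < b → b ≤ T → (∀ s ∈ Set.Ioo a b, s ∉ J) →
    y a - yl b = ∫ u in Set.Ioc a b, d u ∂lebesgue + (K₁ b - K₁ a) - (K₂ b - K₂ a)
  integrable : IntegrableOn d (Set.Ioc 0 T) lebesgue
  mono₁ : MonotoneOn K₁ (Set.Icc 0 T)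
  mono₂ : MonotoneOn K₂ (Set.Icc 0 T)
  cont₁ : ContinuousOn K₁ (Set.Icc 0 T)
  cont₂ : ContinuousOn K₂ (Set.Icc 0 T)

namespace IsReflectedPath

variable {J : Set ℝ≥0} {T : ℝ≥0} {y yl d K₁ K₂ : ℝ≥0 → ℝ}

/-- With the value at b replaced by the left limit, a stretch between two jumps becomes a continuous
path on a closed interval, to which the estimate without jumps applies. -/
lemma sub_eq (h : IsReflectedPath J T y yl d K₁ K₂) {a b : ℝ≥0} (hbT : b ≤ T)
    (hJ : ∀ s ∈ Set.Ioo a b, s ∉ J) {s s' : ℝ≥0} (has : a ≤ s) (hss : s ≤ s') (hsb : s' ≤ b) :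
    Function.update y b (yl b) s - Function.update y b (yl b) s'
      = ∫ u in Set.Ioc s s', d u ∂lebesgue + (K₁ s' - K₁ s) - (K₂ s' - K₂ s) := by
  rcases hss.eq_or_lt with rfl | hlt
  · simp
  rw [Function.update_of_ne (hlt.trans_le hsb).ne]
  have e : Function.update y b (yl b) s' = yl s' := by
    rcases hsb.eq_or_lt with rfl | hlt'
    · simp
    · rw [Function.update_of_ne hlt'.ne, h.left_eq s' (hsb.trans hbT)
        (hJ s' ⟨has.trans_lt hlt, hlt'⟩)]
  rw [e]
  exact h.segment s s' hlt (hsb.trans hbT) fun u hu =>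
    hJ u ⟨has.trans_lt hu.1, hu.2.trans_le hsb⟩

lemma continuousOn_update (h : IsReflectedPath J T y yl d K₁ K₂) {a b : ℝ≥0} (hbT : b ≤ T)
    (hJ : ∀ s ∈ Set.Ioo a b, s ∉ J) :
    ContinuousOn (Function.update y b (yl b)) (Set.Icc a b) := by
  have hsub : Set.Icc a b ⊆ Set.Icc 0 T := Set.Icc_subset_Icc zero_le hbT
  have hbnd := h.integrable.mono_set (Set.Ioc_subset_Ioc (zero_le (a := a)) hbT)
  have hc : ContinuousOn (fun s => Function.update y b (yl b) a
      - (∫ u in Set.Ioc a s, d u ∂lebesgue + (K₁ s - K₁ a) - (K₂ s - K₂ a))) (Set.Icc a b) :=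
    continuousOn_const.sub (((continuousOn_setIntegral_Ioc hbnd).add
      ((h.cont₁.mono hsub).sub continuousOn_const)).sub
      ((h.cont₂.mono hsub).sub continuousOn_const))
  refine hc.congr fun s hs => ?_
  have := h.sub_eq hbT hJ le_rfl hs.1 hs.2
  linarith

lemma exists_Ioo_left (h : IsReflectedPath J T y yl d K₁ K₂) {b : ℝ≥0} (hb : 0 < b) (hbT : b ≤ T) :
    ∃ a < b, ∀ s ∈ Set.Ioo a b, s ∉ J := by
  have h1 : ((J ∩ Set.Icc 0 T) \ ({b} : Set ℝ≥0))ᶜ ∈ 𝓝[<] b := mem_nhdsWithin_of_mem_nhds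
    ((h.finite.subset Set.sdiff_subset).isClosed.isOpen_compl.mem_nhds (by simp))
  obtain ⟨a, ha, hsub⟩ := (mem_nhdsLT_iff_exists_Ioo_subset' hb).1 h1
  exact ⟨a, ha, fun s hs hsJ => hsub hs ⟨⟨hsJ, zero_le, hs.2.le.trans hbT⟩, hs.2.ne⟩⟩

lemma exists_Ioo_right (h : IsReflectedPath J T y yl d K₁ K₂) {a : ℝ≥0} (haT : a < T) :
    ∃ b > a, b ≤ T ∧ ∀ s ∈ Set.Ioo a b, s ∉ J := by
  have h1 : ((J ∩ Set.Icc 0 T) \ ({a} : Set ℝ≥0))ᶜ ∈ 𝓝[>] a := mem_nhdsWithin_of_mem_nhds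
    ((h.finite.subset Set.sdiff_subset).isClosed.isOpen_compl.mem_nhds (by simp))
  obtain ⟨b, hb, hsub⟩ := (mem_nhdsGT_iff_exists_Ioo_subset' haT).1 h1
  refine ⟨min b T, lt_min hb haT, min_le_right _ _, fun s hs hsJ =>
    hsub ⟨hs.1, hs.2.trans_le (min_le_left _ _)⟩
      ⟨⟨hsJ, zero_le, (hs.2.trans_le (min_le_right _ _)).le⟩, hs.1.ne'⟩⟩

lemma tendsto_left (h : IsReflectedPath J T y yl d K₁ K₂) {b : ℝ≥0} (hb : 0 < b) (hbT : b ≤ T) :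
    Tendsto y (𝓝[<] b) (𝓝 (yl b)) := by
  obtain ⟨a, hab, hJ⟩ := h.exists_Ioo_left hb hbT
  have hc := (h.continuousOn_update hbT hJ) b ⟨hab.le, le_rfl⟩
  have h1 : Tendsto (Function.update y b (yl b)) (𝓝[<] b) (𝓝 (yl b)) := by
    have h2 : 𝓝[<] b ≤ 𝓝[Set.Icc a b] b := by
      rw [← nhdsWithin_Ioo_eq_nhdsLT hab]
      exact nhdsWithin_mono _ Set.Ioo_subset_Icc_self
    have h3 := hc.tendsto.mono_left h2
    simpa using h3
  refine h1.congr' ?_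
  filter_upwards [self_mem_nhdsWithin] with s hs
  exact Function.update_of_ne (ne_of_lt hs) _ _

lemma tendsto_right (h : IsReflectedPath J T y yl d K₁ K₂) {a : ℝ≥0} (haT : a < T) :
    Tendsto y (𝓝[>] a) (𝓝 (y a)) := by
  obtain ⟨b, hab, hbT, hJ⟩ := h.exists_Ioo_right haT
  have hc := (h.continuousOn_update hbT hJ) a ⟨le_rfl, hab.le⟩
  have h2 : 𝓝[>] a ≤ 𝓝[Set.Icc a b] a := by
    rw [← nhdsWithin_Ioo_eq_nhdsGT hab]
    exact nhdsWithin_mono _ Set.Ioo_subset_Icc_self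
  have h3 := hc.tendsto.mono_left h2
  rw [Function.update_of_ne hab.ne] at h3
  refine h3.congr' ?_
  filter_upwards [Ioo_mem_nhdsGT hab] with s hs
  exact Function.update_of_ne hs.2.ne _ _

end IsReflectedPath

/-- The supremum of the levels above which the path `y` is not pushed by `K` before time `t`. -/
noncomputable def pushLevel (K y : ℝ≥0 → ℝ) (t : ℝ≥0) : ℝ≥0∞ :=
  ⨆ (m : ℕ) (n : ℕ), ⨆ (_ : TopologicalSpace.denseSeq ℝ≥0 m < TopologicalSpace.denseSeq ℝ≥0 n)
    (_ : TopologicalSpace.denseSeq ℝ≥0 n < t)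
    (_ : K (TopologicalSpace.denseSeq ℝ≥0 m) < K (TopologicalSpace.denseSeq ℝ≥0 n)),
    ⨅ (l : ℕ) (_ : TopologicalSpace.denseSeq ℝ≥0 l ∈ Set.Icc (TopologicalSpace.denseSeq ℝ≥0 m)
      (TopologicalSpace.denseSeq ℝ≥0 n)), ENNReal.ofReal (y (TopologicalSpace.denseSeq ℝ≥0 l))

lemma pushLevel_mono (K y : ℝ≥0 → ℝ) : Monotone (pushLevel K y) := by
  intro s t hst
  refine iSup₂_mono fun m n => iSup_mono fun h1 => iSup_le fun h2 => ?_
  exact le_iSup_of_le (h2.trans_le hst) le_rfl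

lemma exists_denseSeq_between {a b : ℝ≥0} (hab : a < b) :
    ∃ n, a < TopologicalSpace.denseSeq ℝ≥0 n ∧ TopologicalSpace.denseSeq ℝ≥0 n < b := by
  obtain ⟨_, ⟨n, rfl⟩, h⟩ := (TopologicalSpace.denseRange_denseSeq ℝ≥0).exists_between hab
  exact ⟨n, h⟩

/-- If `K` increases on `[r, q]`, the path is below the push level somewhere in `[r, q]`. -/
lemma exists_le_pushLevel {K y ŷ : ℝ≥0 → ℝ} {r q t : ℝ≥0} (hrq : r < q) (hqt : q ≤ t)
    (hKm : MonotoneOn K (Set.Icc r q)) (hKc : ContinuousOn K (Set.Icc r q))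
    (hyc : ContinuousOn ŷ (Set.Icc r q)) (hy : ∀ s ∈ Set.Ioo r q, ŷ s = y s) (hK : K r < K q) :
    ∃ u ∈ Set.Icc r q, ENNReal.ofReal (ŷ u) ≤ pushLevel K y t := by
  obtain ⟨x₁, hx₁, hx₁'⟩ := exists_between hK
  obtain ⟨x₂, hx₂, hx₂'⟩ := exists_between hx₁'
  have hivt := intermediate_value_Ioo hrq.le hKc
  obtain ⟨r', hr, hr'⟩ := hivt ⟨hx₁, hx₁'⟩
  obtain ⟨q', hq, hq'⟩ := hivt ⟨hx₁.trans hx₂, hx₂'⟩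
  have hrq' : r' < q' := by
    by_contra hcon
    have := hKm (Set.Ioo_subset_Icc_self hq) (Set.Ioo_subset_Icc_self hr) (not_lt.1 hcon)
    rw [hr', hq'] at this
    exact absurd hx₂ (not_lt.2 this)
  obtain ⟨m, hm, hm'⟩ := exists_denseSeq_between hr.1
  obtain ⟨n, hn, hn'⟩ := exists_denseSeq_between hq.2
  have hmn : TopologicalSpace.denseSeq ℝ≥0 m < TopologicalSpace.denseSeq ℝ≥0 n :=
    hm'.trans (hrq'.trans hn)
  have hKmn : K (TopologicalSpace.denseSeq ℝ≥0 m) < K (TopologicalSpace.denseSeq ℝ≥0 n) := by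
    have h1 := hKm ⟨hm.le, (hmn.trans hn').le⟩ (Set.Ioo_subset_Icc_self hr) hm'.le
    have h2 := hKm (Set.Ioo_subset_Icc_self hq) ⟨(hm.trans hmn).le, hn'.le⟩ hn.le
    rw [hr'] at h1
    rw [hq'] at h2
    linarith
  -- The minimum over [r, q] lies below the values at all the dense times between `m` and `n`, hence
  -- below the infimum that enters the push level.
  obtain ⟨u, hu, humin⟩ := (isCompact_Icc (a := r) (b := q)).exists_isMinOn ⟨r, le_rfl, hrq.le⟩ hyc
  refine ⟨u, hu, ?_⟩
  refine le_trans ?_ (le_iSup₂_of_le m n (le_iSup₂_of_le hmn (hn'.trans_le hqt)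
    (le_iSup_of_le hKmn le_rfl)))
  refine le_iInf₂ fun l hl => ?_
  have hl' : TopologicalSpace.denseSeq ℝ≥0 l ∈ Set.Ioo r q :=
    ⟨hm.trans_le hl.1, hl.2.trans_lt hn'⟩
  rw [← hy _ hl']
  exact ENNReal.ofReal_le_ofReal (humin (Set.Ioo_subset_Icc_self hl'))

/-- If the path is below `x` somewhere on each interval where `K` increases, so is its push
level. -/
lemma pushLevel_le {K y : ℝ≥0 → ℝ} {T : ℝ≥0} {x : ℝ≥0∞}
    (hy : ∀ s < T, Tendsto y (𝓝[>] s) (𝓝 (y s)))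
    (h : ∀ r q, r < q → q ≤ T → K r < K q → ∃ s, r < s ∧ s < q ∧ ENNReal.ofReal (y s) ≤ x) :
    pushLevel K y T ≤ x := by
  refine iSup₂_le fun m n => iSup_le fun hmn => iSup₂_le fun hnT hK => ?_
  obtain ⟨s, hs, hs', hsx⟩ := h _ _ hmn hnT.le hK
  refine le_trans ?_ hsx
  -- The time s need not belong to the dense sequence, but right continuity gives dense times after
  -- s with values close to the one at s.
  have ht : Tendsto (fun u => ENNReal.ofReal (y u)) (𝓝[>] s) (𝓝 (ENNReal.ofReal (y s))) :=
    (ENNReal.continuous_ofReal.tendsto _).comp (hy s (hs'.trans hnT))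
  refine ge_of_tendsto_of_frequently ht ?_
  rw [(nhdsGT_basis_of_exists_gt ⟨_, hs'⟩).frequently_iff]
  intro u hu
  obtain ⟨l, hl, hl'⟩ := exists_denseSeq_between (lt_min hu hs')
  exact ⟨_, ⟨hl, hl'.trans_le (min_le_left _ _)⟩,
    iInf₂_le l ⟨(hs.trans hl).le, (hl'.trans_le (min_le_right _ _)).le⟩⟩

namespace IsReflectedPath

variable {J : Set ℝ≥0} {T : ℝ≥0} {y yl d K₁ K₂ : ℝ≥0 → ℝ}

/-- The maximum with the push level is blind to both pushes: K₁ increases only where the path comes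
down to the level, and K₂ only lowers the earlier value. Since the level is nondecreasing in time,
the linear estimate holds on every subinterval and can be squared. -/
lemma max_pushLevel_sq_le (h : IsReflectedPath J T y yl d K₁ K₂) {G : ℝ≥0 → ℝ≥0∞}
    (hGm : AEMeasurable G (lebesgue.restrict (Set.Ioc 0 T)))
    (hGfin : ∫⁻ u in Set.Ioc 0 T, G u ∂lebesgue ≠ ∞)
    (hG : ∀ᵐ s ∂lebesgue, s ∈ Set.Ioc 0 T → 0 < y s → ENNReal.ofReal (d s) ≤ G s)
    {a b : ℝ≥0} (hab : a < b) (hbT : b ≤ T) (hJ : ∀ s ∈ Set.Ioo a b, s ∉ J) :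
    max (ENNReal.ofReal (y a)) (pushLevel K₁ y a) ^ 2
      ≤ max (ENNReal.ofReal (yl b)) (pushLevel K₁ y b) ^ 2
        + 2 * ∫⁻ u in Set.Ioc a b, max (ENNReal.ofReal (y u)) (pushLevel K₁ y u) * G u
          ∂lebesgue := by
  have hsubI : Set.Ioc a b ⊆ Set.Ioc 0 T := Set.Ioc_subset_Ioc zero_le hbT
  set w : ℝ≥0 → ℝ := Function.update y b (yl b) with hw
  have hwc : ContinuousOn w (Set.Icc a b) := h.continuousOn_update hbT hJ
  have hwy : ∀ s, s ≠ b → w s = y s := fun s hs => Function.update_of_ne hs _ _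
  have hwb : w b = yl b := Function.update_self ..
  have key := sq_le_sq_add_of_le_add (μ := lebesgue) hab.le
    (U := fun s => max (ENNReal.ofReal (w s)) (pushLevel K₁ y s))
    (hGm.mono_measure (Measure.restrict_mono hsubI le_rfl))
    (ne_top_of_le_ne_top hGfin (lintegral_mono_set hsubI)) ?_
  · rw [hwy a hab.ne, hwb] at key
    refine key.trans (le_of_eq ?_)
    congr 2
    refine lintegral_congr_ae (ae_restrict_of_ae ?_)
    filter_upwards [measure_eq_zero_iff_ae_notMem.1 (measure_singleton (μ := lebesgue) b)] with s hs
    rw [hwy s hs]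
  · intro s s' has hss hsb
    refine max_le ?_ ((pushLevel_mono _ _ hss).trans ((le_max_right _ _).trans le_self_add))
    have hsubJ : Set.Icc s s' ⊆ Set.Icc a b := Set.Icc_subset_Icc has hsb
    have hsubT : Set.Icc s s' ⊆ Set.Icc 0 T := Set.Icc_subset_Icc zero_le (hsb.trans hbT)
    refine ofReal_le_max_add hss (d := d) (K₁ := K₁) (K₂ := K₂)
      (h.integrable.mono_set (Set.Ioc_subset_Ioc zero_le (hsb.trans hbT)))
      (fun u u' hu huu hu' => h.sub_eq hbT hJ (has.trans hu) huu (hu'.trans hsb))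
      (h.mono₁.mono hsubT) (h.mono₂.mono hsubT) (h.cont₁.mono hsubT) (hwc.mono hsubJ) ?_ ?_
    · filter_upwards [hG] with u hu huI huw
      have hub : u < b := huI.2.trans_le hsb
      rw [hwy u hub.ne] at huw
      exact hu ⟨zero_le.trans_lt huI.1, hub.le.trans hbT⟩ huw
    · intro r q hr hrq hq hK
      have hsub : Set.Icc r q ⊆ Set.Icc s s' := Set.Icc_subset_Icc hr.le hq.le
      exact exists_le_pushLevel hrq hq.le (h.mono₁.mono (hsub.trans hsubT))
        (h.cont₁.mono (hsub.trans hsubT)) (hwc.mono (hsub.trans hsubJ))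
        (fun u hu => hwy u ((hu.2.trans hq).trans_le hsb).ne) hK

end IsReflectedPath

/-- Concatenation of estimates between the jumps. -/
lemma add_sum_le_of_le_segment {J : Set ℝ≥0} {T : ℝ≥0} (hJ : ∀ t, (J ∩ Set.Ioc t T).Finite)
    {μ : Measure ℝ≥0} {W Wl g : ℝ≥0 → ℝ≥0∞} (hW : ∀ s ≤ T, s ∉ J → Wl s = W s)
    (hseg : ∀ a b, a < b → b ≤ T → (∀ s ∈ Set.Ioo a b, s ∉ J) →
      W a ≤ Wl b + ∫⁻ u in Set.Ioc a b, g u ∂μ) {t : ℝ≥0} (ht : t ≤ T) :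
    W t + ∑ s ∈ (hJ t).toFinset, W s
      ≤ W T + ∫⁻ u in Set.Ioc t T, g u ∂μ + ∑ s ∈ (hJ t).toFinset, Wl s := by
  induction hn : (hJ t).toFinset.card generalizing t with
  | zero =>
    have hemp : (hJ t).toFinset = ∅ := Finset.card_eq_zero.1 hn
    have hno : ∀ s ∈ Set.Ioc t T, s ∉ J := fun s hs hsJ => by
      have : s ∈ (hJ t).toFinset := (hJ t).mem_toFinset.2 ⟨hsJ, hs⟩
      simp [hemp] at this
    rw [hemp, Finset.sum_empty, Finset.sum_empty, add_zero, add_zero]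
    rcases ht.eq_or_lt with rfl | hlt
    · exact le_self_add
    · rw [← hW T le_rfl (hno T ⟨hlt, le_rfl⟩)]
      exact hseg t T hlt le_rfl fun s hs => hno s ⟨hs.1, hs.2.le⟩
  | succ n ih =>
    have hne : (hJ t).toFinset.Nonempty := Finset.card_pos.1 (by omega)
    -- Cut at the first jump after t: the segment up to b ends in the left limit `Wl b`, and the
    -- induction hypothesis starts from `W b`.
    set b := (hJ t).toFinset.min' hne with hb
    have hbmem : b ∈ J ∩ Set.Ioc t T := (hJ t).mem_toFinset.1 (Finset.min'_mem _ hne)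
    have hno : ∀ s ∈ Set.Ioo t b, s ∉ J := fun s hs hsJ =>
      absurd (Finset.min'_le _ s ((hJ t).mem_toFinset.2 ⟨hsJ, hs.1, hs.2.le.trans hbmem.2.2⟩))
        (not_le.2 hs.2)
    have hnot : b ∉ (hJ b).toFinset := fun hcon => lt_irrefl _ ((hJ b).mem_toFinset.1 hcon).2.1
    have hins : (hJ t).toFinset = insert b (hJ b).toFinset := by
      ext s
      simp only [Set.Finite.mem_toFinset, Finset.mem_insert, Set.mem_inter_iff, Set.mem_Ioc]
      constructor
      · rintro ⟨h1, h2, h3⟩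
        rcases lt_trichotomy s b with hlt | heq | hgt
        · exact absurd h1 (hno s ⟨h2, hlt⟩)
        · exact Or.inl heq
        · exact Or.inr ⟨h1, hgt, h3⟩
      · rintro (rfl | ⟨h1, h2, h3⟩)
        · exact hbmem
        · exact ⟨h1, hbmem.2.1.trans h2, h3⟩
    have hcard : (hJ b).toFinset.card = n := by
      rw [hins, Finset.card_insert_of_notMem hnot] at hn
      omega
    have hIH := ih hbmem.2.2 hcard
    have hS := hseg t b hbmem.2.1 hbmem.2.2 hno
    rw [hins, Finset.sum_insert hnot, Finset.sum_insert hnot,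
      ← setLIntegral_Ioc_add hbmem.2.1.le hbmem.2.2]
    calc _ ≤ (Wl b + ∫⁻ u in Set.Ioc t b, g u ∂μ)
          + (W T + ∫⁻ u in Set.Ioc b T, g u ∂μ + ∑ s ∈ (hJ b).toFinset, Wl s) :=
          add_le_add hS hIH
      _ = _ := by ring

/-- The right end of the interval of the grid of mesh `1 / (n + 1)` that contains `t`. -/
noncomputable def gridRight (n : ℕ) (t : ℝ≥0) : ℝ≥0 := ((⌊(n + 1) * t⌋₊ : ℝ≥0) + 1) / (n + 1)

lemma lt_gridRight (n : ℕ) (t : ℝ≥0) : t < gridRight n t := by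
  rw [gridRight, lt_div_iff₀ (by positivity), mul_comm t]
  exact Nat.lt_floor_add_one _

lemma gridRight_le (n : ℕ) (t : ℝ≥0) : gridRight n t ≤ t + 1 / (n + 1) := by
  rw [gridRight, add_div]
  gcongr
  rw [div_le_iff₀ (by positivity), mul_comm t]
  exact Nat.floor_le zero_le

lemma tendsto_gridRight (t : ℝ≥0) : Tendsto (fun n => gridRight n t) atTop (𝓝[>] t) := by
  refine tendsto_nhdsWithin_iff.2 ⟨?_, Eventually.of_forall fun n => lt_gridRight n t⟩
  have h0 : Tendsto (fun n : ℕ => (1 : ℝ≥0) / (n + 1)) atTop (𝓝 0) := by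
    exact NNReal.tendsto_coe.1 (by simpa using tendsto_one_div_add_atTop_nhds_zero_nat (𝕜 := ℝ))
  have h1 : Tendsto (fun n : ℕ => t + 1 / ((n : ℝ≥0) + 1)) atTop (𝓝 t) := by
    simpa using (tendsto_const_nhds (x := t)).add h0
  exact tendsto_of_tendsto_of_tendsto_of_le_of_le tendsto_const_nhds h1
    (fun n => (lt_gridRight n t).le) (fun n => gridRight_le n t)

/-- The jointly measurable version of a right continuous process on `[0, T]`. -/
noncomputable def rightVersion {Ω : Type*} (T : ℝ≥0) (Y : ℝ≥0 → Ω → ℝ) (p : ℝ≥0 × Ω) : ℝ :=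
  limsup (fun n => Y (min (gridRight n p.1) T) p.2) atTop

lemma measurable_prod_of_countable {ι Ω : Type*} [Countable ι] [MeasurableSpace ι]
    [DiscreteMeasurableSpace ι] [MeasurableSpace Ω] {Y : ι → Ω → ℝ} (hY : ∀ i, Measurable (Y i))
    {g : ℝ≥0 → ι} (hg : Measurable g) : Measurable fun p : ℝ≥0 × Ω => Y (g p.1) p.2 := by
  have h1 : Measurable fun q : ι × Ω => Y q.1 q.2 := measurable_from_prod_countable_right hY
  exact h1.comp ((hg.comp measurable_fst).prodMk measurable_snd)

lemma measurable_gridRight {Ω : Type*} [MeasurableSpace Ω] {T : ℝ≥0} {Y : ℝ≥0 → Ω → ℝ}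
    (hY : ∀ t ≤ T, Measurable (Y t)) (n : ℕ) :
    Measurable fun p : ℝ≥0 × Ω => Y (min (gridRight n p.1) T) p.2 :=
  measurable_prod_of_countable (Y := fun k : ℕ => Y (min (((k : ℝ≥0) + 1) / (n + 1)) T))
    (fun _ => hY _ (min_le_right _ _)) (g := fun t => ⌊((n : ℝ≥0) + 1) * t⌋₊)
    (Nat.measurable_floor.comp (measurable_id.const_mul _))

lemma measurable_rightVersion {Ω : Type*} [MeasurableSpace Ω] {T : ℝ≥0} {Y : ℝ≥0 → Ω → ℝ}
    (hY : ∀ t ≤ T, Measurable (Y t)) : Measurable (rightVersion T Y) :=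
  Measurable.limsup fun n => measurable_gridRight hY n

/-- Right continuity is known only almost surely, and measurability only at each single time. The
upper limit over the grid is jointly measurable for all paths and gives back the regular ones; at
the time T, the minimum with T keeps all samples at T. -/
lemma rightVersion_eq {Ω : Type*} {T : ℝ≥0} {Y : ℝ≥0 → Ω → ℝ} {ω : Ω}
    (h : RCLLOn T fun t => Y t ω) {s : ℝ≥0} (hs : s ≤ T) : rightVersion T Y (s, ω) = Y s ω := by
  refine Tendsto.limsup_eq ?_
  rcases hs.eq_or_lt with rfl | hlt
  · have : (fun n => Y (min (gridRight n s) s) ω) = fun _ => Y s ω := by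
      ext n
      rw [min_eq_right (lt_gridRight n s).le]
    simp only [this]
    exact tendsto_const_nhds
  · have h1 : Tendsto (fun u => Y u ω) (𝓝[≥] s) (𝓝 (Y s ω)) := h.1 s hlt
    refine h1.comp (tendsto_nhdsWithin_iff.2 ⟨?_, Eventually.of_forall fun n =>
      le_min (lt_gridRight n s).le hs⟩)
    have h2 := (tendsto_gridRight s).mono_right nhdsWithin_le_nhds
    simpa [min_eq_left hs] using h2.min (tendsto_const_nhds (x := T))

lemma integrable_of_lintegral_sq {α : Type*} [MeasurableSpace α] {μ : Measure α}
    [IsFiniteMeasure μ] {g : α → ℝ} (hg : AEStronglyMeasurable g μ)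
    (h : ∫⁻ x, ‖g x‖ₑ ^ 2 ∂μ ≠ ∞) : Integrable g μ := by
  refine ⟨hg, ?_⟩
  have h1 : ∀ x, ‖g x‖ₑ ≤ 1 + ‖g x‖ₑ ^ 2 := fun x => by
    rcases le_total ‖g x‖ₑ 1 with h | h
    · exact h.trans le_self_add
    · exact (le_self_pow₀ h two_ne_zero).trans le_add_self
  refine (lintegral_mono h1).trans_lt ?_
  rw [lintegral_add_left measurable_const]
  simp [h.lt_top]

lemma two_mul_mul_le_add_sq (x y : ℝ≥0∞) : 2 * (x * y) ≤ x ^ 2 + y ^ 2 := by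
  wlog h : x ≤ y generalizing x y
  · rw [mul_comm x, add_comm (x ^ 2)]
    exact this y x (le_of_not_ge h)
  obtain ⟨c, rfl⟩ := exists_add_of_le h
  calc 2 * (x * (x + c)) ≤ 2 * (x * (x + c)) + c ^ 2 := le_self_add
    _ = _ := by ring

lemma add_sq_le_two_mul (x y : ℝ≥0∞) : (x + y) ^ 2 ≤ 2 * x ^ 2 + 2 * y ^ 2 := by
  calc (x + y) ^ 2 = x ^ 2 + y ^ 2 + 2 * (x * y) := by ring
    _ ≤ x ^ 2 + y ^ 2 + (x ^ 2 + y ^ 2) := by gcongr; exact two_mul_mul_le_add_sq x y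
    _ = _ := by ring

lemma enorm_add_sq_le (x y : ℝ) : ‖x + y‖ₑ ^ 2 ≤ 2 * ‖x‖ₑ ^ 2 + 2 * ‖y‖ₑ ^ 2 :=
  (pow_le_pow_left₀ zero_le (enorm_add_le x y) 2).trans (add_sq_le_two_mul _ _)

lemma enorm_sub_sq_le (x y : ℝ) : ‖x - y‖ₑ ^ 2 ≤ 2 * ‖x‖ₑ ^ 2 + 2 * ‖y‖ₑ ^ 2 :=
  (pow_le_pow_left₀ zero_le (enorm_sub_le (a := x) (b := y)) 2).trans (add_sq_le_two_mul _ _)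

/-! ### Measurability and size of the functionals of the integrand. -/

namespace MarkovChain

variable {Ω : Type*} [mΩ : MeasurableSpace Ω] {P : Measure Ω} {N : ℕ} (C : MarkovChain P N)

lemma measurable_increment {𝓜 : MeasurableSpace (ℝ≥0 × Ω)} (h𝓜 : C.filtration.predictable ≤ 𝓜)
    {Z : ℝ≥0 × Ω → (Fin N → ℝ)} (hZ : Measurable[𝓜] Z) (j : Fin N) :
    Measurable[𝓜] fun p => C.increment j p.1 p.2 (Z p) := by
  have hl : Measurable[𝓜] fun p : ℝ≥0 × Ω => C.left p.1 p.2 :=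
    C.measurable_left_predictable.mono h𝓜 le_rfl
  have hl' : ∀ i, Measurable[𝓜] fun p : ℝ≥0 × Ω => C.left p.1 p.2 i := fun i =>
    (measurable_pi_apply i).comp hl
  have hZ' : ∀ i, Measurable[𝓜] fun p : ℝ≥0 × Ω => Z p i := fun i =>
    (measurable_pi_apply i).comp hZ
  unfold increment dotProduct
  exact (hZ' j).sub (Finset.measurable_sum _ fun i _ => (hZ' i).mul (hl' i))

lemma measurable_seminormSq {𝓜 : MeasurableSpace (ℝ≥0 × Ω)} (h𝓜 : C.filtration.predictable ≤ 𝓜)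
    {Z : ℝ≥0 × Ω → (Fin N → ℝ)} (hZ : Measurable[𝓜] Z) :
    Measurable[𝓜] fun p => C.seminormSq p.1 p.2 (Z p) := by
  simp only [seminormSq_eq]
  exact Finset.measurable_sum _ fun j _ =>
    ((C.measurable_intensity_predictable j).mono h𝓜 le_rfl).mul
      ((C.measurable_increment h𝓜 hZ j).pow_const 2)

lemma measurable_dotProduct_flow {𝓜 : MeasurableSpace (ℝ≥0 × Ω)}
    (h𝓜 : C.filtration.predictable ≤ 𝓜) {Z : ℝ≥0 × Ω → (Fin N → ℝ)} (hZ : Measurable[𝓜] Z) :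
    Measurable[𝓜] fun p => Z p ⬝ᵥ (C.A p.1 *ᵥ C.left p.1 p.2) := by
  simp only [dotProduct_flow]
  exact Finset.measurable_sum _ fun j _ =>
    ((C.measurable_intensity_predictable j).mono h𝓜 le_rfl).mul (C.measurable_increment h𝓜 hZ j)

/-- Cauchy-Schwarz for the weights λ_j, whose total mass is at most m. -/
lemma sq_sum_intensity_mul_le {m : ℝ} {s : ℝ≥0} (hm : matrixNorm (C.A s) ≤ m) (ω : Ω)
    (x : Fin N → ℝ) :
    (∑ j, C.intensity j s ω * x j) ^ 2 ≤ m * ∑ j, C.intensity j s ω * x j ^ 2 := by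
  have h1 : ∀ j, C.intensity j s ω * x j
      = √(C.intensity j s ω) * (√(C.intensity j s ω) * x j) := fun j => by
    rw [← mul_assoc, Real.mul_self_sqrt (C.intensity_nonneg j s ω)]
  have h2 := Finset.sum_mul_sq_le_sq_mul_sq Finset.univ (fun j => √(C.intensity j s ω))
    (fun j => √(C.intensity j s ω) * x j)
  simp_rw [← h1, mul_pow, Real.sq_sqrt (C.intensity_nonneg _ s ω)] at h2
  exact h2.trans (mul_le_mul_of_nonneg_right (C.sum_intensity_le hm ω)
    (Finset.sum_nonneg fun j _ => mul_nonneg (C.intensity_nonneg j s ω) (sq_nonneg _)))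

lemma dotProduct_flow_sq_le {m : ℝ} {s : ℝ≥0} (hm : matrixNorm (C.A s) ≤ m) (ω : Ω)
    (z : Fin N → ℝ) : (z ⬝ᵥ (C.A s *ᵥ C.left s ω)) ^ 2 ≤ m * C.seminormSq s ω z := by
  rw [dotProduct_flow, seminormSq_eq]
  exact C.sq_sum_intensity_mul_le hm ω _

lemma stochInt_eq (Z : ℝ≥0 → Ω → (Fin N → ℝ)) (t T : ℝ≥0) (ω : Ω) :
    C.stochInt Z t T ω
      = ∑ s ∈ (C.finite_jumps_Ioc t T ω).toFinset, Z s ω ⬝ᵥ (C.X s ω - C.left s ω)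
        - ∫ s in Set.Ioc t T, Z s ω ⬝ᵥ (C.A s *ᵥ C.left s ω) ∂lebesgue := by
  unfold stochInt
  congr 1
  · refine finsum_mem_eq_sum_of_inter_support_eq _ ?_
    ext s
    simp only [Set.mem_inter_iff, Set.Finite.coe_toFinset, Function.mem_support]
    constructor
    · rintro ⟨h1, h2⟩
      refine ⟨⟨fun h => h2 ?_, h1⟩, h2⟩
      rw [h, sub_self, dotProduct_zero]
    · rintro ⟨⟨-, h1⟩, h2⟩
      exact ⟨h1, h2⟩
  · refine integral_congr_ae (ae_restrict_of_ae ?_)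
    filter_upwards [C.ae_X_eq_left ω] with s hs
    rw [hs]

lemma sum_jumps_add {a b c : ℝ≥0} (hab : a ≤ b) (hbc : b ≤ c) (ω : Ω) (g : ℝ≥0 → ℝ) :
    ∑ s ∈ (C.finite_jumps_Ioc a b ω).toFinset, g s + ∑ s ∈ (C.finite_jumps_Ioc b c ω).toFinset, g s
      = ∑ s ∈ (C.finite_jumps_Ioc a c ω).toFinset, g s := by
  rw [← Finset.sum_union]
  · congr 1
    ext s
    simp only [Finset.mem_union, Set.Finite.mem_toFinset, Set.mem_inter_iff, Set.mem_Ioc]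
    constructor
    · rintro (⟨h1, h2, h3⟩ | ⟨h1, h2, h3⟩)
      · exact ⟨h1, h2, h3.trans hbc⟩
      · exact ⟨h1, hab.trans_lt h2, h3⟩
    · rintro ⟨h1, h2, h3⟩
      rcases le_or_gt s b with h | h
      · exact Or.inl ⟨h1, h2, h⟩
      · exact Or.inr ⟨h1, h, h3⟩
  · rw [Finset.disjoint_left]
    intro s hs hs'
    exact absurd ((Set.Finite.mem_toFinset _).1 hs).2.2
      (not_le.2 ((Set.Finite.mem_toFinset _).1 hs').2.1)

namespace IsDriver

variable {C} {T : ℝ≥0} {c' c'' m : ℝ} {f : ℝ≥0 → Ω → ℝ → (Fin N → ℝ) → ℝ}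

lemma measurable_comp (hf : C.IsDriver T c' c'' m f) {𝓜 : MeasurableSpace (ℝ≥0 × Ω)}
    (h𝓜 : C.filtration.predictable ≤ 𝓜) {W : ℝ≥0 × Ω → ℝ} {Z : ℝ≥0 × Ω → (Fin N → ℝ)}
    (hW : Measurable[𝓜] W) (hZ : Measurable[𝓜] Z) :
    Measurable[𝓜] fun p => f p.1 p.2 (W p) (Z p) := by
  have h1 : @Measurable _ _ 𝓜 (C.filtration.predictable.prod inferInstance)
      (fun p : ℝ≥0 × Ω => (p, (W p, Z p))) :=
    @Measurable.prodMk _ 𝓜 _ _ C.filtration.predictable _ _ _ (measurable_id'' h𝓜)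
      (@Measurable.prodMk _ 𝓜 _ _ _ _ _ _ hW hZ)
  exact hf.measurable.comp h1

end IsDriver

end MarkovChain

/-- The integral in time is a measurable function of ω only for the jointly measurable version, so
finiteness is transferred to F' and back. -/
lemma ae_lintegral_ne_top {Ω : Type*} [MeasurableSpace Ω] {P : Measure Ω} {T : ℝ≥0}
    {F : ℝ≥0 → Ω → ℝ≥0∞} {F' : ℝ≥0 × Ω → ℝ≥0∞} (hF' : Measurable F')
    (hFF : ∀ᵐ ω ∂P, ∀ s ∈ Set.Ioc 0 T, F s ω = F' (s, ω))
    (h : ∫⁻ ω, ∫⁻ s in Set.Icc 0 T, F s ω ∂lebesgue ∂P < ∞) :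
    ∀ᵐ ω ∂P, ∫⁻ s in Set.Ioc 0 T, F s ω ∂lebesgue ≠ ∞ := by
  have h1 : ∀ᵐ ω ∂P, ∫⁻ s in Set.Ioc 0 T, F s ω ∂lebesgue
      = ∫⁻ s in Set.Ioc 0 T, F' (s, ω) ∂lebesgue := by
    filter_upwards [hFF] with ω hω
    exact setLIntegral_congr_fun measurableSet_Ioc hω
  have h2 : Measurable fun ω => ∫⁻ s in Set.Ioc 0 T, F' (s, ω) ∂lebesgue :=
    (hF'.comp measurable_swap).lintegral_prod_right'
  rw [restrict_Icc_eq_restrict_Ioc, lintegral_congr_ae h1] at h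
  filter_upwards [ae_lt_top h2 h.ne, h1] with ω hω hω1
  rw [hω1]
  exact hω.ne

/-! ### The path of a single solution. -/

section Solution

variable {Ω : Type*} [mΩ : MeasurableSpace Ω] {P : Measure Ω} {N : ℕ} {C : MarkovChain P N}
  {T : ℝ≥0} {c' c'' m : ℝ} {f : ℝ≥0 → Ω → ℝ → (Fin N → ℝ) → ℝ} {φ G V K : ℝ≥0 → Ω → ℝ}
  {ξ : Ω → ℝ} {Z : ℝ≥0 → Ω → (Fin N → ℝ)}

lemma aestronglyMeasurable_of_eq {F : ℝ≥0 → ℝ} {F' : ℝ≥0 × Ω → ℝ} (hF' : Measurable F') {ω : Ω}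
    (h : ∀ s ∈ Set.Ioc 0 T, F s = F' (s, ω)) :
    AEStronglyMeasurable F (lebesgue.restrict (Set.Ioc 0 T)) := by
  refine (hF'.comp (measurable_prodMk_right (y := ω))).aestronglyMeasurable.congr ?_
  filter_upwards [ae_restrict_mem measurableSet_Ioc] with s hs
  exact (h s hs).symm

namespace MarkovChain

lemma InL2F.measurable (hV : C.InL2F T V) {t : ℝ≥0} (ht : t ≤ T) : Measurable (V t) :=
  (hV.adapted t ht).mono (C.filtration.le t) le_rfl

lemma InL2F.measurable_rightVersion (hV : C.InL2F T V) : Measurable (rightVersion T V) :=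
  MarkovRBSDE.measurable_rightVersion fun _ ht => hV.measurable ht

lemma InL2F.ae_eq (hV : C.InL2F T V) :
    ∀ᵐ ω ∂P, ∀ s ≤ T, rightVersion T V (s, ω) = V s ω := by
  filter_upwards [hV.rcll] with ω hω s hs using rightVersion_eq hω hs

lemma InL2F.ae_lintegral_ne_top (hV : C.InL2F T V) :
    ∀ᵐ ω ∂P, ∫⁻ s in Set.Ioc 0 T, ‖V s ω‖ₑ ^ 2 ∂lebesgue ≠ ∞ := by
  refine MarkovRBSDE.ae_lintegral_ne_top (hV.measurable_rightVersion.enorm.pow_const 2) ?_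
    hV.sq_integrable
  filter_upwards [hV.ae_eq] with ω hω s hs
  rw [hω s hs.2]

lemma InL2F.ae_integrableOn (hV : C.InL2F T V) :
    ∀ᵐ ω ∂P, IntegrableOn (fun s => V s ω) (Set.Ioc 0 T) lebesgue := by
  filter_upwards [hV.ae_lintegral_ne_top, hV.ae_eq] with ω h1 h3
  exact integrable_of_lintegral_sq (aestronglyMeasurable_of_eq (ω := ω) hV.measurable_rightVersion
    fun s hs => (h3 s hs.2).symm) h1

lemma InP2F.measurable_predictable (hZ : C.InP2F T Z) :
    Measurable[C.filtration.predictable] fun p : ℝ≥0 × Ω => Z p.1 p.2 :=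
  StronglyMeasurable.measurable hZ.predictable

lemma InP2F.measurable (hZ : C.InP2F T Z) : Measurable fun p : ℝ≥0 × Ω => Z p.1 p.2 :=
  hZ.measurable_predictable.mono predictable_le_prod le_rfl

lemma InP2F.ae_lintegral_ne_top (hZ : C.InP2F T Z) :
    ∀ᵐ ω ∂P, ∫⁻ s in Set.Ioc 0 T, ENNReal.ofReal (C.seminormSq s ω (Z s ω)) ∂lebesgue ≠ ∞ :=
  MarkovRBSDE.ae_lintegral_ne_top
    (C.measurable_seminormSq predictable_le_prod hZ.measurable).ennreal_ofReal
    (Eventually.of_forall fun _ _ _ => rfl) hZ.sq_integrable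

lemma IsPerturbation.measurable_predictable (hφ : C.IsPerturbation T φ) :
    Measurable[C.filtration.predictable] fun p : ℝ≥0 × Ω => φ p.1 p.2 :=
  StronglyMeasurable.measurable hφ.predictable

lemma IsPerturbation.measurable (hφ : C.IsPerturbation T φ) :
    Measurable fun p : ℝ≥0 × Ω => φ p.1 p.2 :=
  hφ.measurable_predictable.mono predictable_le_prod le_rfl

lemma IsPerturbation.ae_integrableOn (hφ : C.IsPerturbation T φ) :
    ∀ᵐ ω ∂P, IntegrableOn (fun s => φ s ω) (Set.Ioc 0 T) lebesgue := by
  filter_upwards [MarkovRBSDE.ae_lintegral_ne_top (hφ.measurable.enorm.pow_const 2)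
    (Eventually.of_forall fun _ _ _ => rfl) hφ.sq_integrable] with ω hω
  exact integrable_of_lintegral_sq
    (aestronglyMeasurable_of_eq (ω := ω) hφ.measurable fun _ _ => rfl) hω

lemma InP2F.ae_integrableOn_flow (hA : ∀ t ≤ T, matrixNorm (C.A t) ≤ m) (hZ : C.InP2F T Z) :
    ∀ᵐ ω ∂P, IntegrableOn (fun s => Z s ω ⬝ᵥ (C.A s *ᵥ C.left s ω)) (Set.Ioc 0 T) lebesgue := by
  filter_upwards [hZ.ae_lintegral_ne_top] with ω hω
  refine integrable_of_lintegral_sq (aestronglyMeasurable_of_eq (ω := ω)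
    (C.measurable_dotProduct_flow predictable_le_prod hZ.measurable) fun _ _ => rfl) ?_
  have h1 : ∫⁻ s in Set.Ioc 0 T, ‖Z s ω ⬝ᵥ (C.A s *ᵥ C.left s ω)‖ₑ ^ 2 ∂lebesgue
      ≤ ∫⁻ s in Set.Ioc 0 T, ENNReal.ofReal m * ENNReal.ofReal (C.seminormSq s ω (Z s ω))
        ∂lebesgue := by
    refine setLIntegral_mono' measurableSet_Ioc fun s hs => ?_
    rw [Real.enorm_eq_ofReal_abs, ← ENNReal.ofReal_pow (abs_nonneg _), sq_abs,
      ← ENNReal.ofReal_mul' (C.seminormSq_nonneg _ _ _)]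
    exact ENNReal.ofReal_le_ofReal (C.dotProduct_flow_sq_le (hA s hs.2) ω _)
  refine ne_top_of_le_ne_top ?_ h1
  rw [lintegral_const_mul' _ _ ENNReal.ofReal_ne_top]
  exact ENNReal.mul_ne_top ENNReal.ofReal_ne_top hω

lemma IsDriver.ae_integrableOn (hf : C.IsDriver T c' c'' m f) (hV : C.InL2F T V)
    (hZ : C.InP2F T Z) :
    ∀ᵐ ω ∂P, IntegrableOn (fun s => f s ω (V s ω) (Z s ω)) (Set.Ioc 0 T) lebesgue := by
  have hm0 : Measurable fun p : ℝ≥0 × Ω => f p.1 p.2 0 0 :=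
    hf.measurable_comp predictable_le_prod measurable_const measurable_const
  filter_upwards [hV.ae_integrableOn, hZ.ae_lintegral_ne_top, hV.ae_eq, hf.lipschitz,
    MarkovRBSDE.ae_lintegral_ne_top (hm0.enorm.pow_const 2)
      (Eventually.of_forall fun _ _ _ => rfl) hf.sq_integrable] with ω hVi h2 h3 h4 h5
  have h0i : IntegrableOn (fun s => f s ω 0 0) (Set.Ioc 0 T) lebesgue :=
    integrable_of_lintegral_sq (aestronglyMeasurable_of_eq (ω := ω) hm0 fun _ _ => rfl) h5
  have hZi : IntegrableOn (fun s => C.seminorm s ω (Z s ω)) (Set.Ioc 0 T) lebesgue := by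
    refine integrable_of_lintegral_sq (aestronglyMeasurable_of_eq (ω := ω)
      (C.measurable_seminormSq predictable_le_prod hZ.measurable).sqrt fun _ _ => rfl) ?_
    convert h2 using 3 with s
    rw [Real.enorm_eq_ofReal_abs, ← ENNReal.ofReal_pow (abs_nonneg _), sq_abs, seminorm,
      Real.sq_sqrt (C.seminormSq_nonneg _ _ _)]
  have hbound : IntegrableOn (fun s => |f s ω 0 0| + (c' * |V s ω| + c'' * C.seminorm s ω (Z s ω)))
      (Set.Ioc 0 T) lebesgue := h0i.abs.add ((hVi.abs.const_mul c').add (hZi.const_mul c''))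
  refine hbound.mono' (aestronglyMeasurable_of_eq (ω := ω) (hf.measurable_comp predictable_le_prod
    hV.measurable_rightVersion hZ.measurable) fun s hs => by rw [h3 s hs.2]) ?_
  filter_upwards [ae_restrict_mem measurableSet_Ioc] with s hs
  have h6 := h4 s hs.2 (V s ω) 0 (Z s ω) 0
  rw [sub_zero, sub_zero] at h6
  have h7 := abs_sub_abs_le_abs_sub (f s ω (V s ω) (Z s ω)) (f s ω 0 0)
  rw [Real.norm_eq_abs]
  linarith

/-- The drift of a solution between the jumps of the chain. -/
noncomputable def drift (C : MarkovChain P N) (f : ℝ≥0 → Ω → ℝ → (Fin N → ℝ) → ℝ)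
    (V : ℝ≥0 → Ω → ℝ) (Z : ℝ≥0 → Ω → (Fin N → ℝ)) (s : ℝ≥0) (ω : Ω) : ℝ :=
  f s ω (V s ω) (Z s ω) + Z s ω ⬝ᵥ (C.A s *ᵥ C.left s ω)

/-- The left limit at `s` of a process that jumps with the integral of `Z`. -/
noncomputable def beforeJump (C : MarkovChain P N) (V : ℝ≥0 → Ω → ℝ) (Z : ℝ≥0 → Ω → (Fin N → ℝ))
    (s : ℝ≥0) (ω : Ω) : ℝ := V s ω - Z s ω ⬝ᵥ (C.X s ω - C.left s ω)

end MarkovChain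

namespace IsRBSDESolution

/-- Subtract the equation at two times. The compensator part of the stochastic integral is moved
into the drift, so that the remaining sum contains only the jumps. -/
lemma ae_sub_eq (hA : ∀ t ≤ T, matrixNorm (C.A t) ≤ m) (hf : C.IsDriver T c' c'' m f)
    (hφ : C.IsPerturbation T φ)
    (h : IsRBSDESolution C T (fun s ω v z => f s ω v z + φ s ω) ξ G V Z K) :
    ∀ᵐ ω ∂P, ∀ a b, a ≤ b → b ≤ T → V a ω - V b ω
      = ∫ s in Set.Ioc a b, (C.drift f V Z s ω + φ s ω) ∂lebesgue + (K b ω - K a ω)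
        - ∑ s ∈ (C.finite_jumps_Ioc a b ω).toFinset, Z s ω ⬝ᵥ (C.X s ω - C.left s ω) := by
  filter_upwards [h.equation, hf.ae_integrableOn h.memV h.memZ, h.memZ.ae_integrableOn_flow hA,
    hφ.ae_integrableOn] with ω heq hfi hZi hφi a b hab hbT
  have hsub : Set.Ioc a T ⊆ Set.Ioc 0 T := Set.Ioc_subset_Ioc_left zero_le
  have hsub' : Set.Ioc a b ⊆ Set.Ioc 0 T := Set.Ioc_subset_Ioc zero_le hbT
  have hgi : IntegrableOn (fun s => f s ω (V s ω) (Z s ω) + φ s ω) (Set.Ioc 0 T) lebesgue :=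
    hfi.add hφi
  have e1 := heq a (hab.trans hbT)
  have e2 := heq b hbT
  rw [C.stochInt_eq] at e1 e2
  rw [← setIntegral_Ioc_add hab hbT (hgi.mono_set hsub),
    ← setIntegral_Ioc_add hab hbT (hZi.mono_set hsub), ← C.sum_jumps_add hab hbT] at e1
  have e3 : ∫ s in Set.Ioc a b, (C.drift f V Z s ω + φ s ω) ∂lebesgue
      = ∫ s in Set.Ioc a b, (f s ω (V s ω) (Z s ω) + φ s ω) ∂lebesgue
        + ∫ s in Set.Ioc a b, Z s ω ⬝ᵥ (C.A s *ᵥ C.left s ω) ∂lebesgue := by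
    rw [← integral_add (hgi.mono_set hsub') (hZi.mono_set hsub')]
    refine integral_congr_ae (Eventually.of_forall fun s => ?_)
    simp only [MarkovChain.drift]
    ring
  rw [e3]
  linarith

/-- If (a, b) contains no jump, only a jump at b itself can contribute to the sum, and it is exactly
the difference between V_b and `beforeJump` at b. -/
lemma ae_isReflectedPath (hA : ∀ t ≤ T, matrixNorm (C.A t) ≤ m) (hf : C.IsDriver T c' c'' m f)
    (hφ : C.IsPerturbation T φ)
    (h : IsRBSDESolution C T (fun s ω v z => f s ω v z + φ s ω) ξ G V Z K) :
    ∀ᵐ ω ∂P, IsReflectedPath (C.jumps ω) T (fun s => V s ω) (fun s => C.beforeJump V Z s ω)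
      (fun s => C.drift f V Z s ω + φ s ω) (fun s => K s ω) 0 := by
  filter_upwards [h.ae_sub_eq hA hf hφ, hf.ae_integrableOn h.memV h.memZ,
    h.memZ.ae_integrableOn_flow hA, hφ.ae_integrableOn, h.increasing, h.continuous]
    with ω heq hfi hZi hφi hinc hcont
  have hleft : ∀ s, s ∉ C.jumps ω → C.X s ω = C.left s ω := fun s hs => by
    by_contra hne
    exact hs hne
  refine ⟨C.finite_jumps T ω, fun s _ hs => ?_, fun a b hab hbT hJ => ?_, (hfi.add hZi).add hφi,
    hinc, monotoneOn_const, hcont, continuousOn_const⟩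
  · simp [MarkovChain.beforeJump, hleft s hs]
  · have e := heq a b hab.le hbT
    have hsum : ∑ s ∈ (C.finite_jumps_Ioc a b ω).toFinset, Z s ω ⬝ᵥ (C.X s ω - C.left s ω)
        = Z b ω ⬝ᵥ (C.X b ω - C.left b ω) := by
      refine Finset.sum_eq_single b (fun s hs hsb => ?_) (fun hb => ?_)
      · have hs' := (Set.Finite.mem_toFinset _).1 hs
        exact absurd hs'.1 (hJ s ⟨hs'.2.1, lt_of_le_of_ne hs'.2.2 hsb⟩)
      · have hbJ : b ∉ C.jumps ω := fun hb' => hb ((Set.Finite.mem_toFinset _).2 ⟨hb', hab, le_rfl⟩)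
        rw [hleft b hbJ, sub_self, dotProduct_zero]
    rw [hsum] at e
    simp only [MarkovChain.beforeJump, Pi.zero_apply, sub_zero]
    linarith

end IsRBSDESolution

end Solution

/-! ### Differences of reflected paths and removal of a perturbation. -/

namespace IsReflectedPath

variable {J : Set ℝ≥0} {T : ℝ≥0} {y yl d K₁ K₂ : ℝ≥0 → ℝ}

lemma sub {y' yl' d' : ℝ≥0 → ℝ} (h : IsReflectedPath J T y yl d K₁ 0)
    (h' : IsReflectedPath J T y' yl' d' K₂ 0) :
    IsReflectedPath J T (fun s => y s - y' s) (fun s => yl s - yl' s) (fun s => d s - d' s) K₁ K₂ where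
  finite := h.finite
  left_eq s hs hsJ := by rw [h.left_eq s hs hsJ, h'.left_eq s hs hsJ]
  segment a b hab hbT hJ := by
    have hsub : Set.Ioc a b ⊆ Set.Ioc 0 T := Set.Ioc_subset_Ioc zero_le hbT
    have e := h.segment a b hab hbT hJ
    have e' := h'.segment a b hab hbT hJ
    rw [integral_sub (h.integrable.mono_set hsub) (h'.integrable.mono_set hsub)]
    simp only [Pi.zero_apply, sub_zero] at e e'
    linarith
  integrable := h.integrable.sub h'.integrable
  mono₁ := h.mono₁
  mono₂ := h'.mono₁
  cont₁ := h.cont₁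
  cont₂ := h'.cont₁

/-- Carrying φ in the path instead of the drift keeps it out of Gronwall's inequality: it then
enters through ∫|φ|, whose square appears in the final bound. -/
lemma add_integral {φ : ℝ≥0 → ℝ} (h : IsReflectedPath J T y yl (fun s => d s + φ s) K₁ K₂)
    (hφ : IntegrableOn φ (Set.Ioc 0 T) lebesgue) :
    IsReflectedPath J T (fun s => y s + ∫ u in Set.Ioc 0 s, φ u ∂lebesgue)
      (fun s => yl s + ∫ u in Set.Ioc 0 s, φ u ∂lebesgue) d K₁ K₂ := by
  have hd : IntegrableOn d (Set.Ioc 0 T) lebesgue := by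
    refine (h.integrable.sub hφ).congr (Eventually.of_forall fun s => ?_)
    simp
  refine ⟨h.finite, fun s hs hsJ => by rw [h.left_eq s hs hsJ], fun a b hab hbT hJ => ?_, hd,
    h.mono₁, h.mono₂, h.cont₁, h.cont₂⟩
  have hsub : Set.Ioc a b ⊆ Set.Ioc 0 T := Set.Ioc_subset_Ioc zero_le hbT
  have e := h.segment a b hab hbT hJ
  rw [integral_add (hd.mono_set hsub) (hφ.mono_set hsub)] at e
  have e2 := setIntegral_Ioc_add (zero_le (a := a)) hab.le
    (hφ.mono_set (Set.Ioc_subset_Ioc_right hbT))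
  linarith

lemma congr {y' yl' K₁' K₂' : ℝ≥0 → ℝ} (h : IsReflectedPath J T y yl d K₁ K₂)
    (hy : ∀ s ≤ T, y' s = y s) (hyl : ∀ s ≤ T, yl' s = yl s) (hK₁ : ∀ s ≤ T, K₁' s = K₁ s)
    (hK₂ : ∀ s ≤ T, K₂' s = K₂ s) : IsReflectedPath J T y' yl' d K₁' K₂' where
  finite := h.finite
  left_eq s hs hsJ := by rw [hy s hs, hyl s hs, h.left_eq s hs hsJ]
  segment a b hab hbT hJ := by
    have haT := hab.le.trans hbT
    rw [hy a haT, hyl b hbT, hK₁ a haT, hK₁ b hbT, hK₂ a haT, hK₂ b hbT]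
    exact h.segment a b hab hbT hJ
  integrable := h.integrable
  mono₁ := h.mono₁.congr fun s hs => (hK₁ s hs.2).symm
  mono₂ := h.mono₂.congr fun s hs => (hK₂ s hs.2).symm
  cont₁ := h.cont₁.congr fun s hs => hK₁ s hs.2
  cont₂ := h.cont₂.congr fun s hs => hK₂ s hs.2

end IsReflectedPath

/-! ### Adapted versions of the push and of its level. -/

section Predictable

variable {Ω : Type*} {mΩ : MeasurableSpace Ω} {𝓕 : Filtration ℝ≥0 mΩ}

/-- The integral over `(0, t]` of a process, defined from its positive and negative parts. -/
noncomputable def partsIntegral (κ : Ω → Measure ℝ≥0) (H : ℝ≥0 × Ω → ℝ) (t : ℝ≥0) (ω : Ω) : ℝ :=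
  (∫⁻ s in Set.Ioc 0 t, ENNReal.ofReal (H (s, ω)) ∂(κ ω)).toReal
    - (∫⁻ s in Set.Ioc 0 t, ENNReal.ofReal (-H (s, ω)) ∂(κ ω)).toReal

/-- The two parts are separately measurable, so no integrability is needed; an infinite part counts
as 0. -/
lemma measurable_partsIntegral {κ : Ω → Measure ℝ≥0} {t : ℝ≥0}
    (hκ : Measurable[𝓕 t] fun ω => (κ ω).restrict (Set.Ioc 0 t))
    (hfin : ∀ ω, IsFiniteMeasure ((κ ω).restrict (Set.Ioc 0 t))) {H : ℝ≥0 × Ω → ℝ}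
    (hH : Measurable[𝓕.predictable] H) : Measurable[𝓕 t] (partsIntegral κ H t) :=
  (measurable_setLIntegral_of_predictable hκ hfin hH.ennreal_ofReal).ennreal_toReal.sub
    (measurable_setLIntegral_of_predictable hκ hfin hH.neg.ennreal_ofReal).ennreal_toReal

lemma partsIntegral_eq {κ : Ω → Measure ℝ≥0} {H : ℝ≥0 × Ω → ℝ} {g : ℝ≥0 → ℝ} {t : ℝ≥0} {ω : Ω}
    (hg : IntegrableOn g (Set.Ioc 0 t) (κ ω))
    (hH : ∀ᵐ s ∂(κ ω), s ∈ Set.Ioc 0 t → H (s, ω) = g s) :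
    partsIntegral κ H t ω = ∫ s in Set.Ioc 0 t, g s ∂(κ ω) := by
  have h1 : (fun s => H (s, ω)) =ᵐ[(κ ω).restrict (Set.Ioc 0 t)] g :=
    (ae_restrict_iff' measurableSet_Ioc).2 hH
  rw [← integral_congr_ae h1,
    integral_eq_lintegral_pos_part_sub_lintegral_neg_part (hg.congr h1.symm)]
  rfl

lemma measurable_ite_lt {r : ℝ≥0} {b : Ω → ℝ≥0∞} (hb : Measurable[𝓕 r] b) :
    Measurable[𝓕.predictable] fun p : ℝ≥0 × Ω => if r < p.1 then b p.2 else 0 := by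
  refine @measurable_of_Ioi _ _ _ _ _ 𝓕.predictable _ _ _ _ fun x => ?_
  have : (fun p : ℝ≥0 × Ω => if r < p.1 then b p.2 else 0) ⁻¹' Set.Ioi x
      = Set.Ioi r ×ˢ (b ⁻¹' Set.Ioi x) := by
    ext p
    by_cases h : r < p.1 <;> simp [h]
  rw [this]
  exact measurableSet_predictable_Ioi_prod (hb measurableSet_Ioi)

/-- For dense times r < q, the contribution of [r, q] is known at time q and switched on strictly
after q, hence predictable. The strict inequality in the definition of the level and its restriction
to a countable set of times serve this purpose. -/
lemma measurable_pushLevel {T : ℝ≥0} {K y : ℝ≥0 → Ω → ℝ}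
    (hK : ∀ t ≤ T, Measurable[𝓕 t] (K t)) (hy : ∀ t ≤ T, Measurable[𝓕 t] (y t)) :
    Measurable[𝓕.predictable] fun p : ℝ≥0 × Ω =>
      pushLevel (fun t => K t p.2) (fun t => y t p.2) (min p.1 T) := by
  unfold pushLevel
  refine Measurable.iSup fun m => Measurable.iSup fun n => ?_
  set r := TopologicalSpace.denseSeq ℝ≥0 m
  set q := TopologicalSpace.denseSeq ℝ≥0 n
  by_cases hrq : r < q
  · by_cases hqT : q < T
    · have hmeas : Measurable[𝓕 q] fun ω => if K r ω < K q ω then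
          ⨅ (l : ℕ) (_ : TopologicalSpace.denseSeq ℝ≥0 l ∈ Set.Icc r q),
            ENNReal.ofReal (y (TopologicalSpace.denseSeq ℝ≥0 l) ω) else 0 := by
        refine Measurable.ite (measurableSet_lt
          ((hK r (hrq.trans hqT).le).mono (𝓕.mono hrq.le) le_rfl) (hK q hqT.le)) ?_ measurable_const
        refine Measurable.iInf fun l => ?_
        by_cases hl : TopologicalSpace.denseSeq ℝ≥0 l ∈ Set.Icc r q
        · simp only [hl, iInf_pos]
          exact ((hy _ (hl.2.trans hqT.le)).mono (𝓕.mono hl.2) le_rfl).ennreal_ofReal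
        · simp only [hl, iInf_neg, not_false_eq_true]
          exact measurable_const
      convert measurable_ite_lt hmeas using 2 with p
      simp only [hrq, iSup_pos, lt_min_iff, hqT, and_true, iSup_eq_if, ENNReal.bot_eq_zero]
    · have : ∀ p : ℝ≥0 × Ω, ¬ q < min p.1 T := fun p h => hqT (h.trans_le (min_le_right _ _))
      simp only [this, iSup_neg, not_false_eq_true, iSup_bot]
      exact measurable_const
  · simp only [hrq, iSup_neg, not_false_eq_true]
    exact measurable_const

end Predictable

/-- The predictable version of the left limits of a process on `[0, T]`. -/
noncomputable def stoppedLeft {Ω : Type*} (T : ℝ≥0) (V : ℝ≥0 → Ω → ℝ) : ℝ≥0 × Ω → ℝ :=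
  leftVersion fun t => V (min t T)

lemma stoppedLeft_eq {Ω : Type*} {T : ℝ≥0} {V : ℝ≥0 → Ω → ℝ} {s : ℝ≥0} (hs : 0 < s) (hsT : s ≤ T) {ω : Ω} {x : ℝ}
    (h : Tendsto (fun t => V t ω) (𝓝[<] s) (𝓝 x)) : stoppedLeft T V (s, ω) = x := by
  refine leftVersion_eq hs (h.congr' ?_)
  filter_upwards [self_mem_nhdsWithin] with u hu
  rw [min_eq_left ((le_of_lt hu).trans hsT)]

lemma stoppedLeft_zero {Ω : Type*} (T : ℝ≥0) (V : ℝ≥0 → Ω → ℝ) (ω : Ω) :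
    stoppedLeft T V (0, ω) = V 0 ω := by
  rw [stoppedLeft, leftVersion_zero, min_eq_left zero_le]

section Solution

variable {Ω : Type*} [mΩ : MeasurableSpace Ω] {P : Measure Ω} {N : ℕ} {C : MarkovChain P N}
  {T : ℝ≥0} {c' c'' m : ℝ} {f : ℝ≥0 → Ω → ℝ → (Fin N → ℝ) → ℝ} {φ G V K : ℝ≥0 → Ω → ℝ}
  {ξ : Ω → ℝ} {Z : ℝ≥0 → Ω → (Fin N → ℝ)}

namespace MarkovChain

lemma measurable_stoppedLeft {Y : ℝ≥0 → Ω → ℝ} (hY : ∀ t ≤ T, Measurable[C.filtration t] (Y t)) :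
    Measurable[C.filtration.predictable] (stoppedLeft T Y) :=
  measurable_leftVersion fun _ => (hY _ (min_le_right _ _)).mono
    (C.filtration.mono (min_le_left _ _)) le_rfl

lemma measurable_partsIntegral_lebesgue {H : ℝ≥0 × Ω → ℝ}
    (hH : Measurable[C.filtration.predictable] H) (t : ℝ≥0) :
    Measurable[C.filtration t] (partsIntegral (fun _ => lebesgue) H t) :=
  measurable_partsIntegral measurable_const (fun _ => inferInstance) hH

lemma partsIntegral_entryMeasure (j : Fin N) (H : ℝ≥0 × Ω → ℝ) (t : ℝ≥0) (ω : Ω) :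
    partsIntegral (C.entryMeasure j) H t ω
      = ∑ s ∈ (C.finite_entries_Ioc j 0 t ω).toFinset, H (s, ω) := by
  unfold partsIntegral
  rw [C.setLIntegral_entryMeasure, C.setLIntegral_entryMeasure,
    ENNReal.toReal_sum (fun _ _ => ENNReal.ofReal_ne_top),
    ENNReal.toReal_sum (fun _ _ => ENNReal.ofReal_ne_top), ← Finset.sum_sub_distrib]
  refine Finset.sum_congr rfl fun s _ => ?_
  rw [ENNReal.toReal_ofReal', ENNReal.toReal_ofReal']
  exact max_zero_sub_max_neg_zero_eq_self _

lemma dotProduct_jump {j : Fin N} {s : ℝ≥0} {ω : Ω} (hs : s ∈ C.entries j ω) (z : Fin N → ℝ) :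
    z ⬝ᵥ (C.X s ω - C.left s ω) = C.increment j s ω z := by
  rw [dotProduct_sub, C.eq_single_of_X_apply hs.2, increment]
  simp

/-- The process `K` of a solution, expressed by `V` and `Z`. -/
noncomputable def push (C : MarkovChain P N) (T : ℝ≥0) (f : ℝ≥0 → Ω → ℝ → (Fin N → ℝ) → ℝ)
    (φ V : ℝ≥0 → Ω → ℝ) (Z : ℝ≥0 → Ω → (Fin N → ℝ)) (t : ℝ≥0) (ω : Ω) : ℝ :=
  V 0 ω - V t ω
    - partsIntegral (fun _ => lebesgue) (fun p => C.drift f (fun s ω => stoppedLeft T V (s, ω)) Z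
        p.1 p.2 + φ p.1 p.2) t ω
    + ∑ j, partsIntegral (C.entryMeasure j) (fun p => C.increment j p.1 p.2 (Z p.1 p.2)) t ω

/-- Adaptedness of K is not assumed, only measurability of its terminal value. The equation, solved
for K, gives an adapted expression; the driver is evaluated at the left limits of V because these
are predictable, which changes the time integral by nothing. -/
lemma measurable_push (hf : C.IsDriver T c' c'' m f) (hφ : C.IsPerturbation T φ)
    (hV : C.InL2F T V) (hZ : C.InP2F T Z) {t : ℝ≥0} (ht : t ≤ T) :
    Measurable[C.filtration t] (C.push T f φ V Z t) := by
  unfold push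
  refine (((hV.adapted 0 zero_le).mono (C.filtration.mono zero_le) le_rfl).sub
    (hV.adapted t ht)).sub ?_ |>.add ?_
  · refine C.measurable_partsIntegral_lebesgue ?_ t
    exact ((hf.measurable_comp le_rfl (measurable_stoppedLeft hV.adapted)
      hZ.measurable_predictable).add
        (C.measurable_dotProduct_flow le_rfl hZ.measurable_predictable)).add
      hφ.measurable_predictable
  · exact Finset.measurable_sum _ fun j _ => measurable_partsIntegral
      (C.measurable_entryMeasure le_rfl j) (fun _ => inferInstance)
      (C.measurable_increment le_rfl hZ.measurable_predictable j)

end MarkovChain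

namespace IsRBSDESolution

lemma ae_stoppedLeft_eq (hA : ∀ t ≤ T, matrixNorm (C.A t) ≤ m) (hf : C.IsDriver T c' c'' m f)
    (hφ : C.IsPerturbation T φ)
    (h : IsRBSDESolution C T (fun s ω v z => f s ω v z + φ s ω) ξ G V Z K) :
    ∀ᵐ ω ∂P, ∀ s ∈ Set.Ioc 0 T, stoppedLeft T V (s, ω) = C.beforeJump V Z s ω := by
  filter_upwards [h.ae_isReflectedPath hA hf hφ] with ω hω s hs
  exact stoppedLeft_eq hs.1 hs.2 (hω.tendsto_left hs.1 hs.2)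

lemma ae_push_eq (hA : ∀ t ≤ T, matrixNorm (C.A t) ≤ m) (hf : C.IsDriver T c' c'' m f)
    (hφ : C.IsPerturbation T φ)
    (h : IsRBSDESolution C T (fun s ω v z => f s ω v z + φ s ω) ξ G V Z K) :
    ∀ᵐ ω ∂P, ∀ t ≤ T, C.push T f φ V Z t ω = K t ω := by
  filter_upwards [h.ae_isReflectedPath hA hf hφ, h.ae_sub_eq hA hf hφ,
    h.ae_stoppedLeft_eq hA hf hφ, h.zero] with ω hω heq hleft h0 t ht
  have e := heq 0 t zero_le ht
  rw [C.sum_jumps_eq] at e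
  unfold MarkovChain.push
  rw [partsIntegral_eq (κ := fun _ => lebesgue) (hω.integrable.mono_set (Set.Ioc_subset_Ioc_right ht))]
  · simp_rw [C.partsIntegral_entryMeasure]
    have e2 : ∀ j, ∑ s ∈ (C.finite_entries_Ioc j 0 t ω).toFinset, Z s ω ⬝ᵥ (C.X s ω - C.left s ω)
        = ∑ s ∈ (C.finite_entries_Ioc j 0 t ω).toFinset, C.increment j s ω (Z s ω) := fun j =>
      Finset.sum_congr rfl fun s hs =>
        C.dotProduct_jump ((Set.Finite.mem_toFinset _).1 hs).1 _
    simp_rw [e2] at e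
    rw [h0] at e
    linarith
  · filter_upwards [C.ae_notMem_jumps ω] with s hs hsI
    have hs' : s ∈ Set.Ioc 0 T := ⟨hsI.1, hsI.2.trans ht⟩
    simp only [MarkovChain.drift]
    rw [hleft s hs', hω.left_eq s hs'.2 hs]

end IsRBSDESolution

end Solution

/-- Two solutions of reflected equations with the same driver, up to perturbations. -/
structure SolutionPair {Ω : Type*} [mΩ : MeasurableSpace Ω] {P : Measure Ω} {N : ℕ}
    (C : MarkovChain P N) (T : ℝ≥0) (c' c'' m : ℝ) where
  /-- The common driver. -/
  f : ℝ≥0 → Ω → ℝ → (Fin N → ℝ) → ℝ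
  /-- The first terminal value. -/
  ξ₁ : Ω → ℝ
  /-- The second terminal value. -/
  ξ₂ : Ω → ℝ
  /-- The first perturbation. -/
  φ₁ : ℝ≥0 → Ω → ℝ
  /-- The second perturbation. -/
  φ₂ : ℝ≥0 → Ω → ℝ
  /-- The first obstacle. -/
  G₁ : ℝ≥0 → Ω → ℝ
  /-- The second obstacle. -/
  G₂ : ℝ≥0 → Ω → ℝ
  /-- The value of the first solution. -/
  V₁ : ℝ≥0 → Ω → ℝ
  /-- The value of the second solution. -/
  V₂ : ℝ≥0 → Ω → ℝ
  /-- The integrand of the first solution. -/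
  Z₁ : ℝ≥0 → Ω → (Fin N → ℝ)
  /-- The integrand of the second solution. -/
  Z₂ : ℝ≥0 → Ω → (Fin N → ℝ)
  /-- The push of the first solution. -/
  K₁ : ℝ≥0 → Ω → ℝ
  /-- The push of the second solution. -/
  K₂ : ℝ≥0 → Ω → ℝ
  lip_nonneg : 0 ≤ c'
  lip_nonneg' : 0 ≤ c''
  rate_pos : 0 < m
  rate_le : ∀ t ≤ T, matrixNorm (C.A t) ≤ m
  driver : C.IsDriver T c' c'' m f
  terminal₁ : C.InL2 T ξ₁
  terminal₂ : C.InL2 T ξ₂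
  pert₁ : C.IsPerturbation T φ₁
  pert₂ : C.IsPerturbation T φ₂
  obst₁ : C.IsObstacle T G₁
  obst₂ : C.IsObstacle T G₂
  sol₁ : IsRBSDESolution C T (fun s ω v z => f s ω v z + φ₁ s ω) ξ₁ G₁ V₁ Z₁ K₁
  sol₂ : IsRBSDESolution C T (fun s ω v z => f s ω v z + φ₂ s ω) ξ₂ G₂ V₂ Z₂ K₂

/-! ### The gap of two solutions, its jumps and its drift. -/

namespace SolutionPair

variable {Ω : Type*} [mΩ : MeasurableSpace Ω] {P : Measure Ω} {N : ℕ}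
  {c' c'' m : ℝ} {C : MarkovChain P N} {T : ℝ≥0}

/-- The pair in the other order. -/
def swap (D : SolutionPair C T c' c'' m) : SolutionPair C T c' c'' m where
  f := D.f
  ξ₁ := D.ξ₂
  ξ₂ := D.ξ₁
  φ₁ := D.φ₂
  φ₂ := D.φ₁
  G₁ := D.G₂
  G₂ := D.G₁
  V₁ := D.V₂
  V₂ := D.V₁
  Z₁ := D.Z₂
  Z₂ := D.Z₁
  K₁ := D.K₂
  K₂ := D.K₁
  lip_nonneg := D.lip_nonneg
  lip_nonneg' := D.lip_nonneg'
  rate_pos := D.rate_pos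
  rate_le := D.rate_le
  driver := D.driver
  terminal₁ := D.terminal₂
  terminal₂ := D.terminal₁
  pert₁ := D.pert₂
  pert₂ := D.pert₁
  obst₁ := D.obst₂
  obst₂ := D.obst₁
  sol₁ := D.sol₂
  sol₂ := D.sol₁

variable (D : SolutionPair C T c' c'' m)

lemma ae_integrableOn_pert :
    ∀ᵐ ω ∂P, IntegrableOn (fun s => D.φ₁ s ω - D.φ₂ s ω) (Set.Ioc 0 T) lebesgue := by
  filter_upwards [D.pert₁.ae_integrableOn, D.pert₂.ae_integrableOn] with ω h1 h2
  exact h1.sub h2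

/-- The integral of the difference of the perturbations. -/
noncomputable def pertInt : ℝ≥0 → Ω → ℝ :=
  partsIntegral (fun _ => lebesgue) fun p => D.φ₁ p.1 p.2 - D.φ₂ p.1 p.2

/-- The total variation of the integrated difference of the perturbations. -/
noncomputable def pertVar (ω : Ω) : ℝ≥0∞ :=
  ∫⁻ s in Set.Ioc 0 T, ‖D.φ₁ s ω - D.φ₂ s ω‖ₑ ∂lebesgue

/-- The difference of the values, without the contribution of the perturbations. -/
noncomputable def gap (t : ℝ≥0) (ω : Ω) : ℝ := D.V₁ t ω - D.V₂ t ω + D.pertInt t ω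

/-- The left limits of the gap. -/
noncomputable def gapLeft : ℝ≥0 × Ω → ℝ := stoppedLeft T D.gap

/-- The left limits of the difference of the values. -/
noncomputable def valueLeft (p : ℝ≥0 × Ω) : ℝ := stoppedLeft T D.V₁ p - stoppedLeft T D.V₂ p

/-- The difference of the integrands. -/
noncomputable def diffZ (p : ℝ≥0 × Ω) : Fin N → ℝ := D.Z₁ p.1 p.2 - D.Z₂ p.1 p.2

/-- The jump of the gap when the chain enters the state `j`. -/
noncomputable def jump (j : Fin N) (p : ℝ≥0 × Ω) : ℝ := C.increment j p.1 p.2 (D.diffZ p)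

/-- The adapted version of the first push. -/
noncomputable def push₁ : ℝ≥0 → Ω → ℝ := C.push T D.f D.φ₁ D.V₁ D.Z₁

/-- The highest level at which the first push has acted on the gap. -/
noncomputable def level (p : ℝ≥0 × Ω) : ℝ≥0∞ :=
  pushLevel (fun t => D.push₁ t p.2) (fun t => D.gap t p.2) (min p.1 T)

/-- The positive part of the gap, kept above the level. -/
noncomputable def upper (t : ℝ≥0) (ω : Ω) : ℝ≥0∞ :=
  max (ENNReal.ofReal (D.gap t ω)) (D.level (t, ω))

/-- The left limits of `upper`. -/
noncomputable def upperLeft (p : ℝ≥0 × Ω) : ℝ≥0∞ := max (ENNReal.ofReal (D.gapLeft p)) (D.level p)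

/-- The value of `upper` after an entry of the chain into `j`. -/
noncomputable def upperJump (j : Fin N) (p : ℝ≥0 × Ω) : ℝ≥0∞ :=
  max (ENNReal.ofReal (D.gapLeft p + D.jump j p)) (D.level p)

/-- The difference of the drifts. -/
noncomputable def diffDrift (s : ℝ≥0) (ω : Ω) : ℝ :=
  C.drift D.f D.V₁ D.Z₁ s ω - C.drift D.f D.V₂ D.Z₂ s ω

lemma measurable_pertInt (t : ℝ≥0) : Measurable[C.filtration t] (D.pertInt t) :=
  C.measurable_partsIntegral_lebesgue
    (D.pert₁.measurable_predictable.sub D.pert₂.measurable_predictable) t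

lemma measurable_gap {t : ℝ≥0} (ht : t ≤ T) : Measurable[C.filtration t] (D.gap t) :=
  ((D.sol₁.memV.adapted t ht).sub (D.sol₂.memV.adapted t ht)).add (D.measurable_pertInt t)

lemma measurable_gapLeft : Measurable[C.filtration.predictable] D.gapLeft :=
  MarkovChain.measurable_stoppedLeft fun _ ht => D.measurable_gap ht

lemma measurable_valueLeft : Measurable[C.filtration.predictable] D.valueLeft :=
  (MarkovChain.measurable_stoppedLeft D.sol₁.memV.adapted).sub
    (MarkovChain.measurable_stoppedLeft D.sol₂.memV.adapted)

lemma measurable_diffZ : Measurable[C.filtration.predictable] D.diffZ :=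
  D.sol₁.memZ.measurable_predictable.sub D.sol₂.memZ.measurable_predictable

lemma measurable_jump (j : Fin N) : Measurable[C.filtration.predictable] (D.jump j) :=
  C.measurable_increment le_rfl D.measurable_diffZ j

lemma measurable_level : Measurable[C.filtration.predictable] D.level :=
  measurable_pushLevel
    (fun _ ht => MarkovChain.measurable_push D.driver D.pert₁ D.sol₁.memV D.sol₁.memZ ht)
    (fun _ ht => D.measurable_gap ht)

lemma measurable_upperLeft : Measurable[C.filtration.predictable] D.upperLeft :=
  D.measurable_gapLeft.ennreal_ofReal.max D.measurable_level

lemma measurable_upperJump (j : Fin N) : Measurable[C.filtration.predictable] (D.upperJump j) :=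
  (D.measurable_gapLeft.add (D.measurable_jump j)).ennreal_ofReal.max D.measurable_level

lemma ae_pertInt_eq : ∀ᵐ ω ∂P, ∀ t ≤ T,
    D.pertInt t ω = ∫ s in Set.Ioc 0 t, (D.φ₁ s ω - D.φ₂ s ω) ∂lebesgue := by
  filter_upwards [D.ae_integrableOn_pert] with ω h t ht
  exact partsIntegral_eq (κ := fun _ => lebesgue) (h.mono_set (Set.Ioc_subset_Ioc_right ht))
    (Eventually.of_forall fun _ _ => rfl)

lemma ae_enorm_pertInt_le : ∀ᵐ ω ∂P, ∀ t ≤ T, ‖D.pertInt t ω‖ₑ ≤ D.pertVar ω := by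
  filter_upwards [D.ae_pertInt_eq] with ω h t ht
  rw [h t ht]
  exact (enorm_integral_le_lintegral_enorm _).trans
    (lintegral_mono_set (Set.Ioc_subset_Ioc_right ht))

lemma ae_isReflectedPath : ∀ᵐ ω ∂P, IsReflectedPath (C.jumps ω) T (fun s => D.gap s ω)
    (fun s => D.gapLeft (s, ω)) (fun s => D.diffDrift s ω) (fun s => D.push₁ s ω)
    (fun s => D.swap.push₁ s ω) := by
  filter_upwards [D.sol₁.ae_isReflectedPath D.rate_le D.driver D.pert₁,
    D.sol₂.ae_isReflectedPath D.rate_le D.driver D.pert₂, D.ae_integrableOn_pert, D.ae_pertInt_eq,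
    D.sol₁.ae_push_eq D.rate_le D.driver D.pert₁, D.sol₂.ae_push_eq D.rate_le D.driver D.pert₂]
    with ω h1 h2 hφ hΦ hK1 hK2
  have h3 : IsReflectedPath (C.jumps ω) T (fun s => D.V₁ s ω - D.V₂ s ω)
      (fun s => C.beforeJump D.V₁ D.Z₁ s ω - C.beforeJump D.V₂ D.Z₂ s ω)
      (fun s => D.diffDrift s ω + (D.φ₁ s ω - D.φ₂ s ω)) (fun s => D.K₁ s ω)
      (fun s => D.K₂ s ω) := by
    convert h1.sub h2 using 2
    simp only [diffDrift]
    ring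
  have h4 := h3.add_integral hφ
  have hy : ∀ s ≤ T, D.gap s ω
      = D.V₁ s ω - D.V₂ s ω + ∫ u in Set.Ioc 0 s, (D.φ₁ u ω - D.φ₂ u ω) ∂lebesgue := fun s hs => by
    rw [gap, hΦ s hs]
  refine h4.congr hy (fun s hs => ?_) hK1 hK2
  -- There is no left neighbourhood at the time 0: the left version is the value itself, and the
  -- chain does not jump there.
  rcases eq_zero_or_pos s with rfl | hs0
  · have h0 := h4.left_eq 0 hs fun h0 => lt_irrefl _ (C.pos_of_mem_jumps h0)
    have h6 : D.gapLeft (0, ω) = D.gap 0 ω := stoppedLeft_zero T D.gap ω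
    exact h6.trans ((hy 0 hs).trans h0.symm)
  · refine stoppedLeft_eq hs0 hs ((h4.tendsto_left hs0 hs).congr' ?_)
    filter_upwards [self_mem_nhdsWithin] with u hu
    exact (hy u ((le_of_lt hu).trans hs)).symm

lemma ae_valueLeft_eq : ∀ᵐ ω ∂P, ∀ s ∈ Set.Ioc 0 T, s ∉ C.jumps ω →
    D.valueLeft (s, ω) = D.V₁ s ω - D.V₂ s ω := by
  filter_upwards [D.sol₁.ae_isReflectedPath D.rate_le D.driver D.pert₁,
    D.sol₂.ae_isReflectedPath D.rate_le D.driver D.pert₂] with ω h1 h2 s hs hsJ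
  rw [valueLeft, stoppedLeft_eq hs.1 hs.2 (h1.tendsto_left hs.1 hs.2),
    stoppedLeft_eq hs.1 hs.2 (h2.tendsto_left hs.1 hs.2), h1.left_eq s hs.2 hsJ,
    h2.left_eq s hs.2 hsJ]

/-- The integrated perturbation is continuous in time, so the gap and v have the same jumps. -/
lemma ae_gap_eq : ∀ᵐ ω ∂P, ∀ j, ∀ s ∈ Set.Ioc 0 T, s ∈ C.entries j ω →
    D.gap s ω = D.gapLeft (s, ω) + D.jump j (s, ω) := by
  filter_upwards [D.sol₁.ae_isReflectedPath D.rate_le D.driver D.pert₁,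
    D.sol₂.ae_isReflectedPath D.rate_le D.driver D.pert₂, D.ae_integrableOn_pert, D.ae_pertInt_eq]
    with ω h1 h2 hφ hΦ j s hs hsj
  have hc : Tendsto (fun t => D.pertInt t ω) (𝓝[<] s) (𝓝 (D.pertInt s ω)) := by
    have hcont := (continuousOn_setIntegral_Ioc hφ) s ⟨hs.1.le, hs.2⟩
    have h3 : 𝓝[<] s ≤ 𝓝[Set.Icc 0 T] s := by
      rw [← nhdsWithin_Ioo_eq_nhdsLT hs.1]
      exact nhdsWithin_mono _ fun u hu => ⟨hu.1.le, hu.2.le.trans hs.2⟩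
    rw [hΦ s hs.2]
    refine (hcont.tendsto.mono_left h3).congr' ?_
    filter_upwards [self_mem_nhdsWithin] with u hu
    exact (hΦ u ((le_of_lt hu).trans hs.2)).symm
  have hlim := ((h1.tendsto_left hs.1 hs.2).sub (h2.tendsto_left hs.1 hs.2)).add hc
  have e1 : D.gapLeft (s, ω) = C.beforeJump D.V₁ D.Z₁ s ω - C.beforeJump D.V₂ D.Z₂ s ω
      + D.pertInt s ω := stoppedLeft_eq hs.1 hs.2 hlim
  rw [e1, jump, diffZ, C.increment_sub, ← C.dotProduct_jump hsj, ← C.dotProduct_jump hsj, gap,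
    MarkovChain.beforeJump, MarkovChain.beforeJump]
  ring

/-- The driver contributes at most ∑ λ_j |Δ_j| through z and the compensator contributes ∑ λ_j Δ_j.
Negative jumps cancel, and positive ones are at most the value after the jump because the gap is
positive. What remains involves only quantities whose squares the energy inequality controls. -/
lemma ae_ofReal_diffDrift_le : ∀ᵐ ω ∂P, ∀ s ∈ Set.Ioc 0 T, s ∉ C.jumps ω → 0 < D.gap s ω →
    ENNReal.ofReal (D.diffDrift s ω) ≤ ENNReal.ofReal c' * ‖D.valueLeft (s, ω)‖ₑ
      + 2 * ∑ j, ENNReal.ofReal (C.intensity j s ω) * D.upperJump j (s, ω) := by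
  filter_upwards [D.driver.lipschitz, D.driver.small, D.ae_isReflectedPath, D.ae_valueLeft_eq]
    with ω hlip hsmall hpath hval s hs hsJ hpos
  have hleft : D.gapLeft (s, ω) = D.gap s ω := hpath.left_eq s hs.2 hsJ
  have h1 := (le_abs_self _).trans (hlip s hs.2 (D.V₁ s ω) (D.V₂ s ω) (D.Z₁ s ω) (D.Z₂ s ω))
  have h2 := C.mul_seminorm_le D.lip_nonneg' D.rate_pos (D.rate_le s hs.2) (hsmall s hs.2)
    (D.diffZ (s, ω))
  have h3 := C.dotProduct_flow s ω (D.diffZ (s, ω))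
  have h4 : D.diffDrift s ω = D.f s ω (D.V₁ s ω) (D.Z₁ s ω) - D.f s ω (D.V₂ s ω) (D.Z₂ s ω)
      + D.diffZ (s, ω) ⬝ᵥ (C.A s *ᵥ C.left s ω) := by
    simp only [diffDrift, MarkovChain.drift, diffZ, sub_dotProduct]
    ring
  have h5 : ∑ j, C.intensity j s ω * |D.jump j (s, ω)| + ∑ j, C.intensity j s ω * D.jump j (s, ω)
      ≤ 2 * ∑ j, C.intensity j s ω * max (D.gapLeft (s, ω) + D.jump j (s, ω)) 0 := by
    rw [← Finset.sum_add_distrib, Finset.mul_sum]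
    refine Finset.sum_le_sum fun j _ => ?_
    have h6 : |D.jump j (s, ω)| + D.jump j (s, ω)
        ≤ 2 * max (D.gapLeft (s, ω) + D.jump j (s, ω)) 0 := by
      rw [hleft]
      rcases abs_cases (D.jump j (s, ω)) with h | h
      · have := le_max_left (D.gap s ω + D.jump j (s, ω)) 0
        linarith
      · have := le_max_right (D.gap s ω + D.jump j (s, ω)) 0
        linarith
    calc _ = C.intensity j s ω * (|D.jump j (s, ω)| + D.jump j (s, ω)) := by ring
      _ ≤ C.intensity j s ω * (2 * max (D.gapLeft (s, ω) + D.jump j (s, ω)) 0) :=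
        mul_le_mul_of_nonneg_left h6 (C.intensity_nonneg j s ω)
      _ = _ := by ring
  have h7 : D.diffDrift s ω ≤ c' * |D.valueLeft (s, ω)|
      + 2 * ∑ j, C.intensity j s ω * max (D.gapLeft (s, ω) + D.jump j (s, ω)) 0 := by
    rw [hval s hs hsJ, h4, h3]
    simp only [jump, diffZ] at h5 h2 ⊢
    linarith
  refine (ENNReal.ofReal_le_ofReal h7).trans (ENNReal.ofReal_add_le.trans (add_le_add ?_ ?_))
  · rw [ENNReal.ofReal_mul D.lip_nonneg, Real.enorm_eq_ofReal_abs]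
  · rw [ENNReal.ofReal_mul zero_le_two, ENNReal.ofReal_ofNat, ENNReal.ofReal_sum_of_nonneg
      fun j _ => mul_nonneg (C.intensity_nonneg j s ω) (le_max_right _ _)]
    gcongr with j
    rw [ENNReal.ofReal_mul (C.intensity_nonneg j s ω)]
    gcongr
    rw [upperJump]
    refine le_trans (le_of_eq ?_) (le_max_left _ _)
    rcases le_total (D.gapLeft (s, ω) + D.jump j (s, ω)) 0 with h | h
    · rw [max_eq_right h, ENNReal.ofReal_zero, ENNReal.ofReal_of_nonpos h]
    · rw [max_eq_left h]

end SolutionPair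

/-! ### The push acts only at contact with the obstacle. -/

lemma pathMeasure_Ioc {T : ℝ≥0} {k : ℝ≥0 → ℝ} (hm : MonotoneOn k (Set.Icc 0 T))
    (hc : ContinuousOn k (Set.Icc 0 T)) {r q : ℝ≥0} (hr : r ≤ T) (hq : q ≤ T) :
    pathMeasure T k (Set.Ioc r q) = ENNReal.ofReal (k q - k r) := by
  rw [pathMeasure, dif_pos ⟨hm, hc⟩, StieltjesFunction.measure_Ioc]
  change ENNReal.ofReal (k (min q T) - k (min r T)) = _
  rw [min_eq_left hr, min_eq_left hq]

section Contact

variable {Ω : Type*} [mΩ : MeasurableSpace Ω] {P : Measure Ω} {N : ℕ} {C : MarkovChain P N}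
  {T : ℝ≥0} {G V K : ℝ≥0 → Ω → ℝ} {ξ : Ω → ℝ} {Z : ℝ≥0 → Ω → (Fin N → ℝ)}
  {g : ℝ≥0 → Ω → ℝ → (Fin N → ℝ) → ℝ}

lemma MarkovChain.IsObstacle.measurable_section (hG : C.IsObstacle T G) (ω : Ω) :
    Measurable fun s => G (min s T) ω := by
  have h1 : @Measurable _ _ _ (Subtype.instMeasurableSpace.prod (C.filtration T))
      (fun s : ℝ≥0 => ((⟨min s T, Set.mem_Iic.2 (min_le_right _ _)⟩ : Set.Iic T), ω)) :=
    @Measurable.prodMk _ _ _ _ _ (C.filtration T) _ _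
      ((measurable_id.min measurable_const).subtype_mk) measurable_const
  exact (StronglyMeasurable.measurable (hG.progressive T)).comp h1

/-- The push of a solution increases only where the solution touches its obstacle. -/
lemma IsRBSDESolution.ae_exists_contact (hG : C.IsObstacle T G)
    (h : IsRBSDESolution C T g ξ G V Z K) :
    ∀ᵐ ω ∂P, ∀ r q, r < q → q ≤ T → K r ω < K q ω → ∃ s, r < s ∧ s < q ∧ V s ω ≤ G s ω := by
  filter_upwards [h.continuous, h.increasing, h.skorokhod, h.memV.ae_eq]
    with ω hc hm hsk hV r q hrq hqT hK
  obtain ⟨x, hx, hx'⟩ := exists_between hK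
  -- The measure dK still charges (r, q'] for some q' < q. A contact time found there lies strictly
  -- before q.
  obtain ⟨q', hq', hqx⟩ := intermediate_value_Ioo hrq.le
    (hc.mono (Set.Icc_subset_Icc zero_le hqT)) ⟨hx, hx'⟩
  have hq'T : q' ≤ T := hq'.2.le.trans hqT
  have hsub : Set.Ioc r q' ⊆ Set.Icc 0 T := fun s hs => ⟨zero_le, hs.2.trans hq'T⟩
  set μ := pathMeasure T fun t => K t ω with hμ
  have hpos : 0 < μ (Set.Ioc r q') := by
    rw [hμ, pathMeasure_Ioc hm hc (hrq.le.trans hqT) hq'T, ENNReal.ofReal_pos]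
    simp only at hqx ⊢
    linarith
  have hzero : ∫⁻ s in Set.Ioc r q', ENNReal.ofReal (V s ω - G s ω) ∂μ = 0 :=
    le_antisymm ((lintegral_mono_set hsub).trans hsk.le) zero_le
  have hmeas : AEMeasurable (fun s => ENNReal.ofReal (V s ω - G s ω)) (μ.restrict (Set.Ioc r q')) := by
    have h1 : Measurable fun s => ENNReal.ofReal (rightVersion T V (s, ω) - G (min s T) ω) :=
      ((h.memV.measurable_rightVersion.comp (measurable_prodMk_right (y := ω))).sub
        (hG.measurable_section ω)).ennreal_ofReal
    refine ⟨_, h1, ?_⟩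
    filter_upwards [ae_restrict_mem measurableSet_Ioc] with s hs
    rw [hV s (hsub hs).2, min_eq_left (hsub hs).2]
  rw [lintegral_eq_zero_iff' hmeas, EventuallyEq, ae_restrict_iff' measurableSet_Ioc] at hzero
  by_contra hcon
  push Not at hcon
  refine hpos.ne' (measure_eq_zero_iff_ae_notMem.2 ?_)
  filter_upwards [hzero] with s hs hsI
  have h2 := hs hsI
  simp only [Pi.zero_apply, ENNReal.ofReal_eq_zero] at h2
  have h3 := hcon s hsI.1 (hsI.2.trans_lt hq'.2)
  linarith

end Contact

lemma measurable_section {Ω E : Type*} [MeasurableSpace Ω] [MeasurableSpace E] {F : ℝ≥0 × Ω → E}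
    (hF : Measurable F) (ω : Ω) : Measurable fun s => F (s, ω) :=
  hF.comp (measurable_prodMk_right (y := ω))

/-! ### The energy inequality along the paths. -/

namespace SolutionPair

variable {Ω : Type*} [mΩ : MeasurableSpace Ω] {P : Measure Ω} {N : ℕ}
  {C : MarkovChain P N} {T : ℝ≥0} {c' c'' m : ℝ} (D : SolutionPair C T c' c'' m)

lemma level_mono (ω : Ω) {s t : ℝ≥0} (hst : s ≤ t) : D.level (s, ω) ≤ D.level (t, ω) :=
  pushLevel_mono _ _ (min_le_min_right T hst)

/-- At a contact time V₁ ≤ G₁ and V₂ ≥ G₂, so the gap is at most G₁ - G₂ plus the integrated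
perturbation. Every increase of K₁ contains a contact time strictly inside. -/
lemma ae_level_le : ∀ᵐ ω ∂P, D.level (T, ω)
    ≤ (⨆ t ∈ Set.Icc 0 T, ‖D.G₁ t ω - D.G₂ t ω‖ₑ) + D.pertVar ω := by
  filter_upwards [D.sol₁.ae_exists_contact D.obst₁, D.sol₂.obstacle, D.ae_isReflectedPath,
    D.sol₁.ae_push_eq D.rate_le D.driver D.pert₁, D.ae_enorm_pertInt_le] with ω hcon hobs hpath hK hΦ
  rw [level, min_self]
  refine pushLevel_le (fun s hs => hpath.tendsto_right hs) fun r q hrq hqT hKrq => ?_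
  have e1 : D.push₁ r ω = D.K₁ r ω := hK r (hrq.le.trans hqT)
  have e2 : D.push₁ q ω = D.K₁ q ω := hK q hqT
  rw [e1, e2] at hKrq
  obtain ⟨s, hs, hs', hVG⟩ := hcon r q hrq hqT hKrq
  have hsT : s ≤ T := hs'.le.trans hqT
  refine ⟨s, hs, hs', ?_⟩
  have h1 : D.gap s ω ≤ (D.G₁ s ω - D.G₂ s ω) + D.pertInt s ω := by
    have := hobs s hsT
    rw [gap]
    linarith
  refine (ENNReal.ofReal_le_ofReal h1).trans (ENNReal.ofReal_add_le.trans (add_le_add ?_ ?_))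
  · refine le_trans ?_ (le_iSup₂ (f := fun t (_ : t ∈ Set.Icc 0 T) => ‖D.G₁ t ω - D.G₂ t ω‖ₑ) s
      ⟨zero_le, hsT⟩)
    rw [Real.enorm_eq_ofReal_abs]
    exact ENNReal.ofReal_le_ofReal (le_abs_self _)
  · refine le_trans ?_ (hΦ s hsT)
    rw [Real.enorm_eq_ofReal_abs]
    exact ENNReal.ofReal_le_ofReal (le_abs_self _)

lemma measurable_sum_upperJump_sq : Measurable fun p : ℝ≥0 × Ω =>
    ∑ j, ENNReal.ofReal (C.intensity j p.1 p.2) * D.upperJump j p ^ 2 :=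
  Finset.measurable_sum _ fun j _ => (C.measurable_intensity j).ennreal_ofReal.mul
    (((D.measurable_upperJump j).mono predictable_le_prod le_rfl).pow_const 2)

lemma measurable_jumpRate : Measurable fun p : ℝ≥0 × Ω =>
    ∑ j, ENNReal.ofReal (C.intensity j p.1 p.2) * D.upperJump j p :=
  Finset.measurable_sum _ fun j _ => (C.measurable_intensity j).ennreal_ofReal.mul
    ((D.measurable_upperJump j).mono predictable_le_prod le_rfl)

lemma ae_lintegral_valueLeft_ne_top :
    ∀ᵐ ω ∂P, ∫⁻ s in Set.Ioc 0 T, ‖D.valueLeft (s, ω)‖ₑ ∂lebesgue ≠ ∞ := by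
  filter_upwards [D.ae_valueLeft_eq, D.sol₁.memV.ae_integrableOn, D.sol₂.memV.ae_integrableOn]
    with ω hval h1 h2
  have h3 : ∫⁻ s in Set.Ioc 0 T, ‖D.valueLeft (s, ω)‖ₑ ∂lebesgue
      = ∫⁻ s in Set.Ioc 0 T, ‖D.V₁ s ω - D.V₂ s ω‖ₑ ∂lebesgue := by
    refine setLIntegral_congr_fun_ae measurableSet_Ioc ?_
    filter_upwards [C.ae_notMem_jumps ω] with s hsJ hs
    rw [hval s hs hsJ]
  rw [h3]
  exact (h1.sub h2).2.ne

lemma sum_intensity_le (D : SolutionPair C T c' c'' m) {s : ℝ≥0} (hs : s ≤ T) (ω : Ω) :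
    ∑ j, ENNReal.ofReal (C.intensity j s ω) ≤ ENNReal.ofReal m := by
  rw [← ENNReal.ofReal_sum_of_nonneg fun j _ => C.intensity_nonneg j s ω]
  exact ENNReal.ofReal_le_ofReal (C.sum_intensity_le (D.rate_le s hs) ω)

/-- The bound on the difference of the drifts while the gap is positive. -/
noncomputable def driftBound (p : ℝ≥0 × Ω) : ℝ≥0∞ := ENNReal.ofReal c' * ‖D.valueLeft p‖ₑ
  + 2 * ∑ j, ENNReal.ofReal (C.intensity j p.1 p.2) * D.upperJump j p

lemma measurable_driftBound : Measurable D.driftBound :=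
  ((D.measurable_valueLeft.mono predictable_le_prod le_rfl).enorm.const_mul _).add
    (D.measurable_jumpRate.const_mul 2)

/-- The chain rule for squares requires an integrable drift bound. Since x ≤ 1 + x² and the
intensities sum to at most m, the assumed integrability of the squares is enough. -/
lemma ae_lintegral_driftBound_ne_top
    (hfin : ∫⁻ ω, ∫⁻ s in Set.Icc 0 T, ∑ j, ENNReal.ofReal (C.intensity j s ω)
      * D.upperJump j (s, ω) ^ 2 ∂lebesgue ∂P < ∞) :
    ∀ᵐ ω ∂P, ∫⁻ s in Set.Ioc 0 T, D.driftBound (s, ω) ∂lebesgue ≠ ∞ := by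
  filter_upwards [ae_lintegral_ne_top D.measurable_sum_upperJump_sq
    (Eventually.of_forall fun _ _ _ => rfl) hfin, D.ae_lintegral_valueLeft_ne_top] with ω hJ hval
  have hm1 : Measurable fun s => ‖D.valueLeft (s, ω)‖ₑ :=
    (measurable_section (D.measurable_valueLeft.mono predictable_le_prod le_rfl) ω).enorm
  have hm2 : Measurable fun s =>
      ∑ j, ENNReal.ofReal (C.intensity j s ω) * D.upperJump j (s, ω) :=
    measurable_section D.measurable_jumpRate ω
  simp only [driftBound]
  rw [lintegral_add_left (hm1.const_mul _), lintegral_const_mul _ hm1, lintegral_const_mul _ hm2]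
  refine ENNReal.add_ne_top.2 ⟨ENNReal.mul_ne_top ENNReal.ofReal_ne_top hval,
    ENNReal.mul_ne_top ENNReal.ofNat_ne_top ?_⟩
  have hle1 : ∀ x : ℝ≥0∞, x ≤ 1 + x ^ 2 := fun x => by
    rcases le_total x 1 with h | h
    · exact h.trans le_self_add
    · exact (le_self_pow₀ h two_ne_zero).trans le_add_self
  have hb : ∫⁻ s in Set.Ioc 0 T, ∑ j, ENNReal.ofReal (C.intensity j s ω) * D.upperJump j (s, ω)
        ∂lebesgue
      ≤ ∫⁻ s in Set.Ioc 0 T, (ENNReal.ofReal m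
        + ∑ j, ENNReal.ofReal (C.intensity j s ω) * D.upperJump j (s, ω) ^ 2) ∂lebesgue := by
    refine setLIntegral_mono' measurableSet_Ioc fun s hs => ?_
    calc ∑ j, ENNReal.ofReal (C.intensity j s ω) * D.upperJump j (s, ω)
        ≤ ∑ j, (ENNReal.ofReal (C.intensity j s ω)
          + ENNReal.ofReal (C.intensity j s ω) * D.upperJump j (s, ω) ^ 2) := by
          refine Finset.sum_le_sum fun j _ => ?_
          refine (mul_le_mul_right (hle1 _) _).trans (le_of_eq ?_)
          ring
      _ ≤ _ := by
          rw [Finset.sum_add_distrib]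
          exact add_le_add (D.sum_intensity_le hs.2 ω) le_rfl
  refine ne_top_of_le_ne_top ?_ hb
  rw [lintegral_add_left measurable_const]
  refine ENNReal.add_ne_top.2 ⟨?_, hJ⟩
  rw [lintegral_const]
  exact ENNReal.mul_ne_top ENNReal.ofReal_ne_top (measure_ne_top _ _)

lemma ae_upperLeft_eq : ∀ᵐ ω ∂P, ∀ s ≤ T, s ∉ C.jumps ω → D.upperLeft (s, ω) = D.upper s ω := by
  filter_upwards [D.ae_isReflectedPath] with ω h s hs hsJ
  have h1 : D.gapLeft (s, ω) = D.gap s ω := h.left_eq s hs hsJ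
  rw [upperLeft, upper, h1]

/-- The energy inequality along the paths. -/
lemma ae_upper_sq_add_le
    (hfin : ∫⁻ ω, ∫⁻ s in Set.Icc 0 T, ∑ j, ENNReal.ofReal (C.intensity j s ω)
      * D.upperJump j (s, ω) ^ 2 ∂lebesgue ∂P < ∞) :
    ∀ᵐ ω ∂P, ∀ t ≤ T,
      D.upper t ω ^ 2 + ∑ j, ∫⁻ s in Set.Ioc t T, D.upperJump j (s, ω) ^ 2 ∂(C.entryMeasure j ω)
        ≤ D.upper T ω ^ 2 + ∫⁻ s in Set.Ioc t T, 2 * (D.upperLeft (s, ω) * D.driftBound (s, ω))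
            ∂lebesgue
          + ∑ j, ∫⁻ s in Set.Ioc t T, D.upperLeft (s, ω) ^ 2 ∂(C.entryMeasure j ω) := by
  filter_upwards [D.ae_isReflectedPath, D.ae_gap_eq, D.ae_ofReal_diffDrift_le,
    D.ae_lintegral_driftBound_ne_top hfin, D.ae_upperLeft_eq] with ω hpath hgap hdr hfinω hleft t ht
  have hm : Measurable fun s => D.driftBound (s, ω) :=
    measurable_section D.measurable_driftBound ω
  have hG : ∀ᵐ s ∂lebesgue, s ∈ Set.Ioc 0 T → 0 < D.gap s ω →
      ENNReal.ofReal (D.diffDrift s ω) ≤ D.driftBound (s, ω) := by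
    filter_upwards [C.ae_notMem_jumps ω] with s hsJ hs hpos using hdr s hs hsJ hpos
  have hlev : ∀ s ≤ T, D.level (s, ω)
      = pushLevel (fun t => D.push₁ t ω) (fun t => D.gap t ω) s := fun s hs => by
    rw [level, min_eq_left hs]
  -- The squares after the jumps stay on the left and those before the jumps on the right. At an
  -- entry into j, the value after the jump is then replaced by the predictable `upperJump j`, as
  -- the compensation formula requires.
  have key := add_sum_le_of_le_segment (J := C.jumps ω) (T := T) (μ := lebesgue)
    (fun t => C.finite_jumps_Ioc t T ω) (W := fun s => D.upper s ω ^ 2)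
    (Wl := fun s => D.upperLeft (s, ω) ^ 2)
    (g := fun s => 2 * (D.upperLeft (s, ω) * D.driftBound (s, ω)))
    (fun s hs hsJ => by rw [hleft s hs hsJ]) ?_ ht
  · simp only [C.sum_jumps_eq] at key
    simp only [C.setLIntegral_entryMeasure]
    convert key using 4 with j _ s hs
    have hs' := (Set.Finite.mem_toFinset _).1 hs
    rw [upper, upperJump, hgap j s ⟨zero_le.trans_lt hs'.2.1, hs'.2.2⟩ hs'.1]
  · intro a b hab hbT hJ
    have h1 := hpath.max_pushLevel_sq_le hm.aemeasurable hfinω hG hab hbT hJ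
    have haT := hab.le.trans hbT
    simp only [upper, upperLeft]
    rw [hlev a haT, hlev b hbT]
    refine h1.trans (add_le_add le_rfl ?_)
    rw [← lintegral_const_mul' _ _ ENNReal.ofNat_ne_top]
    refine le_of_eq (setLIntegral_congr_fun_ae measurableSet_Ioc ?_)
    filter_upwards [C.ae_notMem_jumps ω] with s hsJ hs
    have hsT : s ≤ T := hs.2.trans hbT
    have h2 : D.gapLeft (s, ω) = D.gap s ω := hpath.left_eq s hsT hsJ
    rw [h2, hlev s hsT]

end SolutionPair

/-! ### The energy inequality in expectation. -/

lemma setLIntegral_Ioc_ite_lt {μ : Measure ℝ≥0} (F : ℝ≥0 → ℝ≥0∞) (t T : ℝ≥0) :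
    ∫⁻ s in Set.Ioc 0 T, (if t < s then F s else 0) ∂μ = ∫⁻ s in Set.Ioc t T, F s ∂μ := by
  have h1 : (fun s => if t < s then F s else 0) = (Set.Ioi t).indicator F := by
    ext s
    simp [Set.indicator_apply]
  have h2 : Set.Ioi t ∩ Set.Ioc 0 T = Set.Ioc t T := by
    ext s
    simp only [Set.mem_inter_iff, Set.mem_Ioi, Set.mem_Ioc]
    exact ⟨fun h => ⟨h.1, h.2.2⟩, fun h => ⟨h.1, zero_le.trans_lt h.1, h.2⟩⟩
  rw [h1, lintegral_indicator measurableSet_Ioi, Measure.restrict_restrict measurableSet_Ioi, h2]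

namespace MarkovChain

variable {Ω : Type*} [mΩ : MeasurableSpace Ω] {P : Measure Ω} {N : ℕ} (C : MarkovChain P N)

lemma measurable_ite_lt_predictable {H : ℝ≥0 × Ω → ℝ≥0∞}
    (hH : Measurable[C.filtration.predictable] H) (t : ℝ≥0) :
    Measurable[C.filtration.predictable] fun p : ℝ≥0 × Ω => if t < p.1 then H p else 0 :=
  Measurable.ite (m := C.filtration.predictable) (measurable_fst_predictable measurableSet_Ioi) hH
    measurable_const

lemma measurable_setLIntegral_entryMeasure (j : Fin N) (t T : ℝ≥0) {H : ℝ≥0 × Ω → ℝ≥0∞}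
    (hH : Measurable[C.filtration.predictable] H) :
    Measurable fun ω => ∫⁻ s in Set.Ioc t T, H (s, ω) ∂(C.entryMeasure j ω) := by
  have h := measurable_setLIntegral_of_predictable (C.measurable_entryMeasure (t := T) le_rfl j)
    (fun _ => inferInstance) (C.measurable_ite_lt_predictable hH t)
  simp only [setLIntegral_Ioc_ite_lt] at h
  exact h.mono (C.filtration.le T) le_rfl

lemma lintegral_entryMeasure_Ioc [IsProbabilityMeasure P] (j : Fin N) (t T : ℝ≥0)
    {H : ℝ≥0 × Ω → ℝ≥0∞} (hH : Measurable[C.filtration.predictable] H) :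
    ∫⁻ ω, ∫⁻ s in Set.Ioc t T, H (s, ω) ∂(C.entryMeasure j ω) ∂P
      = ∫⁻ ω, ∫⁻ s in Set.Ioc t T, ENNReal.ofReal (C.intensity j s ω) * H (s, ω) ∂lebesgue ∂P := by
  have h := C.lintegral_entryMeasure j T (C.measurable_ite_lt_predictable hH t)
  simp only [mul_ite, mul_zero] at h
  simp only [setLIntegral_Ioc_ite_lt] at h
  exact h

/-- The compensation formula for the sum over all entries. -/
lemma lintegral_sum_entryMeasure_Ioc [IsProbabilityMeasure P] (t T : ℝ≥0)
    {H : Fin N → ℝ≥0 × Ω → ℝ≥0∞} (hH : ∀ j, Measurable[C.filtration.predictable] (H j)) :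
    ∫⁻ ω, ∑ j, ∫⁻ s in Set.Ioc t T, H j (s, ω) ∂(C.entryMeasure j ω) ∂P
      = ∫⁻ ω, ∫⁻ s in Set.Ioc t T, ∑ j, ENNReal.ofReal (C.intensity j s ω) * H j (s, ω)
        ∂lebesgue ∂P := by
  have hm : ∀ j, Measurable fun p : ℝ≥0 × Ω => ENNReal.ofReal (C.intensity j p.1 p.2) * H j p :=
    fun j => (C.measurable_intensity j).ennreal_ofReal.mul
      ((hH j).mono predictable_le_prod le_rfl)
  rw [lintegral_finsetSum _ fun j _ => C.measurable_setLIntegral_entryMeasure j t T (hH j)]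
  simp_rw [C.lintegral_entryMeasure_Ioc _ t T (hH _)]
  rw [← lintegral_finsetSum _ fun j _ => ?_]
  · refine lintegral_congr fun ω => ?_
    rw [lintegral_finsetSum _ fun j _ => measurable_section (hm j) ω]
  · exact ((hm j).comp measurable_swap).lintegral_prod_right'

end MarkovChain

lemma measurable_setLIntegral_lebesgue {Ω : Type*} [MeasurableSpace Ω] {F : ℝ≥0 × Ω → ℝ≥0∞}
    (hF : Measurable F) (t T : ℝ≥0) :
    Measurable fun ω => ∫⁻ s in Set.Ioc t T, F (s, ω) ∂lebesgue :=
  (hF.comp measurable_swap).lintegral_prod_right'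

lemma lintegral_setLIntegral_add {Ω : Type*} [MeasurableSpace Ω] {P : Measure Ω}
    {F F' : ℝ≥0 × Ω → ℝ≥0∞} (hF : Measurable F) (t T : ℝ≥0) :
    ∫⁻ ω, ∫⁻ s in Set.Ioc t T, (F (s, ω) + F' (s, ω)) ∂lebesgue ∂P
      = ∫⁻ ω, ∫⁻ s in Set.Ioc t T, F (s, ω) ∂lebesgue ∂P
        + ∫⁻ ω, ∫⁻ s in Set.Ioc t T, F' (s, ω) ∂lebesgue ∂P := by
  rw [← lintegral_add_left (measurable_setLIntegral_lebesgue hF t T)]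
  refine lintegral_congr fun ω => ?_
  rw [lintegral_add_left (measurable_section hF ω)]

lemma lintegral_setLIntegral_const_mul {Ω : Type*} [MeasurableSpace Ω] {P : Measure Ω}
    {F : ℝ≥0 × Ω → ℝ≥0∞} {c : ℝ≥0∞} (hc : c ≠ ∞) (t T : ℝ≥0) :
    ∫⁻ ω, ∫⁻ s in Set.Ioc t T, c * F (s, ω) ∂lebesgue ∂P
      = c * ∫⁻ ω, ∫⁻ s in Set.Ioc t T, F (s, ω) ∂lebesgue ∂P := by
  simp_rw [lintegral_const_mul' _ _ hc]

lemma lintegral_setLIntegral_mono {Ω : Type*} [MeasurableSpace Ω] {P : Measure Ω} {t T : ℝ≥0}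
    {F F' : ℝ≥0 × Ω → ℝ≥0∞}
    (h : ∀ᵐ ω ∂P, ∀ᵐ s ∂lebesgue, s ∈ Set.Ioc t T → F (s, ω) ≤ F' (s, ω)) :
    ∫⁻ ω, ∫⁻ s in Set.Ioc t T, F (s, ω) ∂lebesgue ∂P
      ≤ ∫⁻ ω, ∫⁻ s in Set.Ioc t T, F' (s, ω) ∂lebesgue ∂P := by
  refine lintegral_mono_ae ?_
  filter_upwards [h] with ω hω
  exact setLIntegral_mono_ae' measurableSet_Ioc hω

namespace SolutionPair

variable {Ω : Type*} [mΩ : MeasurableSpace Ω] {P : Measure Ω} {N : ℕ}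
  {C : MarkovChain P N} {T : ℝ≥0} {c' c'' m : ℝ} (D : SolutionPair C T c' c'' m)

lemma measurable_upper {t : ℝ≥0} (ht : t ≤ T) : Measurable (D.upper t) :=
  (((D.measurable_gap ht).mono (C.filtration.le t) le_rfl).ennreal_ofReal).max
    ((D.measurable_level.mono predictable_le_prod le_rfl).comp (measurable_prodMk_left (x := t)))

/-- Young's inequality 2(4x)u ≤ (4x)² + u² spends one copy of the jump energy; the doubling on the
left is made so that a second copy survives. The constant 18m consists of 16m from this step and 2m
from the squares before the jumps. -/
lemma two_mul_drift_add_le {s : ℝ≥0} (hs : s ≤ T) (ω : Ω) :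
    2 * (2 * (D.upperLeft (s, ω) * D.driftBound (s, ω))
        + ∑ j, ENNReal.ofReal (C.intensity j s ω) * D.upperLeft (s, ω) ^ 2)
      ≤ ENNReal.ofReal (2 * c' + 18 * m) * D.upperLeft (s, ω) ^ 2
        + ENNReal.ofReal (2 * c') * ‖D.valueLeft (s, ω)‖ₑ ^ 2
        + ∑ j, ENNReal.ofReal (C.intensity j s ω) * D.upperJump j (s, ω) ^ 2 := by
  have hc := D.lip_nonneg
  have hm := D.rate_pos
  set x := D.upperLeft (s, ω)
  set v := ‖D.valueLeft (s, ω)‖ₑ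
  have e1 : ENNReal.ofReal (2 * c' + 18 * m) = 2 * ENNReal.ofReal c' + 18 * ENNReal.ofReal m := by
    rw [ENNReal.ofReal_add (by positivity) (by positivity), ENNReal.ofReal_mul zero_le_two,
      ENNReal.ofReal_mul (by norm_num), ENNReal.ofReal_ofNat, ENNReal.ofReal_ofNat]
  have e2 : ENNReal.ofReal (2 * c') = 2 * ENNReal.ofReal c' := by
    rw [ENNReal.ofReal_mul zero_le_two, ENNReal.ofReal_ofNat]
  have h1 : 2 * ENNReal.ofReal c' * (2 * (x * v)) ≤ 2 * ENNReal.ofReal c' * (x ^ 2 + v ^ 2) := by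
    gcongr
    exact two_mul_mul_le_add_sq x v
  have h2 : 8 * (x * ∑ j, ENNReal.ofReal (C.intensity j s ω) * D.upperJump j (s, ω))
      ≤ 16 * (ENNReal.ofReal m * x ^ 2)
        + ∑ j, ENNReal.ofReal (C.intensity j s ω) * D.upperJump j (s, ω) ^ 2 := by
    calc 8 * (x * ∑ j, ENNReal.ofReal (C.intensity j s ω) * D.upperJump j (s, ω))
        = ∑ j, ENNReal.ofReal (C.intensity j s ω) * (2 * (4 * x * D.upperJump j (s, ω))) := by
          rw [Finset.mul_sum, Finset.mul_sum]
          exact Finset.sum_congr rfl fun j _ => by ring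
      _ ≤ ∑ j, ENNReal.ofReal (C.intensity j s ω) * ((4 * x) ^ 2 + D.upperJump j (s, ω) ^ 2) := by
          gcongr
          exact two_mul_mul_le_add_sq _ _
      _ = 16 * ((∑ j, ENNReal.ofReal (C.intensity j s ω)) * x ^ 2)
          + ∑ j, ENNReal.ofReal (C.intensity j s ω) * D.upperJump j (s, ω) ^ 2 := by
          rw [Finset.sum_mul, Finset.mul_sum, ← Finset.sum_add_distrib]
          exact Finset.sum_congr rfl fun j _ => by ring
      _ ≤ _ := by
          gcongr
          exact D.sum_intensity_le hs ω
  have h3 : ∑ j, ENNReal.ofReal (C.intensity j s ω) * x ^ 2 ≤ ENNReal.ofReal m * x ^ 2 := by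
    rw [← Finset.sum_mul]
    gcongr
    exact D.sum_intensity_le hs ω
  calc _ = 2 * ENNReal.ofReal c' * (2 * (x * v))
        + 8 * (x * ∑ j, ENNReal.ofReal (C.intensity j s ω) * D.upperJump j (s, ω))
        + 2 * ∑ j, ENNReal.ofReal (C.intensity j s ω) * x ^ 2 := by
        rw [driftBound]
        ring
    _ ≤ 2 * ENNReal.ofReal c' * (x ^ 2 + v ^ 2) + (16 * (ENNReal.ofReal m * x ^ 2)
        + ∑ j, ENNReal.ofReal (C.intensity j s ω) * D.upperJump j (s, ω) ^ 2)
        + 2 * (ENNReal.ofReal m * x ^ 2) := by gcongr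
    _ = _ := by
        rw [e1, e2]
        ring

/-- The energy estimate for one sign of the gap. -/
lemma lintegral_upper_sq_add_le [IsProbabilityMeasure P]
    (hfin : ∫⁻ ω, ∫⁻ s in Set.Icc 0 T, ∑ j, ENNReal.ofReal (C.intensity j s ω)
      * D.upperJump j (s, ω) ^ 2 ∂lebesgue ∂P < ∞) {t : ℝ≥0} (ht : t ≤ T) :
    2 * ∫⁻ ω, D.upper t ω ^ 2 ∂P
        + ∫⁻ ω, ∫⁻ s in Set.Ioc t T, ∑ j, ENNReal.ofReal (C.intensity j s ω)
          * D.upperJump j (s, ω) ^ 2 ∂lebesgue ∂P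
      ≤ 2 * ∫⁻ ω, D.upper T ω ^ 2 ∂P
        + ∫⁻ ω, ∫⁻ s in Set.Ioc t T, (ENNReal.ofReal (2 * c' + 18 * m) * D.upperLeft (s, ω) ^ 2
          + ENNReal.ofReal (2 * c') * ‖D.valueLeft (s, ω)‖ₑ ^ 2) ∂lebesgue ∂P := by
  have hmU : Measurable D.upperLeft := D.measurable_upperLeft.mono predictable_le_prod le_rfl
  have hmv : Measurable D.valueLeft := D.measurable_valueLeft.mono predictable_le_prod le_rfl
  set A := ∫⁻ ω, ∫⁻ s in Set.Ioc t T, ∑ j, ENNReal.ofReal (C.intensity j s ω)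
          * D.upperJump j (s, ω) ^ 2 ∂lebesgue ∂P with hA
  have hAfin : A ≠ ∞ := by
    refine ne_top_of_le_ne_top hfin.ne (lintegral_mono fun ω => ?_)
    exact lintegral_mono_set fun s hs => ⟨zero_le, hs.2⟩
  have hm2 : Measurable fun p : ℝ≥0 × Ω => 2 * (D.upperLeft p * D.driftBound p) :=
    (hmU.mul D.measurable_driftBound).const_mul 2
  have hm4 : Measurable fun ω => D.upper T ω ^ 2
      + ∫⁻ s in Set.Ioc t T, 2 * (D.upperLeft (s, ω) * D.driftBound (s, ω)) ∂lebesgue :=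
    ((D.measurable_upper le_rfl).pow_const 2).add (measurable_setLIntegral_lebesgue hm2 t T)
  have h1 := lintegral_mono_ae (μ := P) (f := fun ω => D.upper t ω ^ 2
    + ∑ j, ∫⁻ s in Set.Ioc t T, D.upperJump j (s, ω) ^ 2 ∂(C.entryMeasure j ω))
    (g := fun ω => D.upper T ω ^ 2
      + ∫⁻ s in Set.Ioc t T, 2 * (D.upperLeft (s, ω) * D.driftBound (s, ω)) ∂lebesgue
      + ∑ j, ∫⁻ s in Set.Ioc t T, D.upperLeft (s, ω) ^ 2 ∂(C.entryMeasure j ω))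
    (by filter_upwards [D.ae_upper_sq_add_le hfin] with ω hω using hω t ht)
  rw [lintegral_add_left ((D.measurable_upper ht).pow_const 2),
    lintegral_add_left hm4,
    lintegral_add_left ((D.measurable_upper le_rfl).pow_const 2),
    C.lintegral_sum_entryMeasure_Ioc t T (H := fun j p => D.upperJump j p ^ 2)
      fun j => (D.measurable_upperJump j).pow_const 2,
    C.lintegral_sum_entryMeasure_Ioc t T (H := fun _ p => D.upperLeft p ^ 2)
      fun j => D.measurable_upperLeft.pow_const 2, ← hA, add_assoc,
    ← lintegral_setLIntegral_add (F' := fun p =>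
      ∑ j, ENNReal.ofReal (C.intensity j p.1 p.2) * D.upperLeft p ^ 2) hm2] at h1
  have h2 : 2 * ∫⁻ ω, ∫⁻ s in Set.Ioc t T, (2 * (D.upperLeft (s, ω) * D.driftBound (s, ω))
        + ∑ j, ENNReal.ofReal (C.intensity j s ω) * D.upperLeft (s, ω) ^ 2) ∂lebesgue ∂P
      ≤ ∫⁻ ω, ∫⁻ s in Set.Ioc t T, (ENNReal.ofReal (2 * c' + 18 * m) * D.upperLeft (s, ω) ^ 2
          + ENNReal.ofReal (2 * c') * ‖D.valueLeft (s, ω)‖ₑ ^ 2) ∂lebesgue ∂P + A := by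
    have hm3 : Measurable fun p => ENNReal.ofReal (2 * c' + 18 * m) * D.upperLeft p ^ 2
        + ENNReal.ofReal (2 * c') * ‖D.valueLeft p‖ₑ ^ 2 :=
      ((hmU.pow_const 2).const_mul _).add ((hmv.enorm.pow_const 2).const_mul _)
    rw [hA, ← lintegral_setLIntegral_add (F' := fun p =>
      ∑ j, ENNReal.ofReal (C.intensity j p.1 p.2) * D.upperJump j p ^ 2) hm3, ← lintegral_setLIntegral_const_mul
      ENNReal.ofNat_ne_top (F := fun p => 2 * (D.upperLeft p * D.driftBound p)
        + ∑ j, ENNReal.ofReal (C.intensity j p.1 p.2) * D.upperLeft p ^ 2)]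
    refine lintegral_setLIntegral_mono (F := fun p => 2 * (2 * (D.upperLeft p * D.driftBound p)
        + ∑ j, ENNReal.ofReal (C.intensity j p.1 p.2) * D.upperLeft p ^ 2))
      (F' := fun p => ENNReal.ofReal (2 * c' + 18 * m) * D.upperLeft p ^ 2
        + ENNReal.ofReal (2 * c') * ‖D.valueLeft p‖ₑ ^ 2
        + ∑ j, ENNReal.ofReal (C.intensity j p.1 p.2) * D.upperJump j p ^ 2)
      (Eventually.of_forall fun ω => Eventually.of_forall fun s hs => ?_)
    exact D.two_mul_drift_add_le hs.2 ω
  -- After doubling, the left side carries the jump energy A twice and the right side at most once.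
  -- One copy is cancelled, which is where A must be finite.
  have h3 := mul_le_mul_right h1 2
  rw [mul_add, mul_add, two_mul A, ← add_assoc] at h3
  refine (ENNReal.add_le_add_iff_right hAfin).1 (h3.trans ?_)
  rw [add_assoc]
  gcongr

end SolutionPair

/-! ### Both signs together, and finiteness in advance. -/

lemma enorm_sq_le_ofReal_add (x : ℝ) :
    ‖x‖ₑ ^ 2 ≤ ENNReal.ofReal x ^ 2 + ENNReal.ofReal (-x) ^ 2 := by
  rw [Real.enorm_eq_ofReal_abs]
  rcases le_total 0 x with h | h
  · rw [abs_of_nonneg h]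
    exact le_self_add
  · rw [abs_of_nonpos h]
    exact le_add_self

lemma ofReal_le_enorm (x : ℝ) : ENNReal.ofReal x ≤ ‖x‖ₑ := by
  rw [Real.enorm_eq_ofReal_abs]
  exact ENNReal.ofReal_le_ofReal (le_abs_self x)

lemma max_sq_le_add (x y : ℝ≥0∞) : max x y ^ 2 ≤ x ^ 2 + y ^ 2 := by
  rcases le_total x y with h | h
  · rw [max_eq_right h]
    exact le_add_self
  · rw [max_eq_left h]
    exact le_self_add

lemma lebesgue_Ioc_le (t T : ℝ≥0) : lebesgue (Set.Ioc t T) ≤ T := by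
  rw [lebesgue_Ioc, ← ENNReal.ofReal_coe_nnreal]
  exact ENNReal.ofReal_le_ofReal (sub_le_self _ t.2)

lemma MarkovChain.ofReal_seminormSq_eq {Ω : Type*} [MeasurableSpace Ω] {P : Measure Ω} {N : ℕ}
    (C : MarkovChain P N) (s : ℝ≥0) (ω : Ω) (z : Fin N → ℝ) :
    ENNReal.ofReal (C.seminormSq s ω z)
      = ∑ j, ENNReal.ofReal (C.intensity j s ω) * ‖C.increment j s ω z‖ₑ ^ 2 := by
  rw [C.seminormSq_eq, ENNReal.ofReal_sum_of_nonneg fun j _ =>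
    mul_nonneg (C.intensity_nonneg j s ω) (sq_nonneg _)]
  refine Finset.sum_congr rfl fun j _ => ?_
  rw [ENNReal.ofReal_mul (C.intensity_nonneg j s ω), Real.enorm_eq_ofReal_abs,
    ← ENNReal.ofReal_pow (abs_nonneg _), sq_abs]

namespace SolutionPair

variable {Ω : Type*} [mΩ : MeasurableSpace Ω] {P : Measure Ω} {N : ℕ}
  {C : MarkovChain P N} {T : ℝ≥0} {c' c'' m : ℝ} (D : SolutionPair C T c' c'' m)

lemma swap_pertInt (t : ℝ≥0) (ω : Ω) : D.swap.pertInt t ω = -D.pertInt t ω := by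
  simp only [pertInt, partsIntegral, swap, neg_sub]

lemma swap_gap (t : ℝ≥0) (ω : Ω) : D.swap.gap t ω = -D.gap t ω := by
  rw [gap, gap, swap_pertInt]
  simp only [swap]
  ring

lemma swap_jump (j : Fin N) (p : ℝ≥0 × Ω) : D.swap.jump j p = -D.jump j p := by
  rw [jump, jump, ← C.increment_neg]
  simp only [diffZ, swap, neg_sub]

lemma swap_pertVar (ω : Ω) : D.swap.pertVar ω = D.pertVar ω := by
  simp only [pertVar, swap]
  simp_rw [enorm_sub_rev (D.φ₂ _ ω)]

lemma swap_valueLeft (p : ℝ≥0 × Ω) : D.swap.valueLeft p = -D.valueLeft p := by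
  simp only [valueLeft, swap, neg_sub]

/-- An upper limit is not odd, so the change of sign is valid only where the left limit exists. -/
lemma ae_swap_gapLeft_eq : ∀ᵐ ω ∂P, ∀ s ∈ Set.Ioc 0 T, D.swap.gapLeft (s, ω) = -D.gapLeft (s, ω) := by
  filter_upwards [D.ae_isReflectedPath] with ω h s hs
  refine stoppedLeft_eq hs.1 hs.2 ?_
  simp_rw [swap_gap]
  exact (h.tendsto_left hs.1 hs.2).neg

/-- The size of the difference of the data. -/
noncomputable def data (ω : Ω) : ℝ≥0∞ := ‖D.ξ₁ ω - D.ξ₂ ω‖ₑ ^ 2 + D.pertVar ω ^ 2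
  + ⨆ t ∈ Set.Icc 0 T, ‖D.G₁ t ω - D.G₂ t ω‖ₑ ^ 2

lemma swap_data (ω : Ω) : D.swap.data ω = D.data ω := by
  rw [data, data, swap_pertVar]
  simp only [swap]
  simp_rw [enorm_sub_rev (D.G₂ _ ω), enorm_sub_rev (D.ξ₂ ω)]

lemma pertVar_sq_le (ω : Ω) : D.pertVar ω ^ 2 ≤ D.data ω :=
  le_add_self.trans le_self_add

lemma ae_level_sq_le : ∀ᵐ ω ∂P, D.level (T, ω) ^ 2 ≤ 2 * D.data ω := by
  filter_upwards [D.ae_level_le] with ω h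
  refine (pow_le_pow_left₀ zero_le h 2).trans ((add_sq_le_two_mul _ _).trans ?_)
  rw [ENNReal.iSup_pow_of_ne_zero two_ne_zero]
  simp_rw [ENNReal.iSup_pow_of_ne_zero two_ne_zero]
  rw [← mul_add, data]
  gcongr 2 * ?_
  rw [add_comm, add_assoc]
  exact le_add_self

lemma _root_.MarkovRBSDE.IsRBSDESolution.ae_terminal {g : ℝ≥0 → Ω → ℝ → (Fin N → ℝ) → ℝ}
    {ξ : Ω → ℝ} {G V K : ℝ≥0 → Ω → ℝ} {Z : ℝ≥0 → Ω → (Fin N → ℝ)}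
    (h : IsRBSDESolution C T g ξ G V Z K) : ∀ᵐ ω ∂P, V T ω = ξ ω := by
  filter_upwards [h.equation] with ω hω
  rw [hω T le_rfl]
  simp [MarkovChain.stochInt]

lemma ae_enorm_gap_terminal_sq_le : ∀ᵐ ω ∂P, ‖D.gap T ω‖ₑ ^ 2 ≤ 2 * D.data ω := by
  filter_upwards [D.sol₁.ae_terminal, D.sol₂.ae_terminal, D.ae_enorm_pertInt_le] with ω h1 h2 h3
  rw [gap, h1, h2]
  refine (enorm_add_sq_le _ _).trans ?_
  rw [← mul_add, data]
  gcongr 2 * ?_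
  refine le_trans ?_ le_self_add
  gcongr
  exact h3 T le_rfl

lemma lintegral_upper_terminal_sq_le : ∫⁻ ω, D.upper T ω ^ 2 ∂P ≤ 4 * ∫⁻ ω, D.data ω ∂P := by
  rw [← lintegral_const_mul' _ _ ENNReal.ofNat_ne_top]
  refine lintegral_mono_ae ?_
  filter_upwards [D.ae_level_sq_le, D.ae_enorm_gap_terminal_sq_le] with ω h1 h2
  refine (max_sq_le_add _ _).trans ?_
  calc _ ≤ 2 * D.data ω + 2 * D.data ω :=
        add_le_add ((pow_le_pow_left₀ zero_le (ofReal_le_enorm _) 2).trans h2) h1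
    _ = _ := by ring

/-- The square of the gap, kept above the levels from both sides. -/
noncomputable def energy (p : ℝ≥0 × Ω) : ℝ≥0∞ := D.upperLeft p ^ 2 + D.swap.upperLeft p ^ 2

/-- The rate of the squares of `upper` at the jumps. -/
noncomputable def jumpEnergy (p : ℝ≥0 × Ω) : ℝ≥0∞ :=
  ∑ j, ENNReal.ofReal (C.intensity j p.1 p.2) * D.upperJump j p ^ 2

/-- The square of the seminorm of the difference of the integrands. -/
noncomputable def diffSq (p : ℝ≥0 × Ω) : ℝ≥0∞ :=
  ENNReal.ofReal (C.seminormSq p.1 p.2 (D.diffZ p))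

lemma diffSq_eq (p : ℝ≥0 × Ω) : D.diffSq p
    = ∑ j, ENNReal.ofReal (C.intensity j p.1 p.2) * ‖D.jump j p‖ₑ ^ 2 :=
  C.ofReal_seminormSq_eq _ _ _

lemma measurable_energy : Measurable D.energy :=
  ((D.measurable_upperLeft.mono predictable_le_prod le_rfl).pow_const 2).add
    ((D.swap.measurable_upperLeft.mono predictable_le_prod le_rfl).pow_const 2)

lemma measurable_diffSq : Measurable D.diffSq :=
  (C.measurable_seminormSq predictable_le_prod
    (D.measurable_diffZ.mono predictable_le_prod le_rfl)).ennreal_ofReal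

lemma measurable_pertVar : Measurable D.pertVar :=
  measurable_setLIntegral_lebesgue (F := fun p => ‖D.φ₁ p.1 p.2 - D.φ₂ p.1 p.2‖ₑ)
    (D.pert₁.measurable.sub D.pert₂.measurable).enorm 0 T

lemma ae_enorm_gapLeft_sq_le : ∀ᵐ ω ∂P, ∀ s ∈ Set.Ioc 0 T,
    ‖D.gapLeft (s, ω)‖ₑ ^ 2 ≤ D.energy (s, ω) := by
  filter_upwards [D.ae_swap_gapLeft_eq] with ω h s hs
  refine (enorm_sq_le_ofReal_add _).trans (add_le_add ?_ ?_)
  · exact pow_le_pow_left₀ zero_le (le_max_left _ _) 2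
  · rw [← h s hs]
    exact pow_le_pow_left₀ zero_le (le_max_left _ _) 2

/-- Write Δ_j = (U₋ + Δ_j) - U₋. The two signs of the first term are covered by the two jump
energies, and U₋ itself by the energy. -/
lemma ae_diffSq_le : ∀ᵐ ω ∂P, ∀ s ∈ Set.Ioc 0 T, D.diffSq (s, ω)
    ≤ 2 * (D.jumpEnergy (s, ω) + D.swap.jumpEnergy (s, ω))
      + 2 * (ENNReal.ofReal m * D.energy (s, ω)) := by
  filter_upwards [D.ae_swap_gapLeft_eq, D.ae_enorm_gapLeft_sq_le] with ω h h' s hs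
  have h1 : ∀ j, ‖D.jump j (s, ω)‖ₑ ^ 2
      ≤ 2 * (D.upperJump j (s, ω) ^ 2 + D.swap.upperJump j (s, ω) ^ 2) + 2 * D.energy (s, ω) := by
    intro j
    have e : D.jump j (s, ω) = (D.gapLeft (s, ω) + D.jump j (s, ω)) - D.gapLeft (s, ω) := by ring
    rw [e]
    refine (enorm_sub_sq_le _ _).trans ?_
    gcongr
    · refine (enorm_sq_le_ofReal_add _).trans (add_le_add ?_ ?_)
      · exact pow_le_pow_left₀ zero_le (le_max_left _ _) 2
      · rw [neg_add, ← h s hs, ← D.swap_jump]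
        exact pow_le_pow_left₀ zero_le (le_max_left _ _) 2
    · exact h' s hs
  rw [diffSq_eq, jumpEnergy, jumpEnergy, ← Finset.sum_add_distrib, Finset.mul_sum]
  calc _ ≤ ∑ j, ENNReal.ofReal (C.intensity j s ω) * (2 * (D.upperJump j (s, ω) ^ 2
        + D.swap.upperJump j (s, ω) ^ 2) + 2 * D.energy (s, ω)) := by
        gcongr with j
        exact h1 j
    _ = ∑ j, 2 * (ENNReal.ofReal (C.intensity j s ω) * D.upperJump j (s, ω) ^ 2
          + ENNReal.ofReal (C.intensity j s ω) * D.swap.upperJump j (s, ω) ^ 2)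
        + 2 * ((∑ j, ENNReal.ofReal (C.intensity j s ω)) * D.energy (s, ω)) := by
        rw [Finset.sum_mul, Finset.mul_sum, ← Finset.sum_add_distrib]
        exact Finset.sum_congr rfl fun j _ => by ring
    _ ≤ _ := by
        gcongr
        exact D.sum_intensity_le hs.2 ω

lemma ae_gapLeft_eq : ∀ᵐ ω ∂P, ∀ s ∈ Set.Ioc 0 T, s ∉ C.jumps ω →
    D.gapLeft (s, ω) = D.valueLeft (s, ω) + D.pertInt s ω := by
  filter_upwards [D.ae_isReflectedPath, D.ae_valueLeft_eq] with ω h1 h2 s hs hsJ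
  have h3 : D.gapLeft (s, ω) = D.gap s ω := h1.left_eq s hs.2 hsJ
  rw [h3, h2 s hs hsJ, gap]

lemma ae_enorm_valueLeft_sq_le : ∀ᵐ ω ∂P, ∀ s ∈ Set.Ioc 0 T, s ∉ C.jumps ω →
    ‖D.valueLeft (s, ω)‖ₑ ^ 2 ≤ 2 * D.energy (s, ω) + 2 * D.pertVar ω ^ 2 := by
  filter_upwards [D.ae_gapLeft_eq, D.ae_enorm_gapLeft_sq_le, D.ae_enorm_pertInt_le]
    with ω h1 h2 h3 s hs hsJ
  have e : D.valueLeft (s, ω) = D.gapLeft (s, ω) - D.pertInt s ω := by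
    rw [h1 s hs hsJ]
    ring
  rw [e]
  refine (enorm_sub_sq_le _ _).trans ?_
  gcongr
  · exact h2 s hs
  · exact h3 s hs.2

/-- An integrable bound of `upperLeft`. -/
noncomputable def roughBound (p : ℝ≥0 × Ω) : ℝ≥0∞ :=
  4 * ‖D.valueLeft p‖ₑ ^ 2 + (4 * D.pertVar p.2 ^ 2 + D.level (T, p.2) ^ 2)

lemma ae_two_mul_enorm_gapLeft_sq_le : ∀ᵐ ω ∂P, ∀ s ∈ Set.Ioc 0 T, s ∉ C.jumps ω →
    2 * ‖D.gapLeft (s, ω)‖ₑ ^ 2 + D.level (s, ω) ^ 2 ≤ D.roughBound (s, ω) := by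
  filter_upwards [D.ae_gapLeft_eq, D.ae_enorm_pertInt_le] with ω h1 h2 s hs hsJ
  rw [h1 s hs hsJ, roughBound, ← add_assoc]
  refine add_le_add ?_ (pow_le_pow_left₀ zero_le (D.level_mono ω hs.2) 2)
  calc _ ≤ 2 * (2 * ‖D.valueLeft (s, ω)‖ₑ ^ 2 + 2 * ‖D.pertInt s ω‖ₑ ^ 2) := by
        gcongr
        exact enorm_add_sq_le _ _
    _ = 4 * ‖D.valueLeft (s, ω)‖ₑ ^ 2 + 4 * ‖D.pertInt s ω‖ₑ ^ 2 := by ring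
    _ ≤ _ := by
        gcongr
        exact h2 s hs.2

lemma lintegral_diffSq_ne_top :
    ∫⁻ ω, ∫⁻ s in Set.Ioc 0 T, D.diffSq (s, ω) ∂lebesgue ∂P ≠ ∞ := by
  have hm : ∀ {Z : ℝ≥0 → Ω → (Fin N → ℝ)}, C.InP2F T Z →
      Measurable fun p : ℝ≥0 × Ω => ENNReal.ofReal (C.seminormSq p.1 p.2 (Z p.1 p.2)) := fun hZ =>
    (C.measurable_seminormSq predictable_le_prod hZ.measurable).ennreal_ofReal
  have h1 : ∫⁻ ω, ∫⁻ s in Set.Ioc 0 T, D.diffSq (s, ω) ∂lebesgue ∂P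
      ≤ ∫⁻ ω, ∫⁻ s in Set.Ioc 0 T, (2 * ENNReal.ofReal (C.seminormSq s ω (D.Z₁ s ω))
        + 2 * ENNReal.ofReal (C.seminormSq s ω (D.Z₂ s ω))) ∂lebesgue ∂P := by
    refine lintegral_mono fun ω => lintegral_mono fun s => ?_
    simp only [C.ofReal_seminormSq_eq, diffSq, diffZ, C.increment_sub]
    rw [Finset.mul_sum, Finset.mul_sum, ← Finset.sum_add_distrib]
    refine Finset.sum_le_sum fun j _ => ?_
    calc _ ≤ ENNReal.ofReal (C.intensity j s ω) * (2 * ‖C.increment j s ω (D.Z₁ s ω)‖ₑ ^ 2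
          + 2 * ‖C.increment j s ω (D.Z₂ s ω)‖ₑ ^ 2) := by
          gcongr
          exact enorm_sub_sq_le _ _
      _ = _ := by ring
  refine ne_top_of_le_ne_top ?_ h1
  rw [lintegral_setLIntegral_add
      (F := fun p => 2 * ENNReal.ofReal (C.seminormSq p.1 p.2 (D.Z₁ p.1 p.2)))
      (F' := fun p => 2 * ENNReal.ofReal (C.seminormSq p.1 p.2 (D.Z₂ p.1 p.2)))
      ((hm D.sol₁.memZ).const_mul 2),
    lintegral_setLIntegral_const_mul ENNReal.ofNat_ne_top
      (F := fun p => ENNReal.ofReal (C.seminormSq p.1 p.2 (D.Z₁ p.1 p.2))),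
    lintegral_setLIntegral_const_mul ENNReal.ofNat_ne_top
      (F := fun p => ENNReal.ofReal (C.seminormSq p.1 p.2 (D.Z₂ p.1 p.2)))]
  have h2 := D.sol₁.memZ.sq_integrable.ne
  have h3 := D.sol₂.memZ.sq_integrable.ne
  rw [restrict_Icc_eq_restrict_Ioc] at h2 h3
  exact ENNReal.add_ne_top.2 ⟨ENNReal.mul_ne_top ENNReal.ofNat_ne_top h2,
    ENNReal.mul_ne_top ENNReal.ofNat_ne_top h3⟩

lemma _root_.MarkovRBSDE.MarkovChain.InL2F.lintegral_rightVersion_ne_top {V : ℝ≥0 → Ω → ℝ}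
    (hV : C.InL2F T V) :
    ∫⁻ ω, ∫⁻ s in Set.Ioc 0 T, ‖rightVersion T V (s, ω)‖ₑ ^ 2 ∂lebesgue ∂P ≠ ∞ := by
  have h := hV.sq_integrable.ne
  rw [restrict_Icc_eq_restrict_Ioc] at h
  convert h using 1
  refine lintegral_congr_ae ?_
  filter_upwards [hV.ae_eq] with ω hω
  exact setLIntegral_congr_fun measurableSet_Ioc fun s hs => by simp only [hω s hs.2]

lemma lintegral_valueLeft_sq_ne_top :
    ∫⁻ ω, ∫⁻ s in Set.Ioc 0 T, ‖D.valueLeft (s, ω)‖ₑ ^ 2 ∂lebesgue ∂P ≠ ∞ := by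
  have hm₁ : Measurable fun p => 2 * ‖rightVersion T D.V₁ p‖ₑ ^ 2 :=
    (D.sol₁.memV.measurable_rightVersion.enorm.pow_const 2).const_mul 2
  have h1 : ∫⁻ ω, ∫⁻ s in Set.Ioc 0 T, ‖D.valueLeft (s, ω)‖ₑ ^ 2 ∂lebesgue ∂P
      ≤ ∫⁻ ω, ∫⁻ s in Set.Ioc 0 T, (2 * ‖rightVersion T D.V₁ (s, ω)‖ₑ ^ 2
        + 2 * ‖rightVersion T D.V₂ (s, ω)‖ₑ ^ 2) ∂lebesgue ∂P := by
    refine lintegral_setLIntegral_mono (F := fun p => ‖D.valueLeft p‖ₑ ^ 2)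
      (F' := fun p => 2 * ‖rightVersion T D.V₁ p‖ₑ ^ 2 + 2 * ‖rightVersion T D.V₂ p‖ₑ ^ 2) ?_
    filter_upwards [D.ae_valueLeft_eq, D.sol₁.memV.ae_eq, D.sol₂.memV.ae_eq] with ω h1 h2 h3
    filter_upwards [C.ae_notMem_jumps ω] with s hsJ hs
    rw [h1 s hs hsJ, h2 s hs.2, h3 s hs.2]
    exact enorm_sub_sq_le _ _
  refine ne_top_of_le_ne_top ?_ h1
  rw [lintegral_setLIntegral_add (F' := fun p => 2 * ‖rightVersion T D.V₂ p‖ₑ ^ 2) hm₁,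
    lintegral_setLIntegral_const_mul ENNReal.ofNat_ne_top
      (F := fun p => ‖rightVersion T D.V₁ p‖ₑ ^ 2),
    lintegral_setLIntegral_const_mul ENNReal.ofNat_ne_top
      (F := fun p => ‖rightVersion T D.V₂ p‖ₑ ^ 2)]
  exact ENNReal.add_ne_top.2
    ⟨ENNReal.mul_ne_top ENNReal.ofNat_ne_top D.sol₁.memV.lintegral_rightVersion_ne_top,
      ENNReal.mul_ne_top ENNReal.ofNat_ne_top D.sol₂.memV.lintegral_rightVersion_ne_top⟩

lemma lintegral_setLIntegral_of_time (F : Ω → ℝ≥0∞) (t : ℝ≥0) :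
    ∫⁻ ω, ∫⁻ _ in Set.Ioc t T, F ω ∂lebesgue ∂P ≤ T * ∫⁻ ω, F ω ∂P := by
  rw [← lintegral_const_mul' _ _ ENNReal.coe_ne_top]
  refine lintegral_mono fun ω => ?_
  rw [setLIntegral_const, mul_comm]
  gcongr
  exact lebesgue_Ioc_le t T

/-- A purely qualitative fact: it supplies the finiteness that absorption and Gronwall's inequality
require, and its size does not enter any constant. -/
lemma lintegral_roughBound_ne_top (hdata : ∫⁻ ω, D.data ω ∂P ≠ ∞) :
    ∫⁻ ω, ∫⁻ s in Set.Ioc 0 T, D.roughBound (s, ω) ∂lebesgue ∂P ≠ ∞ := by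
  have hm : Measurable fun p => 4 * ‖D.valueLeft p‖ₑ ^ 2 :=
    ((D.measurable_valueLeft.mono predictable_le_prod le_rfl).enorm.pow_const 2).const_mul 4
  have h1 : ∫⁻ ω, (4 * D.pertVar ω ^ 2 + D.level (T, ω) ^ 2) ∂P ≠ ∞ := by
    refine ne_top_of_le_ne_top (b := 6 * ∫⁻ ω, D.data ω ∂P)
      (ENNReal.mul_ne_top ENNReal.ofNat_ne_top hdata) ?_
    rw [← lintegral_const_mul' _ _ ENNReal.ofNat_ne_top]
    refine lintegral_mono_ae ?_
    filter_upwards [D.ae_level_sq_le] with ω hω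
    calc _ ≤ 4 * D.data ω + 2 * D.data ω := by
          gcongr
          exact D.pertVar_sq_le ω
      _ = _ := by ring
  simp only [roughBound]
  rw [lintegral_setLIntegral_add (F' := fun p => 4 * D.pertVar p.2 ^ 2 + D.level (T, p.2) ^ 2) hm,
    lintegral_setLIntegral_const_mul ENNReal.ofNat_ne_top (F := fun p => ‖D.valueLeft p‖ₑ ^ 2)]
  exact ENNReal.add_ne_top.2
    ⟨ENNReal.mul_ne_top ENNReal.ofNat_ne_top D.lintegral_valueLeft_sq_ne_top,
      ne_top_of_le_ne_top (ENNReal.mul_ne_top ENNReal.coe_ne_top h1)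
        (lintegral_setLIntegral_of_time _ 0)⟩

lemma lintegral_upperLeft_sq_ne_top (hdata : ∫⁻ ω, D.data ω ∂P ≠ ∞) :
    ∫⁻ ω, ∫⁻ s in Set.Ioc 0 T, D.upperLeft (s, ω) ^ 2 ∂lebesgue ∂P ≠ ∞ := by
  refine ne_top_of_le_ne_top (D.lintegral_roughBound_ne_top hdata)
    (lintegral_setLIntegral_mono (F := fun p => D.upperLeft p ^ 2) ?_)
  filter_upwards [D.ae_two_mul_enorm_gapLeft_sq_le] with ω hω
  filter_upwards [C.ae_notMem_jumps ω] with s hsJ hs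
  refine (max_sq_le_add _ _).trans (le_trans ?_ (hω s hs hsJ))
  gcongr
  rw [two_mul]
  exact (pow_le_pow_left₀ zero_le (ofReal_le_enorm _) 2).trans le_self_add

lemma lintegral_jumpEnergy_ne_top (hdata : ∫⁻ ω, D.data ω ∂P ≠ ∞) :
    ∫⁻ ω, ∫⁻ s in Set.Ioc 0 T, D.jumpEnergy (s, ω) ∂lebesgue ∂P ≠ ∞ := by
  have hb : ∫⁻ ω, ∫⁻ s in Set.Ioc 0 T, D.jumpEnergy (s, ω) ∂lebesgue ∂P
      ≤ ∫⁻ ω, ∫⁻ s in Set.Ioc 0 T, (2 * D.diffSq (s, ω)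
        + ENNReal.ofReal m * D.roughBound (s, ω)) ∂lebesgue ∂P := by
    refine lintegral_setLIntegral_mono
      (F' := fun p => 2 * D.diffSq p + ENNReal.ofReal m * D.roughBound p) ?_
    filter_upwards [D.ae_two_mul_enorm_gapLeft_sq_le] with ω hω
    filter_upwards [C.ae_notMem_jumps ω] with s hsJ hs
    have h1 : ∀ j, D.upperJump j (s, ω) ^ 2 ≤ 2 * ‖D.jump j (s, ω)‖ₑ ^ 2 + D.roughBound (s, ω) := by
      intro j
      refine (max_sq_le_add _ _).trans ?_
      calc _ ≤ (2 * ‖D.gapLeft (s, ω)‖ₑ ^ 2 + 2 * ‖D.jump j (s, ω)‖ₑ ^ 2) + D.level (s, ω) ^ 2 := by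
            gcongr
            exact (pow_le_pow_left₀ zero_le (ofReal_le_enorm _) 2).trans (enorm_add_sq_le _ _)
        _ = 2 * ‖D.jump j (s, ω)‖ₑ ^ 2 + (2 * ‖D.gapLeft (s, ω)‖ₑ ^ 2 + D.level (s, ω) ^ 2) := by
            ring
        _ ≤ _ := by
            gcongr
            exact hω s hs hsJ
    calc D.jumpEnergy (s, ω) ≤ ∑ j, ENNReal.ofReal (C.intensity j s ω)
          * (2 * ‖D.jump j (s, ω)‖ₑ ^ 2 + D.roughBound (s, ω)) := by
          rw [jumpEnergy]
          gcongr with j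
          exact h1 j
      _ = 2 * D.diffSq (s, ω)
          + (∑ j, ENNReal.ofReal (C.intensity j s ω)) * D.roughBound (s, ω) := by
          rw [diffSq_eq, Finset.sum_mul, Finset.mul_sum, ← Finset.sum_add_distrib]
          exact Finset.sum_congr rfl fun j _ => by ring
      _ ≤ _ := by
          gcongr
          exact D.sum_intensity_le hs.2 ω
  refine ne_top_of_le_ne_top ?_ hb
  rw [lintegral_setLIntegral_add (F' := fun p => ENNReal.ofReal m * D.roughBound p)
      (D.measurable_diffSq.const_mul 2),
    lintegral_setLIntegral_const_mul ENNReal.ofNat_ne_top (F := D.diffSq),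
    lintegral_setLIntegral_const_mul ENNReal.ofReal_ne_top (F := D.roughBound)]
  exact ENNReal.add_ne_top.2 ⟨ENNReal.mul_ne_top ENNReal.ofNat_ne_top D.lintegral_diffSq_ne_top,
    ENNReal.mul_ne_top ENNReal.ofReal_ne_top (D.lintegral_roughBound_ne_top hdata)⟩

end SolutionPair

/-- The factor of the data in the energy estimate. -/
noncomputable def dataConst (c' : ℝ) (T : ℝ≥0) : ℝ≥0∞ := 8 + 4 * (ENNReal.ofReal c' * T)

lemma dataConst_ne_top (c' : ℝ) (T : ℝ≥0) : dataConst c' T ≠ ∞ := by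
  unfold dataConst
  finiteness

/-- The factor of the data in the estimate of the integrated energy. -/
noncomputable def energyConst (c' m : ℝ) (T : ℝ≥0) : ℝ≥0∞ :=
  gronwallConst (5 * c' + 9 * m) T * dataConst c' T

lemma energyConst_ne_top (c' m : ℝ) (T : ℝ≥0) : energyConst c' m T ≠ ∞ :=
  ENNReal.mul_ne_top (gronwallConst_ne_top _ _) (dataConst_ne_top _ _)

/-- The factor of the data in the estimate of the energy at one time. -/
noncomputable def timeConst (c' m : ℝ) (T : ℝ≥0) : ℝ≥0∞ :=
  2 * dataConst c' T + 2 * (ENNReal.ofReal (5 * c' + 9 * m) * energyConst c' m T)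

lemma timeConst_ne_top (c' m : ℝ) (T : ℝ≥0) : timeConst c' m T ≠ ∞ := by
  have h1 := dataConst_ne_top c' T
  have h2 := energyConst_ne_top c' m T
  unfold timeConst
  finiteness

/-! ### Gronwall's inequality and the estimates of v and z. -/

namespace SolutionPair

variable {Ω : Type*} [mΩ : MeasurableSpace Ω] {P : Measure Ω} {N : ℕ}
  {C : MarkovChain P N} {T : ℝ≥0} {c' c'' m : ℝ} (D : SolutionPair C T c' c'' m)

lemma lintegral_swap_data : ∫⁻ ω, D.swap.data ω ∂P = ∫⁻ ω, D.data ω ∂P := by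
  simp_rw [swap_data]

/-- The two orders of the solutions are added. Since |v|² is at most twice the energy plus 2(∫|φ₁ -
φ₂|)², the term 4c'|v|² turns the rate 2c' + 18m into 10c' + 18m. The data collect 8 + 8 from the
terminal values and 8c'T from the perturbations. -/
lemma lintegral_energy_step [IsProbabilityMeasure P] (hdata : ∫⁻ ω, D.data ω ∂P ≠ ∞) {t : ℝ≥0}
    (ht : t ≤ T) :
    2 * (∫⁻ ω, D.upper t ω ^ 2 ∂P + ∫⁻ ω, D.swap.upper t ω ^ 2 ∂P)
        + (∫⁻ ω, ∫⁻ s in Set.Ioc t T, D.jumpEnergy (s, ω) ∂lebesgue ∂P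
          + ∫⁻ ω, ∫⁻ s in Set.Ioc t T, D.swap.jumpEnergy (s, ω) ∂lebesgue ∂P)
      ≤ 2 * (dataConst c' T * ∫⁻ ω, D.data ω ∂P) + 2 * (ENNReal.ofReal (5 * c' + 9 * m)
        * ∫⁻ ω, ∫⁻ s in Set.Ioc t T, D.energy (s, ω) ∂lebesgue ∂P) := by
  have hc := D.lip_nonneg
  have hm := D.rate_pos
  have hdata' : ∫⁻ ω, D.swap.data ω ∂P ≠ ∞ := by rwa [D.lintegral_swap_data]
  have hfin := (D.lintegral_jumpEnergy_ne_top hdata).lt_top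
  have hfin' := (D.swap.lintegral_jumpEnergy_ne_top hdata').lt_top
  rw [← restrict_Icc_eq_restrict_Ioc] at hfin hfin'
  have h1 := D.lintegral_upper_sq_add_le hfin ht
  have h2 := D.swap.lintegral_upper_sq_add_le hfin' ht
  have hT := D.lintegral_upper_terminal_sq_le
  have hT' := D.swap.lintegral_upper_terminal_sq_le
  rw [D.lintegral_swap_data] at hT'
  have hmU : Measurable D.upperLeft := D.measurable_upperLeft.mono predictable_le_prod le_rfl
  have hmv : Measurable D.valueLeft := D.measurable_valueLeft.mono predictable_le_prod le_rfl
  have hm1 : Measurable fun p => ENNReal.ofReal (2 * c' + 18 * m) * D.upperLeft p ^ 2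
      + ENNReal.ofReal (2 * c') * ‖D.valueLeft p‖ₑ ^ 2 :=
    ((hmU.pow_const 2).const_mul _).add ((hmv.enorm.pow_const 2).const_mul _)
  have e1 : ENNReal.ofReal (2 * c' + 18 * m) = 2 * ENNReal.ofReal c' + 18 * ENNReal.ofReal m := by
    rw [ENNReal.ofReal_add (by positivity) (by positivity), ENNReal.ofReal_mul zero_le_two,
      ENNReal.ofReal_mul (by norm_num), ENNReal.ofReal_ofNat, ENNReal.ofReal_ofNat]
  have e2 : ENNReal.ofReal (2 * c') = 2 * ENNReal.ofReal c' := by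
    rw [ENNReal.ofReal_mul zero_le_two, ENNReal.ofReal_ofNat]
  have e3 : ENNReal.ofReal (5 * c' + 9 * m) = 5 * ENNReal.ofReal c' + 9 * ENNReal.ofReal m := by
    rw [ENNReal.ofReal_add (by positivity) (by positivity), ENNReal.ofReal_mul (by norm_num),
      ENNReal.ofReal_mul (by norm_num), ENNReal.ofReal_ofNat, ENNReal.ofReal_ofNat]
  have h3 : ∫⁻ ω, ∫⁻ s in Set.Ioc t T, (ENNReal.ofReal (2 * c' + 18 * m) * D.upperLeft (s, ω) ^ 2
          + ENNReal.ofReal (2 * c') * ‖D.valueLeft (s, ω)‖ₑ ^ 2) ∂lebesgue ∂P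
      + ∫⁻ ω, ∫⁻ s in Set.Ioc t T, (ENNReal.ofReal (2 * c' + 18 * m) * D.swap.upperLeft (s, ω) ^ 2
          + ENNReal.ofReal (2 * c') * ‖D.swap.valueLeft (s, ω)‖ₑ ^ 2) ∂lebesgue ∂P
      ≤ 2 * (ENNReal.ofReal (5 * c' + 9 * m)
          * ∫⁻ ω, ∫⁻ s in Set.Ioc t T, D.energy (s, ω) ∂lebesgue ∂P)
        + 8 * ENNReal.ofReal c' * (T * ∫⁻ ω, D.data ω ∂P) := by
    rw [← lintegral_setLIntegral_add
      (F' := fun p => ENNReal.ofReal (2 * c' + 18 * m) * D.swap.upperLeft p ^ 2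
        + ENNReal.ofReal (2 * c') * ‖D.swap.valueLeft p‖ₑ ^ 2) hm1]
    calc _ ≤ ∫⁻ ω, ∫⁻ s in Set.Ioc t T, (2 * ENNReal.ofReal (5 * c' + 9 * m) * D.energy (s, ω)
          + 8 * ENNReal.ofReal c' * D.pertVar ω ^ 2) ∂lebesgue ∂P := by
          refine lintegral_setLIntegral_mono
            (F := fun p => (ENNReal.ofReal (2 * c' + 18 * m) * D.upperLeft p ^ 2
              + ENNReal.ofReal (2 * c') * ‖D.valueLeft p‖ₑ ^ 2)
              + (ENNReal.ofReal (2 * c' + 18 * m) * D.swap.upperLeft p ^ 2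
              + ENNReal.ofReal (2 * c') * ‖D.swap.valueLeft p‖ₑ ^ 2))
            (F' := fun p => 2 * ENNReal.ofReal (5 * c' + 9 * m) * D.energy p
              + 8 * ENNReal.ofReal c' * D.pertVar p.2 ^ 2) ?_
          filter_upwards [D.ae_enorm_valueLeft_sq_le] with ω hω
          filter_upwards [C.ae_notMem_jumps ω] with s hsJ hs
          have h4 := hω s ⟨zero_le.trans_lt hs.1, hs.2⟩ hsJ
          simp only [swap_valueLeft, enorm_neg]
          calc _ = ENNReal.ofReal (2 * c' + 18 * m) * D.energy (s, ω)
                + 2 * ENNReal.ofReal (2 * c') * ‖D.valueLeft (s, ω)‖ₑ ^ 2 := by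
                rw [energy]
                ring
            _ ≤ ENNReal.ofReal (2 * c' + 18 * m) * D.energy (s, ω)
                + 2 * ENNReal.ofReal (2 * c') * (2 * D.energy (s, ω) + 2 * D.pertVar ω ^ 2) := by
                gcongr
            _ = _ := by
                rw [e1, e2, e3]
                ring
      _ = 2 * ENNReal.ofReal (5 * c' + 9 * m)
            * ∫⁻ ω, ∫⁻ s in Set.Ioc t T, D.energy (s, ω) ∂lebesgue ∂P
          + 8 * ENNReal.ofReal c' * ∫⁻ ω, ∫⁻ s in Set.Ioc t T, D.pertVar ω ^ 2 ∂lebesgue ∂P := by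
          rw [lintegral_setLIntegral_add (F := fun p => 2 * ENNReal.ofReal (5 * c' + 9 * m)
              * D.energy p) (F' := fun p => 8 * ENNReal.ofReal c' * D.pertVar p.2 ^ 2)
              (D.measurable_energy.const_mul _),
            lintegral_setLIntegral_const_mul (by finiteness) (F := D.energy),
            lintegral_setLIntegral_const_mul (by finiteness) (F := fun p => D.pertVar p.2 ^ 2)]
      _ ≤ _ := by
          rw [mul_assoc]
          gcongr
          refine (lintegral_setLIntegral_of_time (fun ω => D.pertVar ω ^ 2) t).trans ?_
          gcongr with ω
          exact D.pertVar_sq_le ω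
  have h4 := add_le_add h1 h2
  rw [add_add_add_comm, add_add_add_comm (2 * ∫⁻ ω, D.upper T ω ^ 2 ∂P)] at h4
  rw [mul_add]
  refine h4.trans ((add_le_add (add_le_add (mul_le_mul_right hT 2) (mul_le_mul_right hT' 2))
    h3).trans (le_of_eq ?_))
  rw [dataConst]
  ring

/-- The energy is built from left limits in order to be predictable. At a fixed time the chain
almost surely does not jump, so this is invisible in expectation and the energy step closes on
itself. -/
lemma lintegral_energy_eq [IsProbabilityMeasure P] {t : ℝ≥0} (ht : t ≤ T) :
    ∫⁻ ω, D.energy (t, ω) ∂P = ∫⁻ ω, D.upper t ω ^ 2 ∂P + ∫⁻ ω, D.swap.upper t ω ^ 2 ∂P := by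
  rw [← lintegral_add_left ((D.measurable_upper ht).pow_const 2)]
  refine lintegral_congr_ae ?_
  filter_upwards [D.ae_upperLeft_eq, D.swap.ae_upperLeft_eq, C.ae_notMem_jumps_of_time t]
    with ω h1 h2 h3
  have hJ : t ∉ C.jumps ω := fun h => h h3
  rw [energy, h1 t ht hJ, h2 t ht hJ]

lemma lintegral_energy_le [IsProbabilityMeasure P] (hdata : ∫⁻ ω, D.data ω ∂P ≠ ∞) :
    ∫⁻ ω, ∫⁻ s in Set.Ioc 0 T, D.energy (s, ω) ∂lebesgue ∂P
      ≤ energyConst c' m T * ∫⁻ ω, D.data ω ∂P := by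
  have hc := D.lip_nonneg
  have hm := D.rate_pos
  have hswap : ∀ t, ∫⁻ ω, ∫⁻ s in Set.Ioc t T, D.energy (s, ω) ∂lebesgue ∂P
      = ∫⁻ s in Set.Ioc t T, ∫⁻ ω, D.energy (s, ω) ∂P ∂lebesgue := fun t =>
    lintegral_lintegral_swap (D.measurable_energy.comp measurable_swap).aemeasurable
  have hfin : ∫⁻ ω, ∫⁻ s in Set.Ioc 0 T, D.energy (s, ω) ∂lebesgue ∂P ≠ ∞ := by
    simp only [energy]
    rw [lintegral_setLIntegral_add (F := fun p => D.upperLeft p ^ 2)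
      (F' := fun p => D.swap.upperLeft p ^ 2)
      ((D.measurable_upperLeft.mono predictable_le_prod le_rfl).pow_const 2)]
    exact ENNReal.add_ne_top.2 ⟨D.lintegral_upperLeft_sq_ne_top hdata,
      D.swap.lintegral_upperLeft_sq_ne_top (by rwa [D.lintegral_swap_data])⟩
  rw [hswap] at hfin ⊢
  rw [energyConst, mul_assoc]
  refine lintegral_le_of_le_backward (by positivity) D.measurable_energy.lintegral_prod_right'
    (fun t ht => ?_) hfin
  -- The jump energies are dropped for Gronwall's inequality; inserting its result into the same
  -- step recovers them afterwards.
  have h1 := le_self_add.trans (D.lintegral_energy_step hdata ht.2)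
  rw [← D.lintegral_energy_eq ht.2, ← mul_add, hswap] at h1
  exact (ENNReal.mul_le_mul_iff_right two_ne_zero ENNReal.ofNat_ne_top).1 h1

lemma lintegral_upper_add_jumpEnergy_le [IsProbabilityMeasure P] (hdata : ∫⁻ ω, D.data ω ∂P ≠ ∞)
    {t : ℝ≥0} (ht : t ≤ T) :
    2 * (∫⁻ ω, D.upper t ω ^ 2 ∂P + ∫⁻ ω, D.swap.upper t ω ^ 2 ∂P)
        + (∫⁻ ω, ∫⁻ s in Set.Ioc t T, D.jumpEnergy (s, ω) ∂lebesgue ∂P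
          + ∫⁻ ω, ∫⁻ s in Set.Ioc t T, D.swap.jumpEnergy (s, ω) ∂lebesgue ∂P)
      ≤ timeConst c' m T * ∫⁻ ω, D.data ω ∂P := by
  refine (D.lintegral_energy_step hdata ht).trans ?_
  have h1 : ∫⁻ ω, ∫⁻ s in Set.Ioc t T, D.energy (s, ω) ∂lebesgue ∂P
      ≤ energyConst c' m T * ∫⁻ ω, D.data ω ∂P :=
    (lintegral_mono fun ω => lintegral_mono_set (Set.Ioc_subset_Ioc_left zero_le)).trans
      (D.lintegral_energy_le hdata)
  calc _ ≤ 2 * (dataConst c' T * ∫⁻ ω, D.data ω ∂P) + 2 * (ENNReal.ofReal (5 * c' + 9 * m)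
        * (energyConst c' m T * ∫⁻ ω, D.data ω ∂P)) := by gcongr
    _ = _ := by
        rw [timeConst]
        ring

/-- The estimate of the difference of the values. -/
lemma lintegral_value_sq_le [IsProbabilityMeasure P] (hdata : ∫⁻ ω, D.data ω ∂P ≠ ∞)
    {t : ℝ≥0} (ht : t ≤ T) :
    ∫⁻ ω, ‖D.V₁ t ω - D.V₂ t ω‖ₑ ^ 2 ∂P ≤ (timeConst c' m T + 2) * ∫⁻ ω, D.data ω ∂P := by
  have hmU : Measurable fun ω => 2 * (D.upper t ω ^ 2 + D.swap.upper t ω ^ 2) :=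
    (((D.measurable_upper ht).pow_const 2).add ((D.swap.measurable_upper ht).pow_const 2)).const_mul 2
  calc ∫⁻ ω, ‖D.V₁ t ω - D.V₂ t ω‖ₑ ^ 2 ∂P
      ≤ ∫⁻ ω, (2 * (D.upper t ω ^ 2 + D.swap.upper t ω ^ 2) + 2 * D.data ω) ∂P := by
        refine lintegral_mono_ae ?_
        filter_upwards [D.ae_enorm_pertInt_le] with ω h
        have e : D.V₁ t ω - D.V₂ t ω = D.gap t ω - D.pertInt t ω := by
          rw [gap]
          ring
        rw [e]
        refine (enorm_sub_sq_le _ _).trans ?_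
        gcongr
        · refine (enorm_sq_le_ofReal_add _).trans (add_le_add ?_ ?_)
          · exact pow_le_pow_left₀ zero_le (le_max_left _ _) 2
          · rw [← D.swap_gap]
            exact pow_le_pow_left₀ zero_le (le_max_left _ _) 2
        · exact (pow_le_pow_left₀ zero_le (h t ht) 2).trans (D.pertVar_sq_le ω)
    _ = 2 * (∫⁻ ω, D.upper t ω ^ 2 ∂P + ∫⁻ ω, D.swap.upper t ω ^ 2 ∂P)
        + 2 * ∫⁻ ω, D.data ω ∂P := by
        rw [lintegral_add_left hmU, lintegral_const_mul' _ _ ENNReal.ofNat_ne_top,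
          lintegral_const_mul' _ _ ENNReal.ofNat_ne_top,
          lintegral_add_left ((D.measurable_upper ht).pow_const 2)]
    _ ≤ _ := by
        rw [add_mul]
        exact add_le_add (le_self_add.trans (D.lintegral_upper_add_jumpEnergy_le hdata ht)) le_rfl

/-- The factor of the data in the estimate of the difference of the integrands. -/
noncomputable def _root_.MarkovRBSDE.integrandConst (c' m : ℝ) (T : ℝ≥0) : ℝ≥0∞ :=
  2 * timeConst c' m T + 2 * (ENNReal.ofReal m * energyConst c' m T)

lemma _root_.MarkovRBSDE.integrandConst_ne_top (c' m : ℝ) (T : ℝ≥0) : integrandConst c' m T ≠ ∞ := by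
  have h1 := timeConst_ne_top c' m T
  have h2 := energyConst_ne_top c' m T
  unfold integrandConst
  finiteness

lemma measurable_jumpEnergy : Measurable D.jumpEnergy := D.measurable_sum_upperJump_sq

/-- The estimate of the difference of the integrands. -/
lemma lintegral_diffSq_le [IsProbabilityMeasure P] (hdata : ∫⁻ ω, D.data ω ∂P ≠ ∞) :
    ∫⁻ ω, ∫⁻ s in Set.Ioc 0 T, D.diffSq (s, ω) ∂lebesgue ∂P
      ≤ integrandConst c' m T * ∫⁻ ω, D.data ω ∂P := by
  have hmJ : Measurable fun p => 2 * (D.jumpEnergy p + D.swap.jumpEnergy p) :=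
    (D.measurable_jumpEnergy.add D.swap.measurable_jumpEnergy).const_mul 2
  calc _ ≤ ∫⁻ ω, ∫⁻ s in Set.Ioc 0 T, (2 * (D.jumpEnergy (s, ω) + D.swap.jumpEnergy (s, ω))
      + 2 * (ENNReal.ofReal m * D.energy (s, ω))) ∂lebesgue ∂P := by
        refine lintegral_setLIntegral_mono
          (F' := fun p => 2 * (D.jumpEnergy p + D.swap.jumpEnergy p)
            + 2 * (ENNReal.ofReal m * D.energy p)) ?_
        filter_upwards [D.ae_diffSq_le] with ω hω
        exact Eventually.of_forall fun s hs => hω s hs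
    _ = 2 * (∫⁻ ω, ∫⁻ s in Set.Ioc 0 T, D.jumpEnergy (s, ω) ∂lebesgue ∂P
          + ∫⁻ ω, ∫⁻ s in Set.Ioc 0 T, D.swap.jumpEnergy (s, ω) ∂lebesgue ∂P)
        + 2 * (ENNReal.ofReal m * ∫⁻ ω, ∫⁻ s in Set.Ioc 0 T, D.energy (s, ω) ∂lebesgue ∂P) := by
        rw [lintegral_setLIntegral_add (F' := fun p => 2 * (ENNReal.ofReal m * D.energy p)) hmJ,
          lintegral_setLIntegral_const_mul ENNReal.ofNat_ne_top
            (F := fun p => D.jumpEnergy p + D.swap.jumpEnergy p),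
          lintegral_setLIntegral_const_mul ENNReal.ofNat_ne_top
            (F := fun p => ENNReal.ofReal m * D.energy p),
          lintegral_setLIntegral_const_mul ENNReal.ofReal_ne_top (F := D.energy),
          lintegral_setLIntegral_add (F' := D.swap.jumpEnergy) D.measurable_jumpEnergy]
    _ ≤ 2 * (timeConst c' m T * ∫⁻ ω, D.data ω ∂P)
        + 2 * (ENNReal.ofReal m * (energyConst c' m T * ∫⁻ ω, D.data ω ∂P)) := by
        gcongr
        · exact le_add_self.trans (D.lintegral_upper_add_jumpEnergy_le hdata zero_le)
        · exact D.lintegral_energy_le hdata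
    _ = _ := by
        rw [integrandConst]
        ring

end SolutionPair

/-- A discrete chain rule for the square of a truncated sum. -/
lemma min_sum_sq_le {α : Type*} [LinearOrder α] (F : Finset α) (h : α → ℝ≥0∞) (n : ℝ≥0∞) :
    min (∑ s ∈ F, h s) n ^ 2
      ≤ ∑ s ∈ F, (2 * (min (∑ u ∈ F with u < s, h u) n * h s) + h s ^ 2) := by
  induction F using Finset.induction_on_max with
  | empty => simp
  | insert a F hlt ih =>
    have ha : a ∉ F := fun h => lt_irrefl _ (hlt a h)
    rw [Finset.sum_insert ha, Finset.sum_insert ha]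
    have e1 : (insert a F).filter (· < a) = F := by
      ext u
      simp only [Finset.mem_filter, Finset.mem_insert]
      exact ⟨fun hu => hu.1.resolve_left hu.2.ne, fun hu => ⟨Or.inr hu, hlt u hu⟩⟩
    have e2 : ∀ s ∈ F, (insert a F).filter (· < s) = F.filter (· < s) := fun s hs => by
      ext u
      simp only [Finset.mem_filter, Finset.mem_insert]
      exact ⟨fun hu => ⟨hu.1.resolve_left fun hua =>
        lt_irrefl _ ((hlt s hs).trans (hua ▸ hu.2)), hu.2⟩, fun hu => ⟨Or.inr hu.1, hu.2⟩⟩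
    have e3 : ∑ s ∈ F, (2 * (min (∑ u ∈ insert a F with u < s, h u) n * h s) + h s ^ 2)
        = ∑ s ∈ F, (2 * (min (∑ u ∈ F with u < s, h u) n * h s) + h s ^ 2) :=
      Finset.sum_congr rfl fun s hs => by rw [e2 s hs]
    rw [e1, e3]
    -- The last term raises the truncated sum by at most h a, and expanding the square of this bound
    -- produces the new summand.
    have h1 : min (h a + ∑ s ∈ F, h s) n ≤ min (∑ s ∈ F, h s) n + h a := by
      rw [add_comm (h a)]
      rcases le_total (∑ s ∈ F, h s) n with hn | hn
      · rw [min_eq_left hn]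
        exact min_le_left _ _
      · rw [min_eq_right hn]
        exact (min_le_right _ _).trans le_self_add
    calc _ ≤ (min (∑ s ∈ F, h s) n + h a) ^ 2 := pow_le_pow_left₀ zero_le h1 2
      _ = (2 * (min (∑ s ∈ F, h s) n * h a) + h a ^ 2) + min (∑ s ∈ F, h s) n ^ 2 := by ring
      _ ≤ _ := by gcongr

/-! ### The second moment of the sum of the absolute jumps. -/

namespace MarkovChain

variable {Ω : Type*} [mΩ : MeasurableSpace Ω] {P : Measure Ω} {N : ℕ} (C : MarkovChain P N)

/-- The sum of the sizes of the jumps of the integral of `Z` up to time `t`. -/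
noncomputable def totalJump (Z : ℝ≥0 × Ω → (Fin N → ℝ)) (t : ℝ≥0) (ω : Ω) : ℝ≥0∞ :=
  ∑ s ∈ (C.finite_jumps_Ioc 0 t ω).toFinset, ‖Z (s, ω) ⬝ᵥ (C.X s ω - C.left s ω)‖ₑ

/-- The sum of the sizes of the jumps of the integral of `Z` before time `t`. -/
noncomputable def totalJumpLeft (Z : ℝ≥0 × Ω → (Fin N → ℝ)) (p : ℝ≥0 × Ω) : ℝ≥0∞ :=
  ⨆ n : ℕ, if TopologicalSpace.denseSeq ℝ≥0 n < p.1 then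
    C.totalJump Z (TopologicalSpace.denseSeq ℝ≥0 n) p.2 else 0

variable {Z : ℝ≥0 × Ω → (Fin N → ℝ)}

lemma totalJump_eq (t : ℝ≥0) (ω : Ω) : C.totalJump Z t ω
    = ∑ j, ∫⁻ s in Set.Ioc 0 t, ‖C.increment j s ω (Z (s, ω))‖ₑ ∂(C.entryMeasure j ω) := by
  rw [totalJump, C.sum_jumps_eq]
  refine Finset.sum_congr rfl fun j _ => ?_
  rw [C.setLIntegral_entryMeasure]
  refine Finset.sum_congr rfl fun s hs => ?_
  rw [C.dotProduct_jump ((Set.Finite.mem_toFinset _).1 hs).1]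

lemma measurable_totalJump (hZ : Measurable[C.filtration.predictable] Z) (t : ℝ≥0) :
    Measurable[C.filtration t] (C.totalJump Z t) := by
  have h : C.totalJump Z t = fun ω => ∑ j,
      ∫⁻ s in Set.Ioc 0 t, ‖C.increment j s ω (Z (s, ω))‖ₑ ∂(C.entryMeasure j ω) :=
    funext fun ω => C.totalJump_eq t ω
  rw [h]
  exact Finset.measurable_sum _ fun j _ => measurable_setLIntegral_of_predictable
    (C.measurable_entryMeasure le_rfl j) (fun _ => inferInstance)
    (measurable_enorm.comp (C.measurable_increment le_rfl hZ j))

lemma measurable_totalJumpLeft (hZ : Measurable[C.filtration.predictable] Z) :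
    Measurable[C.filtration.predictable] (C.totalJumpLeft Z) :=
  Measurable.iSup fun _ => measurable_ite_lt (C.measurable_totalJump hZ _)

/-- Only finitely many jumps precede s, so a dense time between the last of them and s already
collects them all. -/
lemma totalJumpLeft_eq {s t : ℝ≥0} (hst : s ≤ t) (ω : Ω) : C.totalJumpLeft Z (s, ω)
    = ∑ u ∈ (C.finite_jumps_Ioc 0 t ω).toFinset with u < s,
      ‖Z (u, ω) ⬝ᵥ (C.X u ω - C.left u ω)‖ₑ := by
  refine le_antisymm (iSup_le fun n => ?_) ?_
  · split_ifs with hn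
    · refine Finset.sum_le_sum_of_subset fun u hu => ?_
      have hu' := (Set.Finite.mem_toFinset _).1 hu
      have hus : u < s := hu'.2.2.trans_lt hn
      exact Finset.mem_filter.2 ⟨(Set.Finite.mem_toFinset _).2
        ⟨hu'.1, hu'.2.1, hus.le.trans hst⟩, hus⟩
    · exact zero_le
  · rcases ((C.finite_jumps_Ioc 0 t ω).toFinset.filter (· < s)).eq_empty_or_nonempty with h | h
    · rw [h, Finset.sum_empty]
      exact zero_le
    · have hmem := Finset.mem_filter.1 (Finset.max'_mem _ h)
      obtain ⟨n, hn, hn'⟩ := exists_denseSeq_between hmem.2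
      refine le_iSup_of_le n ?_
      rw [if_pos hn']
      refine Finset.sum_le_sum_of_subset fun u hu => ?_
      have hu' := Finset.mem_filter.1 hu
      have hu'' := (Set.Finite.mem_toFinset _).1 hu'.1
      exact (Set.Finite.mem_toFinset _).2
        ⟨hu''.1, hu''.2.1, (Finset.le_max' _ u hu).trans hn.le⟩

lemma totalJumpLeft_eq_totalJump {s : ℝ≥0} {ω : Ω} (hs : s ∉ C.jumps ω) :
    C.totalJumpLeft Z (s, ω) = C.totalJump Z s ω := by
  rw [C.totalJumpLeft_eq le_rfl, totalJump]
  congr 1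
  ext u
  simp only [Finset.mem_filter, Set.Finite.mem_toFinset, and_iff_left_iff_imp]
  rintro ⟨h1, h2⟩
  exact lt_of_le_of_ne h2.2 fun h => hs (h ▸ h1)

lemma min_totalJump_sq_le (n : ℝ≥0∞) (t : ℝ≥0) (ω : Ω) :
    min (C.totalJump Z t ω) n ^ 2 ≤ ∑ j, ∫⁻ s in Set.Ioc 0 t,
      (2 * (min (C.totalJumpLeft Z (s, ω)) n * ‖C.increment j s ω (Z (s, ω))‖ₑ)
        + ‖C.increment j s ω (Z (s, ω))‖ₑ ^ 2) ∂(C.entryMeasure j ω) := by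
  refine (min_sum_sq_le _ _ n).trans (le_of_eq ?_)
  rw [C.sum_jumps_eq]
  refine Finset.sum_congr rfl fun j _ => ?_
  rw [C.setLIntegral_entryMeasure]
  refine Finset.sum_congr rfl fun s hs => ?_
  have hs' := (Set.Finite.mem_toFinset _).1 hs
  rw [C.dotProduct_jump hs'.1, C.totalJumpLeft_eq hs'.2.2]

/-- Compensating the discrete chain rule and using 2xh + h² ≤ x² + 2h², with intensities of total
mass at most m, gives a forward Gronwall inequality for the truncated sum. -/
lemma lintegral_min_totalJump_sq_le [IsProbabilityMeasure P] {T : ℝ≥0} {m : ℝ}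
    (hA : ∀ t ≤ T, matrixNorm (C.A t) ≤ m) (hZ : Measurable[C.filtration.predictable] Z)
    (n : ℝ≥0∞) {t : ℝ≥0} (ht : t ≤ T) :
    ∫⁻ ω, min (C.totalJump Z t ω) n ^ 2 ∂P
      ≤ 2 * ∫⁻ ω, ∫⁻ s in Set.Ioc 0 T, ENNReal.ofReal (C.seminormSq s ω (Z (s, ω))) ∂lebesgue ∂P
        + ENNReal.ofReal m * ∫⁻ s in Set.Ioc 0 t, ∫⁻ ω, min (C.totalJumpLeft Z (s, ω)) n ^ 2 ∂P
          ∂lebesgue := by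
  have hmx : Measurable[C.filtration.predictable] fun p => min (C.totalJumpLeft Z p) n :=
    (C.measurable_totalJumpLeft hZ).min measurable_const
  have hmi : ∀ j, Measurable[C.filtration.predictable]
      fun p : ℝ≥0 × Ω => ‖C.increment j p.1 p.2 (Z p)‖ₑ := fun j =>
    (measurable_enorm.comp (C.measurable_increment le_rfl hZ j))
  have hmS : Measurable fun p : ℝ≥0 × Ω => 2 * ENNReal.ofReal (C.seminormSq p.1 p.2 (Z p)) :=
    ((C.measurable_seminormSq predictable_le_prod
      (hZ.mono predictable_le_prod le_rfl)).ennreal_ofReal).const_mul 2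
  have hmx' : Measurable fun p : ℝ≥0 × Ω => min (C.totalJumpLeft Z p) n ^ 2 :=
    (hmx.mono predictable_le_prod le_rfl).pow_const 2
  calc _ ≤ ∫⁻ ω, ∑ j, ∫⁻ s in Set.Ioc 0 t,
      (2 * (min (C.totalJumpLeft Z (s, ω)) n * ‖C.increment j s ω (Z (s, ω))‖ₑ)
        + ‖C.increment j s ω (Z (s, ω))‖ₑ ^ 2) ∂(C.entryMeasure j ω) ∂P :=
        lintegral_mono fun ω => C.min_totalJump_sq_le n t ω
    _ = ∫⁻ ω, ∫⁻ s in Set.Ioc 0 t, ∑ j, ENNReal.ofReal (C.intensity j s ω)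
        * (2 * (min (C.totalJumpLeft Z (s, ω)) n * ‖C.increment j s ω (Z (s, ω))‖ₑ)
        + ‖C.increment j s ω (Z (s, ω))‖ₑ ^ 2) ∂lebesgue ∂P :=
        C.lintegral_sum_entryMeasure_Ioc 0 t (H := fun j p =>
          2 * (min (C.totalJumpLeft Z p) n * ‖C.increment j p.1 p.2 (Z p)‖ₑ)
            + ‖C.increment j p.1 p.2 (Z p)‖ₑ ^ 2)
          fun j => ((hmx.mul (hmi j)).const_mul 2).add ((hmi j).pow_const 2)
    _ ≤ ∫⁻ ω, ∫⁻ s in Set.Ioc 0 t, (2 * ENNReal.ofReal (C.seminormSq s ω (Z (s, ω)))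
        + ENNReal.ofReal m * min (C.totalJumpLeft Z (s, ω)) n ^ 2) ∂lebesgue ∂P := by
        refine lintegral_mono fun ω => setLIntegral_mono' measurableSet_Ioc fun s hs => ?_
        rw [C.ofReal_seminormSq_eq]
        calc _ ≤ ∑ j, ENNReal.ofReal (C.intensity j s ω) * ((min (C.totalJumpLeft Z (s, ω)) n ^ 2
              + ‖C.increment j s ω (Z (s, ω))‖ₑ ^ 2) + ‖C.increment j s ω (Z (s, ω))‖ₑ ^ 2) := by
              gcongr
              exact two_mul_mul_le_add_sq _ _
          _ = 2 * ∑ j, ENNReal.ofReal (C.intensity j s ω) * ‖C.increment j s ω (Z (s, ω))‖ₑ ^ 2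
              + (∑ j, ENNReal.ofReal (C.intensity j s ω))
                * min (C.totalJumpLeft Z (s, ω)) n ^ 2 := by
              rw [Finset.sum_mul, Finset.mul_sum, ← Finset.sum_add_distrib]
              exact Finset.sum_congr rfl fun j _ => by ring
          _ ≤ _ := by
              gcongr
              rw [← ENNReal.ofReal_sum_of_nonneg fun j _ => C.intensity_nonneg j s ω]
              exact ENNReal.ofReal_le_ofReal (C.sum_intensity_le (hA s (hs.2.trans ht)) ω)
    _ = 2 * ∫⁻ ω, ∫⁻ s in Set.Ioc 0 t, ENNReal.ofReal (C.seminormSq s ω (Z (s, ω))) ∂lebesgue ∂P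
        + ENNReal.ofReal m * ∫⁻ ω, ∫⁻ s in Set.Ioc 0 t, min (C.totalJumpLeft Z (s, ω)) n ^ 2
          ∂lebesgue ∂P := by
        rw [lintegral_setLIntegral_add
            (F' := fun p => ENNReal.ofReal m * min (C.totalJumpLeft Z p) n ^ 2) hmS,
          lintegral_setLIntegral_const_mul ENNReal.ofNat_ne_top
            (F := fun p => ENNReal.ofReal (C.seminormSq p.1 p.2 (Z p))),
          lintegral_setLIntegral_const_mul ENNReal.ofReal_ne_top
            (F := fun p => min (C.totalJumpLeft Z p) n ^ 2)]
    _ ≤ _ := by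
        rw [lintegral_lintegral_swap
          (f := fun ω s => min (C.totalJumpLeft Z (s, ω)) n ^ 2)
          (hmx'.comp measurable_swap).aemeasurable]
        gcongr 2 * ?_ + _
        exact lintegral_mono fun ω => lintegral_mono_set (Set.Ioc_subset_Ioc_right ht)

/-- The factor in the estimate of the second moment of the total jump. -/
noncomputable def _root_.MarkovRBSDE.jumpConst (m : ℝ) (T : ℝ≥0) : ℝ≥0∞ :=
  2 + ENNReal.ofReal m * (gronwallConst m T * 2)

lemma _root_.MarkovRBSDE.jumpConst_ne_top (m : ℝ) (T : ℝ≥0) : jumpConst m T ≠ ∞ := by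
  have h := gronwallConst_ne_top m T
  unfold jumpConst
  finiteness

/-- The second moment of the total jump. -/
lemma lintegral_totalJump_sq_le [IsProbabilityMeasure P] {T : ℝ≥0} {m : ℝ} (hm : 0 < m)
    (hA : ∀ t ≤ T, matrixNorm (C.A t) ≤ m) (hZ : Measurable[C.filtration.predictable] Z) :
    ∫⁻ ω, C.totalJump Z T ω ^ 2 ∂P ≤ jumpConst m T
      * ∫⁻ ω, ∫⁻ s in Set.Ioc 0 T, ENNReal.ofReal (C.seminormSq s ω (Z (s, ω))) ∂lebesgue ∂P := by
  set Q := ∫⁻ ω, ∫⁻ s in Set.Ioc 0 T, ENNReal.ofReal (C.seminormSq s ω (Z (s, ω))) ∂lebesgue ∂P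
    with hQ
  have hmT : Measurable (C.totalJump Z T) :=
    (C.measurable_totalJump hZ T).mono (C.filtration.le T) le_rfl
  -- The truncation at n provides the finiteness needed by Gronwall's inequality. The constant does
  -- not depend on n, and monotone convergence removes the truncation.
  have key : ∀ n : ℕ, ∫⁻ ω, min (C.totalJump Z T ω) n ^ 2 ∂P ≤ jumpConst m T * Q := by
    intro n
    have hmx : Measurable fun p : ℝ≥0 × Ω => min (C.totalJumpLeft Z p) n ^ 2 :=
      (((C.measurable_totalJumpLeft hZ).mono predictable_le_prod le_rfl).min
        measurable_const).pow_const 2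
    have hg : ∫⁻ s in Set.Ioc 0 T, ∫⁻ ω, min (C.totalJumpLeft Z (s, ω)) n ^ 2 ∂P ∂lebesgue
        ≤ gronwallConst m T * (2 * Q) := by
      refine lintegral_le_of_le_forward hm hmx.lintegral_prod_right' (fun t ht => ?_) ?_
      · refine le_trans (le_of_eq (lintegral_congr_ae ?_))
          (C.lintegral_min_totalJump_sq_le hA hZ n ht.2)
        filter_upwards [C.ae_notMem_jumps_of_time t] with ω hω
        rw [C.totalJumpLeft_eq_totalJump fun h => h hω]
      · have hb : ∫⁻ s in Set.Ioc 0 T, ∫⁻ ω, min (C.totalJumpLeft Z (s, ω)) n ^ 2 ∂P ∂lebesgue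
            ≤ ∫⁻ _ in Set.Ioc 0 T, (n : ℝ≥0∞) ^ 2 ∂lebesgue := by
          refine lintegral_mono fun s => ?_
          calc _ ≤ ∫⁻ _, (n : ℝ≥0∞) ^ 2 ∂P :=
                lintegral_mono fun ω => pow_le_pow_left₀ zero_le (min_le_right _ _) 2
            _ = _ := by simp
        refine ne_top_of_le_ne_top ?_ hb
        rw [lintegral_const]
        exact ENNReal.mul_ne_top (by finiteness) (measure_ne_top _ _)
    refine (C.lintegral_min_totalJump_sq_le hA hZ n le_rfl).trans ?_
    calc _ ≤ 2 * Q + ENNReal.ofReal m * (gronwallConst m T * (2 * Q)) := by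
          gcongr
      _ = _ := by
          rw [jumpConst]
          ring
  have hsup : ∀ ω, C.totalJump Z T ω ^ 2 = ⨆ n : ℕ, min (C.totalJump Z T ω) n ^ 2 := fun ω => by
    rw [← ENNReal.iSup_pow_of_ne_zero two_ne_zero, ← inf_iSup_eq, ENNReal.iSup_natCast, inf_top_eq]
  simp_rw [hsup]
  rw [lintegral_iSup (fun n => (hmT.min measurable_const).pow_const 2)]
  · exact iSup_le key
  · intro n k hnk ω
    exact pow_le_pow_left₀ zero_le (min_le_min_left _ (by exact_mod_cast hnk)) 2

end MarkovChain

/-- The Cauchy-Schwarz inequality against the constant function. -/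
lemma setLIntegral_Ioc_sq_le {T : ℝ≥0} {g : ℝ≥0 → ℝ≥0∞} (hg : Measurable g) :
    (∫⁻ s in Set.Ioc 0 T, g s ∂lebesgue) ^ 2 ≤ T * ∫⁻ s in Set.Ioc 0 T, g s ^ 2 ∂lebesgue := by
  have h := ENNReal.lintegral_mul_le_Lp_mul_Lq (lebesgue.restrict (Set.Ioc 0 T))
    Real.HolderConjugate.two_two (f := fun _ => 1) (g := g) aemeasurable_const hg.aemeasurable
  simp only [Pi.mul_apply, one_mul, one_pow, lintegral_const, Measure.restrict_apply_univ,
    ENNReal.rpow_two] at h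
  refine (pow_le_pow_left₀ zero_le h 2).trans ?_
  have hsq : ∀ x : ℝ≥0∞, (x ^ (1 / 2 : ℝ)) ^ 2 = x := fun x => by
    rw [← ENNReal.rpow_two, ← ENNReal.rpow_mul]
    norm_num
  rw [mul_pow, hsq, hsq]
  gcongr
  exact lebesgue_Ioc_le 0 T

/-! ### The variation of v + k. -/

namespace SolutionPair

variable {Ω : Type*} [mΩ : MeasurableSpace Ω] {P : Measure Ω} {N : ℕ}
  {C : MarkovChain P N} {T : ℝ≥0} {c' c'' m : ℝ} (D : SolutionPair C T c' c'' m)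

lemma measurable_enorm_valueLeft : Measurable fun p => ‖D.valueLeft p‖ₑ :=
  (D.measurable_valueLeft.mono predictable_le_prod le_rfl).enorm

/-- A bound of the difference of the drifts. -/
noncomputable def driftSize (p : ℝ≥0 × Ω) : ℝ≥0∞ := ENNReal.ofReal c' * ‖D.valueLeft p‖ₑ
  + ENNReal.ofReal (c'' + √m) * ENNReal.ofReal (C.seminorm p.1 p.2 (D.diffZ p))

/-- The integral of `driftSize`. -/
noncomputable def driftVar (ω : Ω) : ℝ≥0∞ := ∫⁻ s in Set.Ioc 0 T, D.driftSize (s, ω) ∂lebesgue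

lemma measurable_driftSize : Measurable D.driftSize :=
  (D.measurable_enorm_valueLeft.const_mul _).add
    ((C.measurable_seminormSq predictable_le_prod
      (D.measurable_diffZ.mono predictable_le_prod le_rfl)).sqrt.ennreal_ofReal.const_mul _)

lemma measurable_driftVar : Measurable D.driftVar :=
  measurable_setLIntegral_lebesgue D.measurable_driftSize 0 T

lemma driftSize_sq_le (p : ℝ≥0 × Ω) : D.driftSize p ^ 2
    ≤ 2 * ENNReal.ofReal c' ^ 2 * ‖D.valueLeft p‖ₑ ^ 2
      + 2 * ENNReal.ofReal (c'' + √m) ^ 2 * D.diffSq p := by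
  have h : D.diffSq p = ENNReal.ofReal (C.seminorm p.1 p.2 (D.diffZ p)) ^ 2 := by
    rw [diffSq, MarkovChain.seminorm, ← ENNReal.ofReal_pow (Real.sqrt_nonneg _), Real.sq_sqrt]
    rw [C.seminormSq_eq]
    exact Finset.sum_nonneg fun j _ => mul_nonneg (C.intensity_nonneg _ _ _) (sq_nonneg _)
  rw [h]
  refine (add_sq_le_two_mul _ _).trans (le_of_eq ?_)
  ring

/-- With z already estimated, the crude Lipschitz bound suffices and the smallness condition plays
no role here. The compensator is at most √m ‖z‖ by Cauchy-Schwarz. -/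
lemma ae_enorm_diffDrift_le : ∀ᵐ ω ∂P, ∀ s ∈ Set.Ioc 0 T, s ∉ C.jumps ω →
    ‖D.diffDrift s ω‖ₑ ≤ D.driftSize (s, ω) := by
  filter_upwards [D.driver.lipschitz, D.ae_valueLeft_eq] with ω hlip hval s hs hsJ
  have h1 := hlip s hs.2 (D.V₁ s ω) (D.V₂ s ω) (D.Z₁ s ω) (D.Z₂ s ω)
  have h2 : D.diffDrift s ω = D.f s ω (D.V₁ s ω) (D.Z₁ s ω) - D.f s ω (D.V₂ s ω) (D.Z₂ s ω)
      + D.diffZ (s, ω) ⬝ᵥ (C.A s *ᵥ C.left s ω) := by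
    simp only [diffDrift, MarkovChain.drift, diffZ, sub_dotProduct]
    ring
  have h3 : |D.diffZ (s, ω) ⬝ᵥ (C.A s *ᵥ C.left s ω)|
      ≤ √m * C.seminorm s ω (D.diffZ (s, ω)) := by
    rw [MarkovChain.seminorm, ← Real.sqrt_mul D.rate_pos.le]
    exact Real.abs_le_sqrt (C.dotProduct_flow_sq_le (D.rate_le s hs.2) ω _)
  have hσ : 0 ≤ C.seminorm s ω (D.diffZ (s, ω)) := Real.sqrt_nonneg _
  have h4 : |D.diffDrift s ω| ≤ c' * |D.valueLeft (s, ω)|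
      + (c'' + √m) * C.seminorm s ω (D.diffZ (s, ω)) := by
    rw [h2, hval s hs hsJ]
    refine (abs_add_le _ _).trans ((add_le_add h1 h3).trans (le_of_eq ?_))
    simp only [diffZ]
    ring
  have hc := D.lip_nonneg
  have hc' : 0 ≤ c'' + √m := add_nonneg D.lip_nonneg' (Real.sqrt_nonneg _)
  rw [driftSize, Real.enorm_eq_ofReal_abs, Real.enorm_eq_ofReal_abs, ← ENNReal.ofReal_mul hc,
    ← ENNReal.ofReal_mul hc', ← ENNReal.ofReal_add (by positivity) (mul_nonneg hc' hσ)]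
  exact ENNReal.ofReal_le_ofReal h4

/-- The variation of the difference of the values, without the pushes. -/
noncomputable def freeVar (ω : Ω) : ℝ≥0∞ :=
  D.driftVar ω + (D.pertVar ω + C.totalJump D.diffZ T ω)

/-- The pushes cancel in v + k: its increments consist of drift, perturbation and jumps. A single
random variable therefore bounds all of them, uniformly in the two times. -/
lemma ae_enorm_free_sub_le : ∀ᵐ ω ∂P, ∀ a b, a ≤ b → b ≤ T →
    ‖(D.V₁ a ω - D.V₂ a ω + (D.K₁ a ω - D.K₂ a ω))
      - (D.V₁ b ω - D.V₂ b ω + (D.K₁ b ω - D.K₂ b ω))‖ₑ ≤ D.freeVar ω := by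
  filter_upwards [D.sol₁.ae_sub_eq D.rate_le D.driver D.pert₁,
    D.sol₂.ae_sub_eq D.rate_le D.driver D.pert₂, D.driver.ae_integrableOn D.sol₁.memV D.sol₁.memZ,
    D.sol₁.memZ.ae_integrableOn_flow D.rate_le, D.pert₁.ae_integrableOn,
    D.driver.ae_integrableOn D.sol₂.memV D.sol₂.memZ,
    D.sol₂.memZ.ae_integrableOn_flow D.rate_le, D.pert₂.ae_integrableOn, D.ae_enorm_diffDrift_le]
    with ω h1 h2 hf1 hZ1 hφ1 hf2 hZ2 hφ2 hd a b hab hbT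
  have hsub : Set.Ioc a b ⊆ Set.Ioc 0 T := Set.Ioc_subset_Ioc zero_le hbT
  have hi1 : IntegrableOn (fun s => C.drift D.f D.V₁ D.Z₁ s ω + D.φ₁ s ω) (Set.Ioc a b) lebesgue :=
    ((hf1.add hZ1).add hφ1).mono_set hsub
  have hi2 : IntegrableOn (fun s => C.drift D.f D.V₂ D.Z₂ s ω + D.φ₂ s ω) (Set.Ioc a b) lebesgue :=
    ((hf2.add hZ2).add hφ2).mono_set hsub
  have e : (D.V₁ a ω - D.V₂ a ω + (D.K₁ a ω - D.K₂ a ω))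
      - (D.V₁ b ω - D.V₂ b ω + (D.K₁ b ω - D.K₂ b ω))
      = ∫ s in Set.Ioc a b, (D.diffDrift s ω + (D.φ₁ s ω - D.φ₂ s ω)) ∂lebesgue
        - ∑ s ∈ (C.finite_jumps_Ioc a b ω).toFinset,
          D.diffZ (s, ω) ⬝ᵥ (C.X s ω - C.left s ω) := by
    have e1 : ∫ s in Set.Ioc a b, (D.diffDrift s ω + (D.φ₁ s ω - D.φ₂ s ω)) ∂lebesgue
        = ∫ s in Set.Ioc a b, (C.drift D.f D.V₁ D.Z₁ s ω + D.φ₁ s ω) ∂lebesgue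
          - ∫ s in Set.Ioc a b, (C.drift D.f D.V₂ D.Z₂ s ω + D.φ₂ s ω) ∂lebesgue := by
      rw [← integral_sub hi1 hi2]
      refine integral_congr_ae (Eventually.of_forall fun s => ?_)
      simp only [diffDrift]
      ring
    simp only [diffZ, sub_dotProduct, Finset.sum_sub_distrib]
    rw [e1]
    linarith [h1 a b hab hbT, h2 a b hab hbT]
  have hI : ‖∫ s in Set.Ioc a b, (D.diffDrift s ω + (D.φ₁ s ω - D.φ₂ s ω)) ∂lebesgue‖ₑ
      ≤ D.driftVar ω + D.pertVar ω := by
    calc _ ≤ ∫⁻ s in Set.Ioc 0 T, ‖D.diffDrift s ω + (D.φ₁ s ω - D.φ₂ s ω)‖ₑ ∂lebesgue :=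
          (enorm_integral_le_lintegral_enorm _).trans (lintegral_mono_set hsub)
      _ ≤ ∫⁻ s in Set.Ioc 0 T, (D.driftSize (s, ω) + ‖D.φ₁ s ω - D.φ₂ s ω‖ₑ) ∂lebesgue := by
          refine setLIntegral_mono_ae' measurableSet_Ioc ?_
          filter_upwards [C.ae_notMem_jumps ω] with s hsJ hs
          exact (enorm_add_le _ _).trans (add_le_add (hd s hs hsJ) le_rfl)
      _ = _ := lintegral_add_left (measurable_section D.measurable_driftSize ω) _
  have hS : ‖∑ s ∈ (C.finite_jumps_Ioc a b ω).toFinset,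
      D.diffZ (s, ω) ⬝ᵥ (C.X s ω - C.left s ω)‖ₑ ≤ C.totalJump D.diffZ T ω := by
    refine (enorm_sum_le _ _).trans (Finset.sum_le_sum_of_subset ?_)
    exact Set.Finite.toFinset_subset_toFinset.2 (Set.inter_subset_inter_right _ hsub)
  rw [e, freeVar, ← add_assoc]
  exact enorm_sub_le.trans (add_le_add hI hS)

end SolutionPair

/-- The factor in the estimate of the integrated drift. -/
noncomputable def driftConst (c' c'' m : ℝ) (T : ℝ≥0) : ℝ≥0∞ :=
  T * (2 * ENNReal.ofReal c' ^ 2 * (2 * energyConst c' m T + 2 * T)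
    + 2 * ENNReal.ofReal (c'' + √m) ^ 2 * integrandConst c' m T)

lemma driftConst_ne_top (c' c'' m : ℝ) (T : ℝ≥0) : driftConst c' c'' m T ≠ ∞ := by
  have h1 := integrandConst_ne_top c' m T
  have h2 := energyConst_ne_top c' m T
  unfold driftConst
  finiteness

/-- The factor in the estimate of the variation without the pushes. -/
noncomputable def freeConst (c' c'' m : ℝ) (T : ℝ≥0) : ℝ≥0∞ :=
  2 * driftConst c' c'' m T + 4 * (1 + jumpConst m T * integrandConst c' m T)

lemma freeConst_ne_top (c' c'' m : ℝ) (T : ℝ≥0) : freeConst c' c'' m T ≠ ∞ := by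
  have h1 := integrandConst_ne_top c' m T
  have h2 := driftConst_ne_top c' c'' m T
  have h3 := jumpConst_ne_top m T
  unfold freeConst
  finiteness

/-! ### Second moments of the variation, of the pushes and of sup |v + k|. -/

namespace SolutionPair

variable {Ω : Type*} [mΩ : MeasurableSpace Ω] {P : Measure Ω} {N : ℕ}
  {C : MarkovChain P N} {T : ℝ≥0} {c' c'' m : ℝ} (D : SolutionPair C T c' c'' m)

lemma lintegral_valueLeft_sq_le [IsProbabilityMeasure P] (hdata : ∫⁻ ω, D.data ω ∂P ≠ ∞) :
    ∫⁻ ω, ∫⁻ s in Set.Ioc 0 T, ‖D.valueLeft (s, ω)‖ₑ ^ 2 ∂lebesgue ∂P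
      ≤ (2 * energyConst c' m T + 2 * T) * ∫⁻ ω, D.data ω ∂P := by
  calc _ ≤ ∫⁻ ω, ∫⁻ s in Set.Ioc 0 T, (2 * D.energy (s, ω) + 2 * D.pertVar ω ^ 2)
        ∂lebesgue ∂P := by
        refine lintegral_setLIntegral_mono (F := fun p => ‖D.valueLeft p‖ₑ ^ 2)
          (F' := fun p => 2 * D.energy p + 2 * D.pertVar p.2 ^ 2) ?_
        filter_upwards [D.ae_enorm_valueLeft_sq_le] with ω hω
        filter_upwards [C.ae_notMem_jumps ω] with s hsJ hs using hω s hs hsJ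
    _ = 2 * ∫⁻ ω, ∫⁻ s in Set.Ioc 0 T, D.energy (s, ω) ∂lebesgue ∂P
        + 2 * ∫⁻ ω, ∫⁻ s in Set.Ioc 0 T, D.pertVar ω ^ 2 ∂lebesgue ∂P := by
        rw [lintegral_setLIntegral_add (F := fun p => 2 * D.energy p)
            (F' := fun p => 2 * D.pertVar p.2 ^ 2) (D.measurable_energy.const_mul 2),
          lintegral_setLIntegral_const_mul ENNReal.ofNat_ne_top (F := D.energy),
          lintegral_setLIntegral_const_mul ENNReal.ofNat_ne_top (F := fun p => D.pertVar p.2 ^ 2)]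
    _ ≤ 2 * (energyConst c' m T * ∫⁻ ω, D.data ω ∂P) + 2 * (T * ∫⁻ ω, D.data ω ∂P) := by
        gcongr
        · exact D.lintegral_energy_le hdata
        · rw [← lintegral_const_mul' _ _ ENNReal.coe_ne_top]
          refine lintegral_mono fun ω => ?_
          rw [lintegral_const, Measure.restrict_apply_univ, mul_comm]
          exact mul_le_mul' (lebesgue_Ioc_le 0 T) (D.pertVar_sq_le ω)
    _ = _ := by ring

lemma lintegral_driftVar_sq_le [IsProbabilityMeasure P] (hdata : ∫⁻ ω, D.data ω ∂P ≠ ∞) :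
    ∫⁻ ω, D.driftVar ω ^ 2 ∂P ≤ driftConst c' c'' m T * ∫⁻ ω, D.data ω ∂P := by
  calc _ ≤ ∫⁻ ω, T * ∫⁻ s in Set.Ioc 0 T, D.driftSize (s, ω) ^ 2 ∂lebesgue ∂P :=
        lintegral_mono fun ω => setLIntegral_Ioc_sq_le (measurable_section D.measurable_driftSize ω)
    _ = T * ∫⁻ ω, ∫⁻ s in Set.Ioc 0 T, D.driftSize (s, ω) ^ 2 ∂lebesgue ∂P :=
        lintegral_const_mul' _ _ ENNReal.coe_ne_top
    _ ≤ T * ∫⁻ ω, ∫⁻ s in Set.Ioc 0 T, (2 * ENNReal.ofReal c' ^ 2 * ‖D.valueLeft (s, ω)‖ₑ ^ 2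
      + 2 * ENNReal.ofReal (c'' + √m) ^ 2 * D.diffSq (s, ω)) ∂lebesgue ∂P := by
        gcongr
        exact D.driftSize_sq_le _
    _ = T * (2 * ENNReal.ofReal c' ^ 2
          * ∫⁻ ω, ∫⁻ s in Set.Ioc 0 T, ‖D.valueLeft (s, ω)‖ₑ ^ 2 ∂lebesgue ∂P
        + 2 * ENNReal.ofReal (c'' + √m) ^ 2
          * ∫⁻ ω, ∫⁻ s in Set.Ioc 0 T, D.diffSq (s, ω) ∂lebesgue ∂P) := by
        rw [lintegral_setLIntegral_add
            (F := fun p => 2 * ENNReal.ofReal c' ^ 2 * ‖D.valueLeft p‖ₑ ^ 2)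
            (F' := fun p => 2 * ENNReal.ofReal (c'' + √m) ^ 2 * D.diffSq p)
            ((D.measurable_enorm_valueLeft.pow_const 2).const_mul _),
          lintegral_setLIntegral_const_mul (by finiteness) (F := fun p => ‖D.valueLeft p‖ₑ ^ 2),
          lintegral_setLIntegral_const_mul (by finiteness) (F := D.diffSq)]
    _ ≤ T * (2 * ENNReal.ofReal c' ^ 2
          * ((2 * energyConst c' m T + 2 * T) * ∫⁻ ω, D.data ω ∂P)
        + 2 * ENNReal.ofReal (c'' + √m) ^ 2
          * (integrandConst c' m T * ∫⁻ ω, D.data ω ∂P)) := by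
        gcongr
        · exact D.lintegral_valueLeft_sq_le hdata
        · exact D.lintegral_diffSq_le hdata
    _ = _ := by
        rw [driftConst]
        ring

lemma measurable_totalJump_diffZ : Measurable (C.totalJump D.diffZ T) :=
  (C.measurable_totalJump D.measurable_diffZ T).mono (C.filtration.le T) le_rfl

lemma measurable_freeVar : Measurable D.freeVar :=
  D.measurable_driftVar.add (D.measurable_pertVar.add D.measurable_totalJump_diffZ)

lemma lintegral_freeVar_sq_le [IsProbabilityMeasure P] (hdata : ∫⁻ ω, D.data ω ∂P ≠ ∞) :
    ∫⁻ ω, D.freeVar ω ^ 2 ∂P ≤ freeConst c' c'' m T * ∫⁻ ω, D.data ω ∂P := by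
  calc _ ≤ ∫⁻ ω, (2 * D.driftVar ω ^ 2
        + (4 * D.pertVar ω ^ 2 + 4 * C.totalJump D.diffZ T ω ^ 2)) ∂P := by
        refine lintegral_mono fun ω => (add_sq_le_two_mul _ _).trans (add_le_add le_rfl ?_)
        calc _ ≤ 2 * (2 * D.pertVar ω ^ 2 + 2 * C.totalJump D.diffZ T ω ^ 2) := by
              gcongr
              exact add_sq_le_two_mul _ _
          _ = _ := by ring
    _ = 2 * ∫⁻ ω, D.driftVar ω ^ 2 ∂P
        + (4 * ∫⁻ ω, D.pertVar ω ^ 2 ∂P + 4 * ∫⁻ ω, C.totalJump D.diffZ T ω ^ 2 ∂P) := by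
        rw [lintegral_add_left ((D.measurable_driftVar.pow_const 2).const_mul 2),
          lintegral_add_left ((D.measurable_pertVar.pow_const 2).const_mul 4),
          lintegral_const_mul' _ _ ENNReal.ofNat_ne_top,
          lintegral_const_mul' _ _ ENNReal.ofNat_ne_top,
          lintegral_const_mul' _ _ ENNReal.ofNat_ne_top]
    _ ≤ 2 * (driftConst c' c'' m T * ∫⁻ ω, D.data ω ∂P) + (4 * ∫⁻ ω, D.data ω ∂P
        + 4 * (jumpConst m T * (integrandConst c' m T * ∫⁻ ω, D.data ω ∂P))) := by
        gcongr
        · exact D.lintegral_driftVar_sq_le hdata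
        · exact D.pertVar_sq_le _
        · exact (C.lintegral_totalJump_sq_le D.rate_pos D.rate_le D.measurable_diffZ).trans
            (mul_le_mul' le_rfl (D.lintegral_diffSq_le hdata))
    _ = _ := by
        rw [freeConst]
        ring

lemma measurable_value {t : ℝ≥0} (ht : t ≤ T) : Measurable fun ω => D.V₁ t ω - D.V₂ t ω :=
  ((D.sol₁.memV.adapted t ht).sub (D.sol₂.memV.adapted t ht)).mono (C.filtration.le t) le_rfl

/-- The estimate of the difference of the pushes. -/
lemma lintegral_push_sq_le [IsProbabilityMeasure P] (hdata : ∫⁻ ω, D.data ω ∂P ≠ ∞)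
    {t : ℝ≥0} (ht : t ≤ T) :
    ∫⁻ ω, ‖(D.K₁ T ω - D.K₂ T ω) - (D.K₁ t ω - D.K₂ t ω)‖ₑ ^ 2 ∂P
      ≤ (2 * freeConst c' c'' m T + 8 * (timeConst c' m T + 2)) * ∫⁻ ω, D.data ω ∂P := by
  calc _ ≤ ∫⁻ ω, (2 * D.freeVar ω ^ 2 + (4 * ‖D.V₁ t ω - D.V₂ t ω‖ₑ ^ 2
        + 4 * ‖D.V₁ T ω - D.V₂ T ω‖ₑ ^ 2)) ∂P := by
        refine lintegral_mono_ae ?_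
        filter_upwards [D.ae_enorm_free_sub_le] with ω h
        -- Use k = (v + k) - v: the increment of v + k is bounded by `freeVar`, and v is estimated
        -- at each of the two times.
        have e : (D.K₁ T ω - D.K₂ T ω) - (D.K₁ t ω - D.K₂ t ω)
            = ((D.V₁ t ω - D.V₂ t ω) - (D.V₁ T ω - D.V₂ T ω))
              - ((D.V₁ t ω - D.V₂ t ω + (D.K₁ t ω - D.K₂ t ω))
                - (D.V₁ T ω - D.V₂ T ω + (D.K₁ T ω - D.K₂ T ω))) := by ring
        rw [e]
        refine (enorm_sub_sq_le _ _).trans ?_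
        rw [add_comm]
        refine add_le_add ?_ ?_
        · gcongr
          exact h t T ht le_rfl
        · calc _ ≤ 2 * (2 * ‖D.V₁ t ω - D.V₂ t ω‖ₑ ^ 2 + 2 * ‖D.V₁ T ω - D.V₂ T ω‖ₑ ^ 2) := by
                gcongr
                exact enorm_sub_sq_le _ _
            _ = _ := by ring
    _ = 2 * ∫⁻ ω, D.freeVar ω ^ 2 ∂P + (4 * ∫⁻ ω, ‖D.V₁ t ω - D.V₂ t ω‖ₑ ^ 2 ∂P
        + 4 * ∫⁻ ω, ‖D.V₁ T ω - D.V₂ T ω‖ₑ ^ 2 ∂P) := by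
        rw [lintegral_add_left ((D.measurable_freeVar.pow_const 2).const_mul 2),
          lintegral_add_left (((D.measurable_value ht).enorm.pow_const 2).const_mul 4),
          lintegral_const_mul' _ _ ENNReal.ofNat_ne_top,
          lintegral_const_mul' _ _ ENNReal.ofNat_ne_top,
          lintegral_const_mul' _ _ ENNReal.ofNat_ne_top]
    _ ≤ 2 * (freeConst c' c'' m T * ∫⁻ ω, D.data ω ∂P)
        + (4 * ((timeConst c' m T + 2) * ∫⁻ ω, D.data ω ∂P)
          + 4 * ((timeConst c' m T + 2) * ∫⁻ ω, D.data ω ∂P)) := by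
        gcongr
        · exact D.lintegral_freeVar_sq_le hdata
        · exact D.lintegral_value_sq_le hdata ht
        · exact D.lintegral_value_sq_le hdata le_rfl
    _ = _ := by ring

/-- The uniform estimate of the sum of the differences of the values and of the pushes. -/
lemma lintegral_iSup_free_sq_le [IsProbabilityMeasure P] (hdata : ∫⁻ ω, D.data ω ∂P ≠ ∞) :
    ∫⁻ ω, ⨆ t ∈ Set.Icc 0 T, ‖D.V₁ t ω - D.V₂ t ω + (D.K₁ t ω - D.K₂ t ω)‖ₑ ^ 2 ∂P
      ≤ (2 * freeConst c' c'' m T + 2 * (timeConst c' m T + 2)) * ∫⁻ ω, D.data ω ∂P := by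
  calc _ ≤ ∫⁻ ω, (2 * D.freeVar ω ^ 2 + 2 * ‖D.V₁ 0 ω - D.V₂ 0 ω‖ₑ ^ 2) ∂P := by
        refine lintegral_mono_ae ?_
        filter_upwards [D.ae_enorm_free_sub_le, D.sol₁.zero, D.sol₂.zero] with ω h hK1 hK2
        refine iSup₂_le fun t ht => ?_
        -- Start from the time 0, where k vanishes and v has its estimate at a fixed time; the
        -- remaining increment is bounded uniformly in t.
        have e : D.V₁ t ω - D.V₂ t ω + (D.K₁ t ω - D.K₂ t ω) = (D.V₁ 0 ω - D.V₂ 0 ω)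
            - ((D.V₁ 0 ω - D.V₂ 0 ω + (D.K₁ 0 ω - D.K₂ 0 ω))
              - (D.V₁ t ω - D.V₂ t ω + (D.K₁ t ω - D.K₂ t ω))) := by
          rw [hK1, hK2]
          ring
        rw [e]
        refine (enorm_sub_sq_le _ _).trans ?_
        rw [add_comm]
        gcongr
        exact h 0 t zero_le ht.2
    _ = 2 * ∫⁻ ω, D.freeVar ω ^ 2 ∂P + 2 * ∫⁻ ω, ‖D.V₁ 0 ω - D.V₂ 0 ω‖ₑ ^ 2 ∂P := by
        rw [lintegral_add_left ((D.measurable_freeVar.pow_const 2).const_mul 2),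
          lintegral_const_mul' _ _ ENNReal.ofNat_ne_top,
          lintegral_const_mul' _ _ ENNReal.ofNat_ne_top]
    _ ≤ 2 * (freeConst c' c'' m T * ∫⁻ ω, D.data ω ∂P)
        + 2 * ((timeConst c' m T + 2) * ∫⁻ ω, D.data ω ∂P) := by
        gcongr
        · exact D.lintegral_freeVar_sq_le hdata
        · exact D.lintegral_value_sq_le hdata zero_le
    _ = _ := by ring

end SolutionPair

/-- The factor of the data in the stability estimates. -/
noncomputable def stabilityConst (c' c'' m : ℝ) (T : ℝ≥0) : ℝ≥0∞ :=
  9 * (timeConst c' m T + 2) + integrandConst c' m T + 2 * freeConst c' c'' m T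

lemma stabilityConst_ne_top (c' c'' m : ℝ) (T : ℝ≥0) : stabilityConst c' c'' m T ≠ ∞ := by
  have h1 := integrandConst_ne_top c' m T
  have h2 := timeConst_ne_top c' m T
  have h3 := freeConst_ne_top c' c'' m T
  unfold stabilityConst
  finiteness

/-! ### The two stability estimates. -/

namespace SolutionPair

variable {Ω : Type*} [mΩ : MeasurableSpace Ω] {P : Measure Ω} {N : ℕ}
  {C : MarkovChain P N} {T : ℝ≥0} {c' c'' m : ℝ} (D : SolutionPair C T c' c'' m)

lemma iSup_lintegral_add_le [IsProbabilityMeasure P] (hdata : ∫⁻ ω, D.data ω ∂P ≠ ∞) :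
    (⨆ t ∈ Set.Icc 0 T, ∫⁻ ω, ‖D.V₁ t ω - D.V₂ t ω‖ₑ ^ 2 ∂P)
        + (∫⁻ ω, ∫⁻ s in Set.Ioc 0 T, D.diffSq (s, ω) ∂lebesgue ∂P)
        + (⨆ t ∈ Set.Icc 0 T,
          ∫⁻ ω, ‖(D.K₁ T ω - D.K₂ T ω) - (D.K₁ t ω - D.K₂ t ω)‖ₑ ^ 2 ∂P)
      ≤ stabilityConst c' c'' m T * ∫⁻ ω, D.data ω ∂P := by
  calc _ ≤ (timeConst c' m T + 2) * ∫⁻ ω, D.data ω ∂P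
        + integrandConst c' m T * ∫⁻ ω, D.data ω ∂P
        + (2 * freeConst c' c'' m T + 8 * (timeConst c' m T + 2)) * ∫⁻ ω, D.data ω ∂P :=
        add_le_add (add_le_add (iSup₂_le fun t ht => D.lintegral_value_sq_le hdata ht.2)
          (D.lintegral_diffSq_le hdata)) (iSup₂_le fun t ht => D.lintegral_push_sq_le hdata ht.2)
    _ = _ := by
        rw [stabilityConst]
        ring

/-- The stability estimate uniformly in time. -/
lemma lintegral_iSup_add_le [IsProbabilityMeasure P] (hdata : ∫⁻ ω, D.data ω ∂P ≠ ∞) :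
    ∫⁻ ω, ((⨆ t ∈ Set.Icc 0 T, ‖D.V₁ t ω - D.V₂ t ω + (D.K₁ t ω - D.K₂ t ω)‖ₑ ^ 2)
        + ∫⁻ s in Set.Ioc 0 T, D.diffSq (s, ω) ∂lebesgue) ∂P
      ≤ stabilityConst c' c'' m T * ∫⁻ ω, D.data ω ∂P := by
  -- No measurability of the supremum over all times is at hand, so the integral is split through
  -- the measurability of the other summand.
  rw [lintegral_add_right _ (measurable_setLIntegral_lebesgue D.measurable_diffSq 0 T)]
  refine (add_le_add (D.lintegral_iSup_free_sq_le hdata) (D.lintegral_diffSq_le hdata)).trans ?_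
  rw [← add_mul]
  gcongr
  -- The factor 9 = 1 + 8 in the common constant is what the first estimate needs; the second uses
  -- only 2, and the other 7 are slack.
  calc _ ≤ 2 * freeConst c' c'' m T + 2 * (timeConst c' m T + 2) + integrandConst c' m T
        + 7 * (timeConst c' m T + 2) := le_self_add
    _ = _ := by
        rw [stabilityConst]
        ring

end SolutionPair

end MarkovRBSDE

theorem proposition4p1 (c' c'' m : ℝ) (hc' : 0 ≤ c') (hc'' : 0 ≤ c'') (hm : 0 < m) (T : ℝ≥0) :
    ∃ Cbar : ℝ≥0, 0 < Cbar ∧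
      ∀ {Ω : Type*} [MeasurableSpace Ω] (P : Measure Ω) [IsProbabilityMeasure P] (N : ℕ)
        (C : MarkovRBSDE.MarkovChain P N)
        (_ : ∀ t ≤ T, MarkovRBSDE.matrixNorm (C.A t) ≤ m)
        (f : ℝ≥0 → Ω → ℝ → (Fin N → ℝ) → ℝ) (_ : C.IsDriver T c' c'' m f)
        (ξ₁ ξ₂ : Ω → ℝ) (_ : C.InL2 T ξ₁) (_ : C.InL2 T ξ₂)
        (φ₁ φ₂ : ℝ≥0 → Ω → ℝ) (_ : C.IsPerturbation T φ₁) (_ : C.IsPerturbation T φ₂)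
        (G₁ G₂ : ℝ≥0 → Ω → ℝ) (_ : C.IsObstacle T G₁) (_ : C.IsObstacle T G₂)
        (V₁ V₂ : ℝ≥0 → Ω → ℝ) (Z₁ Z₂ : ℝ≥0 → Ω → (Fin N → ℝ)) (K₁ K₂ : ℝ≥0 → Ω → ℝ)
        (_ : MarkovRBSDE.IsRBSDESolution C T (fun s ω v z => f s ω v z + φ₁ s ω) ξ₁ G₁ V₁ Z₁ K₁)
        (_ : MarkovRBSDE.IsRBSDESolution C T (fun s ω v z => f s ω v z + φ₂ s ω) ξ₂ G₂ V₂ Z₂ K₂)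
        (v k : ℝ≥0 → Ω → ℝ) (z : ℝ≥0 → Ω → (Fin N → ℝ))
        (_ : v = V₁ - V₂) (_ : z = Z₁ - Z₂) (_ : k = K₁ - K₂),
        ((⨆ t ∈ Set.Icc 0 T, ∫⁻ ω, ‖v t ω‖ₑ ^ 2 ∂P)
            + (∫⁻ ω, ∫⁻ s in Set.Icc 0 T,
                ENNReal.ofReal (C.seminormSq s ω (z s ω)) ∂MarkovRBSDE.lebesgue ∂P)
            + (⨆ t ∈ Set.Icc 0 T, ∫⁻ ω, ‖k T ω - k t ω‖ₑ ^ 2 ∂P)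
          ≤ Cbar * ∫⁻ ω, (‖ξ₁ ω - ξ₂ ω‖ₑ ^ 2
              + (∫⁻ s in Set.Icc 0 T, ‖φ₁ s ω - φ₂ s ω‖ₑ ∂MarkovRBSDE.lebesgue) ^ 2
              + ⨆ t ∈ Set.Icc 0 T, ‖G₁ t ω - G₂ t ω‖ₑ ^ 2) ∂P) ∧
        ((∫⁻ ω, ((⨆ t ∈ Set.Icc 0 T, ‖v t ω + k t ω‖ₑ ^ 2)
            + ∫⁻ s in Set.Icc 0 T,
                ENNReal.ofReal (C.seminormSq s ω (z s ω)) ∂MarkovRBSDE.lebesgue) ∂P)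
          ≤ Cbar * ∫⁻ ω, (‖ξ₁ ω - ξ₂ ω‖ₑ ^ 2
              + (∫⁻ s in Set.Icc 0 T, ‖φ₁ s ω - φ₂ s ω‖ₑ ∂MarkovRBSDE.lebesgue) ^ 2
              + ⨆ t ∈ Set.Icc 0 T, ‖G₁ t ω - G₂ t ω‖ₑ ^ 2) ∂P) := by
  -- Adding 1 guarantees a positive constant, so that infinite data make the right-hand side
  -- infinite and the claim trivial.
  refine ⟨(MarkovRBSDE.stabilityConst c' c'' m T).toNNReal + 1, by positivity, ?_⟩
  intro Ω _ P _ N C hA f hf ξ₁ ξ₂ hξ₁ hξ₂ φ₁ φ₂ hφ₁ hφ₂ G₁ G₂ hG₁ hG₂ V₁ V₂ Z₁ Z₂ K₁ K₂ h₁ h₂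
    v k z hv hz hk
  subst hv hz hk
  let D : MarkovRBSDE.SolutionPair C T c' c'' m :=
    { f := f, ξ₁ := ξ₁, ξ₂ := ξ₂, φ₁ := φ₁, φ₂ := φ₂, G₁ := G₁, G₂ := G₂, V₁ := V₁, V₂ := V₂,
      Z₁ := Z₁, Z₂ := Z₂, K₁ := K₁, K₂ := K₂, lip_nonneg := hc', lip_nonneg' := hc'',
      rate_pos := hm, rate_le := hA, driver := hf, terminal₁ := hξ₁, terminal₂ := hξ₂,
      pert₁ := hφ₁, pert₂ := hφ₂, obst₁ := hG₁, obst₂ := hG₂, sol₁ := h₁, sol₂ := h₂ }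
  simp only [MarkovRBSDE.restrict_Icc_eq_restrict_Ioc, Pi.sub_apply]
  have hle : MarkovRBSDE.stabilityConst c' c'' m T
      ≤ (((MarkovRBSDE.stabilityConst c' c'' m T).toNNReal + 1 : ℝ≥0) : ℝ≥0∞) := by
    rw [ENNReal.coe_add, ENNReal.coe_toNNReal (MarkovRBSDE.stabilityConst_ne_top c' c'' m T)]
    exact le_self_add
  by_cases hdata : ∫⁻ ω, D.data ω ∂P = ∞
  · have htop : (((MarkovRBSDE.stabilityConst c' c'' m T).toNNReal + 1 : ℝ≥0) : ℝ≥0∞)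
        * ∫⁻ ω, D.data ω ∂P = ∞ := by
      rw [hdata]
      exact ENNReal.mul_top (by simp)
    exact ⟨le_top.trans_eq htop.symm, le_top.trans_eq htop.symm⟩
  · exact ⟨(D.iSup_lintegral_add_le hdata).trans (mul_le_mul' hle le_rfl),
      (D.lintegral_iSup_add_le hdata).trans (mul_le_mul' hle le_rfl)⟩
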